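/- **Conventions.** A (binary) constraint graph $G=(V,E,\Sigma,\Pi)$ consists of a finite non-empty undirected multigraph $(V,E)$ (self-loops and parallel edges allowed; a self-loop counts twice in the degree and contributes $2$ to the diagonal of the adjacency matrix), a finite alphabet $\Sigma$, and for each edge $e$ a set $\pi_e$ of acceptable pairs of values of its endpoints. For $\psi\colon V\to\Sigma$ let $\mathrm{val}_G(\psi)$ be the fraction of edges satisfied by $\psi$, and let $\mathrm{val}_G(\psi^{\mathsf{ini}}\leftrightsquigarrow\psi^{\mathsf{tar}})$ be the maximum, over all finite sequences of assignments from $\psi^{\mathsf{ini}}$ to $\psi^{\mathsf{tar}}$ in which neighbouring assignments differ in at most one vertex, of the minimum of $\mathrm{val}_G$ along the sequence. In $\mathrm{Gap}_{c,s}$ $2$-$\mathrm{CSP}_W$ Reconfiguration an instance is $(G;\psi^{\mathsf{ini}},\psi^{\mathsf{tar}})$ with $|\Sigma|=W$; it is a yes-instance if $\mathrm{val}_G(\psi^{\mathsf{ini}}\leftrightsquigarrow\psi^{\mathsf{tar}})\ge c$ and a no-instance if this value is $<s$. For an integer $d$ and a real $\lambda<d$, a $(d,\lambda)$-expander is a $d$-regular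 graph whose adjacency matrix $A$ satisfies $\max_{x\ne 0,\ x\perp \mathbf 1}\|Ax\|_2/\|x\|_2\le\lambda$ (the maximum is read as $0$ for one-vertex graphs). A gap-preserving reduction is a polynomial-time computable map from instances to instances that sends yes-instances to yes-instances and no-instances to no-instances. **Lemma 3.3 (Gap amplification lemma).** There are a universal constant $C>0$ and a function $W'=W'(\varepsilon,W,d)$ with positive integer values satisfying $$W'(\varepsilon,W,d)\le W^{\,d^{\,C/\varepsilon}}$$ for all reals $\varepsilon\in(0,1)$ and all positive integers $W,d$ (that is, $W'=W^{d^{O(1/\varepsilon)}}$) such that the following holds. For every real $\varepsilon\in(0,1)$, every positive integer $d$ and every real $\lambda$ with $0<\lambda\le d/2$ there are a positive integer $d'$ and a real $\lambda'$ with $0\le\lambda'<d'$, depending only on $\varepsilon,d,\lambda$, such that $$\frac{\lambda'}{d'}\le\frac{4^{100}}{100}\cdot\frac{\lambda}{d},$$ and for every positive integer $W$ there is a (polynomial-time) gap-preserving reduction from $\mathrm{Gap}_{1,1-\varepsilon}$ $2$-$\mathrm{CSP}_W$ Reconfiguration whose underlying graph is a $(d,\lambda)$-expander to $\mathrm{Gap}_{1,1-\varepsilon'}$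 $2$-$\mathrm{CSP}_{W'}$ Reconfiguration, $W'=W'(\varepsilon,W,d)$, whose underlying graph is a $(d',\lambda')$-expander, where $$\varepsilon'=\frac{0.0294}{3+2\frac{d}{d-\lambda}}.$$ -/

import Mathlib

/-! ### Polynomial time

Data are finite binary trees (`BinaryTree Unit`).  Programs are the while programs over binary trees
(constants, `cons`, `hd`, `tl`, equality test, sequencing, branching, `while`), in point-free form:
a program transforms one tree, and several variables are kept in one tree by pairing. -/

/-- The data of the machine model: unlabelled binary trees. -/
abbrev Data : Type := BinaryTree Unit

/-- The tree with the two given subtrees. -/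
def Data.cons (l r : Data) : Data := BinaryTree.node () l r

/-- The truth values: `nil` is false, and the one-node tree is true. -/
def Data.ofBool (b : Bool) : Data := if b then Data.cons .nil .nil else .nil

/-- While programs over binary trees. -/
inductive Prog : Type
  | const (c : Data)
  | id
  | hd
  | tl
  | eq
  | pair (p q : Prog)
  | seq (p q : Prog)
  | ite (c p q : Prog)
  | while (c p : Prog)

/-- `p.Runs x y t`: on input `x` the program `p` halts with output `y` after `t` time units.
Every executed operation is charged one unit plus the sizes of the tree it is applied to and of the
tree it returns, so copying, comparing and building trees is paid for symbol by symbol; this time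
measure agrees with that of multitape Turing machines up to a polynomial. -/
inductive Prog.Runs : Prog → Data → Data → ℕ → Prop
  | const (c x : Data) : Runs (.const c) x c (1 + x.numNodes + c.numNodes)
  | id (x : Data) : Runs .id x x (1 + x.numNodes + x.numNodes)
  | hd (x : Data) : Runs .hd x x.left (1 + x.numNodes + x.left.numNodes)
  | tl (x : Data) : Runs .tl x x.right (1 + x.numNodes + x.right.numNodes)
  | eq (x : Data) : Runs .eq x (Data.ofBool (decide (x.left = x.right)))
      (1 + x.numNodes + (Data.ofBool (decide (x.left = x.right))).numNodes)
  | pair {p q : Prog} {x y z : Data} {s t : ℕ} (hp : Runs p x y s) (hq : Runs q x z t) :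
      Runs (.pair p q) x (Data.cons y z) (s + t + (1 + x.numNodes + (Data.cons y z).numNodes))
  | seq {p q : Prog} {x y z : Data} {s t : ℕ} (hp : Runs p x y s) (hq : Runs q y z t) :
      Runs (.seq p q) x z (s + t + (1 + x.numNodes + z.numNodes))
  | ite_true {c p q : Prog} {x b y : Data} {s t : ℕ} (hc : Runs c x b s) (hb : b ≠ .nil)
      (hp : Runs p x y t) : Runs (.ite c p q) x y (s + t + (1 + x.numNodes + y.numNodes))
  | ite_false {c p q : Prog} {x y : Data} {s t : ℕ} (hc : Runs c x .nil s)
      (hq : Runs q x y t) : Runs (.ite c p q) x y (s + t + (1 + x.numNodes + y.numNodes))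
  | while_stop {c p : Prog} {x : Data} {s : ℕ} (hc : Runs c x .nil s) :
      Runs (.while c p) x x (s + (1 + x.numNodes + x.numNodes))
  | while_step {c p : Prog} {x b y z : Data} {s t u : ℕ} (hc : Runs c x b s) (hb : b ≠ .nil)
      (hp : Runs p x y t) (hw : Runs (.while c p) y z u) :
      Runs (.while c p) x z (s + t + u + (1 + x.numNodes + z.numNodes))

/-- `f` is computable in polynomial time, with respect to the encodings `ea` and `eb`. -/
def PolyTimeComputable {α β : Type} (ea : α → Data) (eb : β → Data) (f : α → β) : Prop :=
  ∃ (p : Prog) (T : Polynomial ℕ), ∀ a : α, ∃ t : ℕ,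
    t ≤ T.eval (ea a).numNodes ∧ p.Runs (ea a) (eb (f a)) t

/-- Lists are encoded as right combs. -/
def encodeList : List Data → Data
  | [] => .nil
  | a :: l => Data.cons a (encodeList l)

/-- Numbers (the names of vertices and of symbols) are encoded in unary. -/
def encodeNat (n : ℕ) : Data := encodeList (List.replicate n .nil)

/-! ### Constraint graphs and reconfiguration -/

/-- An edge with endpoints `fst` and `snd` (a self-loop if they are equal), together with its
constraint: the pair of values `(a, b)` for `(fst, snd)` is acceptable if `rel a b` is true. -/
structure ConstraintEdge (V A : Type) where
  fst : V
  snd : V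
  rel : A → A → Bool

/-- A binary constraint graph with vertex set `V` and alphabet `A`.  The list of edges is read as a
multiset: self-loops and parallel edges are allowed. -/
structure ConstraintGraph (V A : Type) where
  edges : List (ConstraintEdge V A)

namespace ConstraintGraph

variable {V A : Type}

/-- The fraction of the edges that are satisfied by the assignment `ψ`. -/
noncomputable def val (G : ConstraintGraph V A) (ψ : V → A) : ℝ :=
  (G.edges.countP fun e => e.rel (ψ e.fst) (ψ e.snd) : ℝ) / (G.edges.length : ℝ)

/-- `seq 0, …, seq T` is a reconfiguration sequence from `ini` to `tar`: any two neighbouring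
assignments differ in at most one vertex. -/
def IsReconfSeq (ini tar : V → A) (T : ℕ) (seq : Fin (T + 1) → V → A) : Prop :=
  seq 0 = ini ∧ seq (Fin.last T) = tar ∧
    ∀ i : Fin T, {v | seq i.castSucc v ≠ seq i.succ v}.encard ≤ 1

/-- The value of a sequence of assignments: the minimum of their values. -/
noncomputable def seqVal (G : ConstraintGraph V A) {T : ℕ} (seq : Fin (T + 1) → V → A) : ℝ :=
  Finset.univ.inf' Finset.univ_nonempty fun i => G.val (seq i)

/-- The maximum value of a reconfiguration sequence from `ini` to `tar`. -/
noncomputable def reconfVal (G : ConstraintGraph V A) (ini tar : V → A) : ℝ :=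
  sSup {r | ∃ (T : ℕ) (seq : Fin (T + 1) → V → A), IsReconfSeq ini tar T seq ∧ r = G.seqVal seq}

variable [DecidableEq V]

/-- The number of edges at `v`; a self-loop is counted twice. -/
def degree (G : ConstraintGraph V A) (v : V) : ℕ :=
  (G.edges.map fun e => (if e.fst = v then 1 else 0) + (if e.snd = v then 1 else 0)).sum

/-- The adjacency matrix of the underlying graph; a self-loop contributes `2` on the diagonal, so
that the row sums are the degrees. -/
def adjMatrix (G : ConstraintGraph V A) : Matrix V V ℝ := fun u v =>
  (G.edges.map fun e =>
    (if e.fst = u ∧ e.snd = v then 1 else 0) + (if e.snd = u ∧ e.fst = v then 1 else 0)).sum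

variable [Fintype V]

/-- The second largest eigenvalue in absolute value of the underlying graph: the maximum of
`‖A x‖₂ / ‖x‖₂` over the vectors `x ≠ 0` orthogonal to the all-ones vector (`0` if there are none,
that is, if there is only one vertex). -/
noncomputable def secondEigenvalue (G : ConstraintGraph V A) : ℝ :=
  sSup {r | ∃ x : V → ℝ, x ≠ 0 ∧ ∑ v, x v = 0 ∧
    r = √(∑ v, (G.adjMatrix.mulVec x v) ^ 2) / √(∑ v, x v ^ 2)}

/-- The underlying graph is a `(d, lam)`-expander. -/
def IsExpander (G : ConstraintGraph V A) (d : ℕ) (lam : ℝ) : Prop :=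
  lam < d ∧ (∀ v, G.degree v = d) ∧ G.secondEigenvalue ≤ lam

end ConstraintGraph

/-- An instance of 2-CSP Reconfiguration with alphabet size `W`: a constraint graph on a nonempty
vertex set and two assignments for it. -/
structure CSPInstance (W : ℕ) where
  n : ℕ
  n_pos : 0 < n
  graph : ConstraintGraph (Fin n) (Fin W)
  ini : Fin n → Fin W
  tar : Fin n → Fin W

namespace CSPInstance

variable {W : ℕ}

/-- The encoding of an edge: its two endpoints and the truth table of its constraint. -/
def encodeEdge {n : ℕ} (e : ConstraintEdge (Fin n) (Fin W)) : Data :=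
  encodeList [encodeNat e.fst, encodeNat e.snd,
    encodeList (List.ofFn fun a => encodeList (List.ofFn fun b => Data.ofBool (e.rel a b)))]

/-- The encoding of an assignment: the list of its values. -/
def encodeAssignment {n : ℕ} (ψ : Fin n → Fin W) : Data :=
  encodeList (List.ofFn fun v => encodeNat (ψ v))

/-- The encoding of an instance: the number of vertices, the list of edges, and the two
assignments. -/
def encode (I : CSPInstance W) : Data :=
  encodeList [encodeNat I.n, encodeList (I.graph.edges.map encodeEdge),
    encodeAssignment I.ini, encodeAssignment I.tar]

/-- The optimal value of the instance. -/
noncomputable def value (I : CSPInstance W) : ℝ := I.graph.reconfVal I.ini I.tar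

end CSPInstance

/-- The instances with alphabet size `W` whose underlying graph is a `(d, lam)`-expander. -/
abbrev ExpanderInstance (W d : ℕ) (lam : ℝ) : Type :=
  {I : CSPInstance W // I.graph.IsExpander d lam}

/-- There is a polynomial-time gap-preserving reduction from `Gap_{c,s}` 2-CSP Reconfiguration with
alphabet size `W` and a `(d, lam)`-expander as underlying graph to `Gap_{c',s'}` 2-CSP
Reconfiguration with alphabet size `W'` and a `(d', lam')`-expander as underlying graph: it maps
yes-instances (value at least `c`) to yes-instances and no-instances (value less than `s`) to
no-instances. -/
def GapReducible (c s : ℝ) (W d : ℕ) (lam : ℝ) (c' s' : ℝ) (W' d' : ℕ) (lam' : ℝ) : Prop :=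
  ∃ f : ExpanderInstance W d lam → ExpanderInstance W' d' lam',
    PolyTimeComputable (fun I => I.1.encode) (fun J => J.1.encode) f ∧
    ∀ I : ExpanderInstance W d lam,
      (c ≤ I.1.value → c' ≤ (f I).1.value) ∧ (I.1.value < s → (f I).1.value < s')

/-!
The reduction is a form of graph powering.  Fix `t ≈ 100 / ε`.  A new symbol at `v` holds an opinion
about the end of each walk of length at most `t` from `v`; an opinion is a set of one or two old
values.  The new edges are the walks of the lengths `1, …, 2 t - 1`, repeated so that every length
has the same weight, and the constraint of a walk (`Accepts`) compares the opinions of its two ends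
about the edges of the walk.  On the vectors orthogonal to the constants the new adjacency matrix is
a combination of powers of the old one, so the ratio of the second eigenvalue to the degree does not
grow (`isExpander_powerEdges`).

Soundness.  Decode an assignment of the powered graph by plurality: `x` gets the value that the ends
of random walks from `x` most often admit for it.  If the decoding violates an edge, then a random
walk through this edge is rejected there with constant probability: either the decoded values of
both its ends are popular and the incompatible pair shows up, or no opinion about one end is
popular, and independent opinions about it are often disjoint (`RotGraph.bad_of_decode_violates`).
If the decoding violates a fraction of at least `ε / 2` of the edges, then a walk of about `t` steps
meets many violated edges on average.  By the spectral gap the visits at different times are almost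
independent, and the second moment method (`RotGraph.HasGap.reject_bound`) shows that more than a
fraction `0.00588 = 0.0294 / 5` of all walks is rejected.  A change of one new symbol affects the
decoding only at distance less than `t`, hence a small fraction of the edges if the graph is large,
so a path of good assignments of the powered graph decodes to a path of good assignments
(`RotGraph.HasGap.reconfigurable_decode`).  The finitely many small instances are mapped to
instances with one vertex according to their values.

Completeness.  A step of a path of satisfying assignments that changes the value of one vertex from
`a` to `b` is followed by changing the opinions about this vertex from `{a}` to `{a, b}`, and then
from `{a, b}` to `{b}`, one new vertex at a time; no constraint is ever violated
(`RotGraph.reconfigurable_honest`).  This is why opinions are sets.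

Polynomial time.  `PolyTime` is closed under composition, branching, lookup in finite tables, and
list comprehensions.  The walks of bounded length are enumerated by comprehensions; all remaining
data, such as the tables of the new constraints, depend on boundedly many bits and are looked up.
-/

/-! ### Polynomial-time computable families of trees -/

theorem numNodes_left_le (x : Data) : x.left.numNodes ≤ x.numNodes := by
  cases x <;> simp [BinaryTree.left]; omega

theorem numNodes_right_le (x : Data) : x.right.numNodes ≤ x.numNodes := by
  cases x <;> simp [BinaryTree.right]; omega

@[simp] theorem numNodes_cons (x y : Data) :
    (Data.cons x y).numNodes = x.numNodes + y.numNodes + 1 := rfl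

@[simp] theorem left_cons (x y : Data) : (Data.cons x y).left = x := rfl

@[simp] theorem right_cons (x y : Data) : (Data.cons x y).right = y := rfl

theorem cons_ne_nil (x y : Data) : Data.cons x y ≠ .nil := by simp [Data.cons]

@[simp] theorem cons_inj {x y x' y' : Data} :
    Data.cons x y = Data.cons x' y' ↔ x = x' ∧ y = y' := by simp [Data.cons]

/-- Output is paid for. -/
theorem Prog.Runs.numNodes_le {p : Prog} {x y : Data} {t : ℕ} (h : p.Runs x y t) :
    y.numNodes ≤ t := by
  induction h <;> (try simp only [numNodes_cons]) <;> omega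

theorem Prog.Runs.while_nil {c p : Prog} {x : Data} {s : ℕ} (hc : c.Runs x .nil s) :
    Prog.Runs (.while c p) x x (s + (1 + x.numNodes + x.numNodes)) := by
  constructor
  exact hc

/-- Polynomials with natural coefficients are monotone. -/
theorem eval_mono (Q : Polynomial ℕ) {a b : ℕ} (h : a ≤ b) : Q.eval a ≤ Q.eval b := by
  simp only [Polynomial.eval_eq_sum_range]
  gcongr

section

variable {ι κ : Type}

/-- `N i` is bounded by a polynomial in the size of `e i`. -/
def PolyBounded (e : ι → Data) (N : ι → ℕ) : Prop :=
  ∃ Q : Polynomial ℕ, ∀ i, N i ≤ Q.eval (e i).numNodes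

namespace PolyBounded

variable {e : ι → Data} {M N : ι → ℕ}

theorem mono (h : PolyBounded e N) (hM : ∀ i, M i ≤ N i) : PolyBounded e M := by
  obtain ⟨Q, hQ⟩ := h
  exact ⟨Q, fun i => (hM i).trans (hQ i)⟩

theorem const (e : ι → Data) (c : ℕ) : PolyBounded e fun _ => c :=
  ⟨Polynomial.C c, fun i => by simp⟩

theorem size (e : ι → Data) : PolyBounded e fun i => (e i).numNodes :=
  ⟨Polynomial.X, fun i => by simp⟩

theorem add (hM : PolyBounded e M) (hN : PolyBounded e N) : PolyBounded e fun i => M i + N i := by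
  obtain ⟨P, hP⟩ := hM
  obtain ⟨Q, hQ⟩ := hN
  exact ⟨P + Q, fun i => by simpa using add_le_add (hP i) (hQ i)⟩

theorem trans {a : ι → Data} (h : PolyBounded e fun i => (a i).numNodes) (hN : PolyBounded a N) :
    PolyBounded e N := by
  obtain ⟨P, hP⟩ := h
  obtain ⟨Q, hQ⟩ := hN
  refine ⟨Q.comp P, fun i => (hQ i).trans ?_⟩
  rw [Polynomial.eval_comp]
  exact eval_mono Q (hP i)

theorem reindex (h : PolyBounded e N) (φ : κ → ι) : PolyBounded (e ∘ φ) (N ∘ φ) := by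
  obtain ⟨Q, hQ⟩ := h
  exact ⟨Q, fun i => hQ _⟩

end PolyBounded

/-- The family `a` is computable in polynomial time from the family `e`: one program takes every
`e i` to `a i`.  The families `e` of interest are stacks of variables, built by `Data.cons`; this
is how the bodies of comprehensions and of folds are expressed. -/
def PolyTime (e a : ι → Data) : Prop :=
  ∃ (p : Prog) (τ : ι → ℕ), PolyBounded e τ ∧ ∀ i, p.Runs (e i) (a i) (τ i)

theorem polyTimeComputable_of_polyTime {α β : Type} {ea : α → Data} {eb : β → Data} {f : α → β}
    (h : PolyTime ea fun a => eb (f a)) : PolyTimeComputable ea eb f := by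
  obtain ⟨p, τ, ⟨Q, hQ⟩, hp⟩ := h
  exact ⟨p, Q, fun a => ⟨τ a, hQ a, hp a⟩⟩

namespace PolyTime

variable {e a b c : ι → Data}

theorem size (h : PolyTime e a) : PolyBounded e fun i => (a i).numNodes := by
  obtain ⟨p, τ, hτ, hp⟩ := h
  exact hτ.mono fun i => (hp i).numNodes_le

theorem reindex (h : PolyTime e a) (φ : κ → ι) :
    PolyTime (fun k => e (φ k)) (fun k => a (φ k)) := by
  obtain ⟨p, τ, hτ, hp⟩ := h
  exact ⟨p, _, hτ.reindex φ, fun i => hp _⟩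

theorem congr {e' a' : ι → Data} (h : PolyTime e a) (he : ∀ i, e i = e' i) (ha : ∀ i, a i = a' i) :
    PolyTime e' a' := by
  obtain rfl : e = e' := funext he
  obtain rfl : a = a' := funext ha
  exact h

theorem id (e : ι → Data) : PolyTime e e :=
  ⟨.id, _, ((PolyBounded.const e 1).add (.size e)).add (.size e), fun _ => .id _⟩

theorem const (e : ι → Data) (x : Data) : PolyTime e fun _ => x :=
  ⟨.const x, _, ((PolyBounded.const e 1).add (.size e)).add (.const e x.numNodes),
    fun _ => .const _ _⟩

theorem comp (ha : PolyTime e a) (hb : PolyTime a b) : PolyTime e b := by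
  have hsa := ha.size
  have hsb := hsa.trans hb.size
  obtain ⟨p, τ, hτ, hp⟩ := ha
  obtain ⟨q, σ, hσ, hq⟩ := hb
  exact ⟨.seq p q, _, (hτ.add (hsa.trans hσ)).add (((PolyBounded.const e 1).add (.size e)).add hsb),
    fun i => .seq (hp i) (hq i)⟩

theorem cons (ha : PolyTime e a) (hb : PolyTime e b) :
    PolyTime e fun i => Data.cons (a i) (b i) := by
  have hs := (ha.size.add hb.size).add (.const e 1)
  obtain ⟨p, τ, hτ, hp⟩ := ha
  obtain ⟨q, σ, hσ, hq⟩ := hb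
  exact ⟨.pair p q, _, (hτ.add hσ).add (((PolyBounded.const e 1).add (.size e)).add hs),
    fun i => .pair (hp i) (hq i)⟩

theorem left (ha : PolyTime e a) : PolyTime e fun i => (a i).left :=
  ha.comp ⟨.hd, fun i => 1 + (a i).numNodes + (a i).left.numNodes,
    ((PolyBounded.const a 1).add (.size a)).add ((PolyBounded.size a).mono fun _ =>
      numNodes_left_le _), fun _ => .hd _⟩

theorem right (ha : PolyTime e a) : PolyTime e fun i => (a i).right :=
  ha.comp ⟨.tl, fun i => 1 + (a i).numNodes + (a i).right.numNodes,
    ((PolyBounded.const a 1).add (.size a)).add ((PolyBounded.size a).mono fun _ =>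
      numNodes_right_le _), fun _ => .tl _⟩

theorem of_cons_left (h : PolyTime e fun i => Data.cons (a i) (b i)) : PolyTime e a :=
  h.left

theorem of_cons_right (h : PolyTime e fun i => Data.cons (a i) (b i)) : PolyTime e b :=
  h.right

/-- The top variable of the stack. -/
theorem top : PolyTime (fun i => Data.cons (a i) (e i)) a := of_cons_left (.id _)

/-- The stack without its top variable. -/
theorem pop : PolyTime (fun i => Data.cons (a i) (e i)) e := of_cons_right (.id _)

/-- Weakening: a new top variable may be ignored. -/
theorem weaken (h : PolyTime e b) : PolyTime (fun i => Data.cons (a i) (e i)) b := pop.comp h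

theorem beq (ha : PolyTime e a) (hb : PolyTime e b) :
    PolyTime e fun i => Data.ofBool (decide (a i = b i)) := by
  refine (ha.cons hb).comp ⟨.eq, _, PolyBounded.mono
    (((PolyBounded.const _ 1).add (.size fun i => Data.cons (a i) (b i))).add
      (.const _ 1)) fun i => ?_, fun i => .eq _⟩
  gcongr
  unfold Data.ofBool
  split <;> simp

/-- Branching: the two branches only have to be correct where they are taken. -/
theorem ite (hc : PolyTime e c)
    (ha : PolyTime (fun i : {i // c i ≠ .nil} => e i) fun i => a i)
    (hb : PolyTime (fun i : {i // c i = .nil} => e i) fun i => a i) : PolyTime e a := by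
  classical
  obtain ⟨p, τ, ⟨T, hT⟩, hp⟩ := hc
  obtain ⟨q, σ, ⟨S, hS⟩, hq⟩ := ha
  obtain ⟨r, υ, ⟨U, hU⟩, hr⟩ := hb
  refine ⟨.ite p q r, fun i => τ i + (if h : c i = .nil then υ ⟨i, h⟩ else σ ⟨i, h⟩) +
    (1 + (e i).numNodes + (a i).numNodes), ?_, fun i => ?_⟩
  · refine ⟨T + (S + U) + (1 + Polynomial.X + (S + U)), fun i => ?_⟩
    have h1 := hT i
    by_cases h : c i = .nil
    · have h2 := hU ⟨i, h⟩
      have h3 := (hr ⟨i, h⟩).numNodes_le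
      simp only [h, dite_true, Polynomial.eval_add, Polynomial.eval_X, Polynomial.eval_one]
      simp only at h2 h3
      omega
    · have h2 := hS ⟨i, h⟩
      have h3 := (hq ⟨i, h⟩).numNodes_le
      simp only [h, dite_false, Polynomial.eval_add, Polynomial.eval_X, Polynomial.eval_one]
      simp only at h2 h3
      omega
  · by_cases h : c i = .nil
    · simp only [h, dite_true]
      exact .ite_false (h ▸ hp i) (hr ⟨i, h⟩)
    · simp only [h, dite_false]
      exact .ite_true (hp i) h (hq ⟨i, h⟩)

/-- Every function of a key with finitely many values is computable by table lookup. -/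
theorem lookup [Finite κ] {key : κ → Data} (hkey : Function.Injective key) (k : ι → κ)
    (out : κ → Data) (h : PolyTime e fun i => key (k i)) : PolyTime e fun i => out (k i) := by
  classical
  suffices H : ∀ l : List κ, PolyTime (fun x : {x : κ // x ∈ l} => key x) fun x => out x by
    have := Fintype.ofFinite κ
    exact h.comp ((H Finset.univ.toList).reindex fun i => ⟨k i, by simp⟩)
  intro l
  induction l with
  | nil => exact ⟨.id, fun _ => 0, .const _ 0, fun x => absurd x.2 (by simp)⟩
  | cons y l ih =>
    refine ite (c := fun x => Data.ofBool (decide (key x = key y)))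
      ((PolyTime.id _).beq (.const _ _)) ?_ ?_
    · refine (PolyTime.const _ (out y)).congr (fun _ => rfl) fun x => ?_
      have := x.2
      by_cases hx : key x.1 = key y
      · rw [hkey hx]
      · simp [hx, Data.ofBool] at this
    · refine ih.reindex (κ := {x : {x : κ // x ∈ y :: l} //
        Data.ofBool (decide (key x = key y)) = .nil}) fun x => ⟨x.1.1, ?_⟩
      have h1 := x.1.2
      have h2 := x.2
      simp only [List.mem_cons] at h1
      rcases h1 with h1 | h1
      · simp [h1, Data.ofBool, cons_ne_nil] at h2
      · exact h1

end PolyTime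

/-! ### Loops -/

theorem numNodes_encodeList_cons (x : Data) (l : List Data) :
    (encodeList (x :: l)).numNodes = x.numNodes + (encodeList l).numNodes + 1 := rfl

theorem length_le_numNodes (l : List Data) : l.length ≤ (encodeList l).numNodes := by
  induction l with
  | nil => simp
  | cons x l ih => rw [numNodes_encodeList_cons, List.length_cons]; omega

theorem numNodes_drop_le (l : List Data) (k : ℕ) :
    (encodeList (l.drop k)).numNodes ≤ (encodeList l).numNodes := by
  induction l generalizing k with
  | nil => simp
  | cons x l ih =>
    cases k with
    | zero => simp
    | succ k => rw [numNodes_encodeList_cons, List.drop_succ_cons]; have := ih k; omega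

theorem numNodes_le_of_mem {x : Data} {l : List Data} (h : x ∈ l) :
    x.numNodes ≤ (encodeList l).numNodes := by
  induction l with
  | nil => simp at h
  | cons y l ih =>
    rw [numNodes_encodeList_cons]
    rcases List.mem_cons.1 h with rfl | h
    · omega
    · have := ih h; omega

/-- A loop over a list: `s i k` is the state after the first `k` entries have been processed.  The
sizes of the states have to be bounded separately, since a polynomial bound for a single step does
not give one for the iteration. -/
theorem PolyTime.loop {e : ι → Data} {l : ι → List Data} {s : ι → ℕ → Data}
    (hl : PolyTime e fun i => encodeList (l i)) (h0 : PolyTime e fun i => s i 0)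
    (hs : PolyTime (fun x : Σ i, Fin (l i).length =>
        Data.cons ((l x.1)[x.2]) (Data.cons (s x.1 x.2) (e x.1))) fun x => s x.1 (x.2 + 1))
    (hb : PolyBounded (fun x : Σ i, Fin (l i).length => e x.1) fun x => (s x.1 x.2).numNodes) :
    PolyTime e fun i => s i (l i).length := by
  -- the state of the machine
  let S : ι → ℕ → Data := fun i k => Data.cons (Data.cons (encodeList ((l i).drop k)) (s i k)) (e i)
  have hlow := hl.size
  obtain ⟨P, hP⟩ := hlow
  obtain ⟨Q, hQ⟩ := hb
  have hSb : PolyBounded (fun x : Σ i, Fin (l i).length => e x.1)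
      fun x => (S x.1 x.2).numNodes := by
    refine ⟨P + Q + Polynomial.X + 2, fun x => ?_⟩
    have h1 := hP x.1
    have h2 := hQ x
    beta_reduce at h1 h2
    have h3 := numNodes_drop_le (l x.1) x.2
    simp only [S, numNodes_cons, Polynomial.eval_add, Polynomial.eval_X, Polynomial.eval_ofNat]
    omega
  have hbody : PolyTime (fun x : Σ i, Fin (l i).length => S x.1 x.2)
      fun x => S x.1 (x.2 + 1) := by
    have hdrop (x : Σ i, Fin (l i).length) : encodeList ((l x.1).drop x.2) =
        Data.cons ((l x.1)[x.2]) (encodeList ((l x.1).drop (x.2 + 1))) := by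
      rw [List.drop_eq_getElem_cons x.2.2]; rfl
    have h1 : PolyTime (fun x : Σ i, Fin (l i).length => S x.1 x.2)
        fun x => encodeList ((l x.1).drop x.2) := of_cons_left top
    have h2 : PolyTime (fun x : Σ i, Fin (l i).length => S x.1 x.2)
        fun x => s x.1 x.2 := of_cons_right top
    have h3 : PolyTime (fun x : Σ i, Fin (l i).length => S x.1 x.2)
        fun x => e x.1 := pop
    simp only [hdrop] at h1
    exact ((of_cons_right h1).cons (((of_cons_left h1).cons (h2.cons h3)).comp hs)).cons h3
  obtain ⟨p, τ, hτ, hp⟩ := hbody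
  have hτ' := hSb.trans hτ
  have hSb' := (PolyTime.size ⟨p, τ, hτ, hp⟩)
  replace hSb' := hSb.trans hSb'
  obtain ⟨A, hA⟩ := hSb
  obtain ⟨A', hA'⟩ := hSb'
  obtain ⟨B, hB⟩ := hτ'
  obtain ⟨Z, hZ⟩ := h0.size
  -- a bound on the sizes of all states
  have hsize (i : ι) (k : ℕ) (hk : k ≤ (l i).length) : (S i k).numNodes ≤
      (A' + P + Z + Polynomial.X + 2).eval (e i).numNodes := by
    simp only [Polynomial.eval_add, Polynomial.eval_X, Polynomial.eval_ofNat]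
    cases k with
    | zero =>
      have h1 := hP i
      have h2 := hZ i
      beta_reduce at h1 h2
      simp only [S, numNodes_cons, List.drop_zero]
      omega
    | succ k =>
      have := hA' ⟨i, ⟨k, hk⟩⟩
      simp only at this
      omega
  set R := A' + P + Z + Polynomial.X + 2 with hR
  have hloop (i : ι) (m : ℕ) : m ≤ (l i).length →
      ∃ t, t ≤ (m + 1) * (B + 8 * R + 6).eval (e i).numNodes ∧
      Prog.Runs (.while (.seq .hd .hd) p) (S i ((l i).length - m)) (S i (l i).length) t := by
    have hcond (k : ℕ) : Prog.Runs (.seq .hd .hd) (S i k) (encodeList ((l i).drop k)) _ :=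
      .seq (.hd _) (.hd _)
    have hct (k : ℕ) (hk : k ≤ (l i).length) := hsize i k hk
    induction m with
    | zero =>
      intro _
      have hnil := hcond (l i).length
      rw [List.drop_length] at hnil
      refine ⟨_, ?_, .while_nil hnil⟩
      · have h1 := hct _ le_rfl
        have h2 := numNodes_left_le (S i (l i).length)
        have h3 := numNodes_left_le (S i (l i).length).left
        have h4 : (encodeList []).numNodes = 0 := rfl
        simp only [Polynomial.eval_add, Polynomial.eval_mul, Polynomial.eval_ofNat, Nat.sub_zero]
        omega
    | succ m ih =>
      intro hm
      obtain ⟨t, ht, hrun⟩ := ih (by omega)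
      obtain ⟨k, hk⟩ : ∃ k, k = (l i).length - (m + 1) := ⟨_, rfl⟩
      have hk' : (l i).length - m = k + 1 := by omega
      have hkl : k < (l i).length := by omega
      rw [hk'] at hrun
      rw [← hk]
      refine ⟨_, ?_, .while_step (hcond k) ?_ (hp ⟨i, ⟨k, hkl⟩⟩) hrun⟩
      · have h1 := hct _ hkl.le
        have h1' := hct _ le_rfl
        have h2 := numNodes_left_le (S i k)
        have h3 : (encodeList ((l i).drop k)).numNodes ≤ (S i k).left.numNodes :=
          numNodes_left_le (S i k).left
        have h3' := numNodes_left_le (S i k).left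
        have h4 := hB ⟨i, ⟨k, hkl⟩⟩
        simp only at h4
        rw [add_mul (m + 1) 1]
        simp only [Polynomial.eval_add, Polynomial.eval_mul, Polynomial.eval_ofNat] at ht ⊢
        omega
      · rw [List.drop_eq_getElem_cons hkl]
        exact cons_ne_nil _ _
  have hwhile : PolyTime (fun i => S i 0) fun i => S i (l i).length := by
    choose t ht hrun using fun i => hloop i (l i).length le_rfl
    simp only [Nat.sub_self] at hrun
    refine ⟨_, t, ?_, hrun⟩
    refine ⟨(Polynomial.X + 1) * (B + 8 * R + 6), fun i => (ht i).trans ?_⟩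
    rw [Polynomial.eval_mul]
    refine Nat.mul_le_mul ?_ (eval_mono _ ?_)
    · have := length_le_numNodes (l i)
      simp only [S, numNodes_cons, List.drop_zero, Polynomial.eval_add, Polynomial.eval_X,
        Polynomial.eval_one]
      omega
    · simp only [S, numNodes_cons]; omega
  have hstart : PolyTime e fun i => S i 0 := (hl.cons h0).cons (.id e)
  exact of_cons_right (of_cons_left (hstart.comp hwhile))

end

section

variable {ι : Type} {β γ : ι → Type} {e : ι → Data}

theorem numNodes_encodeList_le {l : List Data} {B : ℕ} (h : ∀ x ∈ l, x.numNodes ≤ B) :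
    (encodeList l).numNodes ≤ l.length * (B + 1) := by
  induction l with
  | nil => simp [encodeList]
  | cons x l ih =>
    rw [numNodes_encodeList_cons, List.length_cons, add_mul, one_mul]
    have h1 := h x (by simp)
    have h2 := ih fun y hy => h y (by simp [hy])
    omega

theorem numNodes_encodeList_append (l m : List Data) :
    (encodeList (l ++ m)).numNodes = (encodeList l).numNodes + (encodeList m).numNodes := by
  induction l with
  | nil => simp [encodeList]
  | cons x l ih => rw [List.cons_append, numNodes_encodeList_cons, numNodes_encodeList_cons, ih]; omega

theorem numNodes_encodeList_reverse (l : List Data) :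
    (encodeList l.reverse).numNodes = (encodeList l).numNodes := by
  induction l with
  | nil => rfl
  | cons x l ih =>
    rw [List.reverse_cons, numNodes_encodeList_append, numNodes_encodeList_cons, ih,
      numNodes_encodeList_cons]
    simp [encodeList]; omega

theorem encodeList_injective : Function.Injective encodeList := by
  intro l m h
  induction l generalizing m with
  | nil => cases m with
    | nil => rfl
    | cons y m => exact absurd h.symm (cons_ne_nil _ _)
  | cons x l ih => cases m with
    | nil => exact absurd h (cons_ne_nil _ _)
    | cons y m =>
      obtain ⟨rfl, h'⟩ := cons_inj.1 h
      rw [ih h']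

namespace PolyTime

theorem reverse {l : ι → List Data} (hl : PolyTime e fun i => encodeList (l i)) :
    PolyTime e fun i => encodeList (l i).reverse := by
  have := loop (s := fun i k => encodeList ((l i).take k).reverse) hl (.const e .nil) ?_ ?_
  · simpa using this
  · simp only [← List.take_concat_get' _ _ (Fin.is_lt _), List.reverse_append, List.reverse_cons,
      List.reverse_nil, List.nil_append, List.singleton_append, Fin.getElem_fin]
    exact top.cons (weaken top)
  · refine (hl.size.reindex _).mono fun x => ?_
    simp only [numNodes_encodeList_reverse, Function.comp_apply]
    conv_rhs => rw [← List.take_append_drop x.2 (l x.1), numNodes_encodeList_append]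
    omega

/-- Right folds with a list as state: the loop over the reversed list. -/
theorem foldr {l : (i : ι) → List (β i)} {enc : (i : ι) → β i → Data}
    {f : (i : ι) → β i → List Data → List Data} {s : ι → List Data}
    (hl : PolyTime e fun i => encodeList ((l i).map (enc i)))
    (h0 : PolyTime e fun i => encodeList (s i))
    (hf : PolyTime (fun x : Σ i, {b // b ∈ l i} × List Data =>
      Data.cons (enc x.1 x.2.1) (Data.cons (encodeList x.2.2) (e x.1)))
      fun x => encodeList (f x.1 x.2.1 x.2.2))
    (hb : PolyBounded (fun x : Σ i, {m : List (β i) // m <:+ l i} => e x.1)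
      fun x => (encodeList (x.2.1.foldr (f x.1) (s x.1))).numNodes) :
    PolyTime e fun i => encodeList ((l i).foldr (f i) (s i)) := by
  have hr := hl.reverse
  have := loop (s := fun i k =>
    encodeList (((l i).drop ((l i).length - k)).foldr (f i) (s i))) hr ?_ ?_ ?_
  · simpa using this
  · simpa using h0
  · have hlen (x : Σ i, Fin ((l i).map (enc i)).reverse.length) : x.2 < (l x.1).length := by
      simpa using x.2.2
    have h := hf.reindex fun x : Σ i, Fin ((l i).map (enc i)).reverse.length =>
      ⟨x.1, ⟨(l x.1)[(l x.1).length - (x.2 + 1)]'(by have := hlen x; omega),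
        List.getElem_mem _⟩, ((l x.1).drop ((l x.1).length - x.2)).foldr (f x.1) (s x.1)⟩
    refine h.congr (fun x => ?_) fun x => ?_
    · congr 2
      simp only [Fin.getElem_fin, List.getElem_reverse, List.getElem_map, List.length_map]
      congr 2
      omega
    · have := hlen x
      conv_rhs => rw [List.drop_eq_getElem_cons (by omega), List.foldr_cons]
      congr 3
      dsimp only
      congr 2
      omega
  · exact hb.reindex fun x : Σ i, Fin ((l i).map (enc i)).reverse.length =>
      ⟨x.1, _, List.drop_suffix ((l x.1).length - x.2) _⟩

theorem append {l m : ι → List Data} (hl : PolyTime e fun i => encodeList (l i))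
    (hm : PolyTime e fun i => encodeList (m i)) :
    PolyTime e fun i => encodeList (l i ++ m i) := by
  have := foldr (β := fun _ => Data) (l := l) (enc := fun _ x => x) (f := fun _ x s => x :: s)
    (s := m) (by simpa using hl) hm (top.cons (weaken top)) ?_
  · simpa using this
  · refine ((hl.size.add hm.size).reindex fun x :
      (Σ i, {m : List Data // m <:+ l i}) => x.1).mono fun x => ?_
    obtain ⟨i, t, u, hu⟩ := x
    have h := numNodes_encodeList_append t (m i)
    have h' := numNodes_encodeList_append u t
    rw [hu] at h'
    have hf : t.foldr (fun x s => x :: s) (m i) = t ++ m i := by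
      induction t <;> simp_all
    simp only [hf, Function.comp_apply]
    omega

/-- Comprehensions with bodies that are lists. -/
theorem flatMap {l : (i : ι) → List (β i)} {enc : (i : ι) → β i → Data}
    {f : (i : ι) → β i → List Data}
    (hl : PolyTime e fun i => encodeList ((l i).map (enc i)))
    (hf : PolyTime (fun x : Σ i, {b // b ∈ l i} => Data.cons (enc x.1 x.2) (e x.1))
      fun x => encodeList (f x.1 x.2)) :
    PolyTime e fun i => encodeList ((l i).flatMap (f i)) := by
  have henv : PolyBounded (fun x : Σ i, {b // b ∈ l i} => e x.1)
      fun x => (Data.cons (enc x.1 x.2) (e x.1)).numNodes := by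
    refine (((hl.size.add (.size e)).add (.const e 1)).reindex
      fun x : Σ i, {b // b ∈ l i} => x.1).mono fun x => ?_
    have := numNodes_le_of_mem (List.mem_map_of_mem (f := enc x.1) x.2.2)
    simp only [numNodes_cons, Function.comp_apply]
    omega
  have hsize := henv.trans hf.size
  have h := foldr (f := fun i b s => f i b ++ s) (s := fun _ => []) hl (.const e .nil) ?_ ?_
  · refine h.congr (fun _ => rfl) fun i => ?_
    congr 1
    induction l i with
    | nil => rfl
    | cons b t ih => rw [List.foldr_cons, ih, List.flatMap_cons]
  · exact append ((top.cons (weaken pop)).comp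
      (hf.reindex fun x : Σ i, {b // b ∈ l i} × List Data => ⟨x.1, x.2.1⟩)) (weaken top)
  · obtain ⟨Q, hQ⟩ := hsize
    obtain ⟨P, hP⟩ := hl.size
    refine ⟨P * Q, fun ⟨i, t, ht⟩ => ?_⟩
    have key : ∀ t : List (β i), (∀ b ∈ t, b ∈ l i) →
        (encodeList (t.foldr (fun b s => f i b ++ s) [])).numNodes ≤
          t.length * Q.eval (e i).numNodes := by
      intro t ht
      induction t with
      | nil => simp [encodeList]
      | cons b t ih =>
        rw [List.foldr_cons, numNodes_encodeList_append, List.length_cons, add_mul, one_mul,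
          add_comm]
        exact add_le_add (ih fun b hb => ht b (by simp [hb])) (hQ ⟨i, b, ht b (by simp)⟩)
    refine (key t fun b hb => ht.subset hb).trans ?_
    rw [Polynomial.eval_mul]
    gcongr
    refine ht.length_le.trans (le_trans ?_ (hP i))
    simpa using length_le_numNodes ((l i).map (enc i))

theorem map {l : (i : ι) → List (β i)} {enc : (i : ι) → β i → Data} {f : (i : ι) → β i → Data}
    (hl : PolyTime e fun i => encodeList ((l i).map (enc i)))
    (hf : PolyTime (fun x : Σ i, {b // b ∈ l i} => Data.cons (enc x.1 x.2) (e x.1))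
      fun x => f x.1 x.2) :
    PolyTime e fun i => encodeList ((l i).map (f i)) := by
  have := flatMap (f := fun i b => [f i b]) hl (hf.cons (.const _ .nil))
  simpa only [← List.map_eq_flatMap] using this

theorem filter {l : (i : ι) → List (β i)} {enc : (i : ι) → β i → Data}
    {p : (i : ι) → β i → Bool}
    (hl : PolyTime e fun i => encodeList ((l i).map (enc i)))
    (hp : PolyTime (fun x : Σ i, {b // b ∈ l i} => Data.cons (enc x.1 x.2) (e x.1))
      fun x => Data.ofBool (p x.1 x.2)) :
    PolyTime e fun i => encodeList (((l i).filter (p i)).map (enc i)) := by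
  have := flatMap (f := fun i b => if p i b then [enc i b] else []) hl (ite hp ?_ ?_)
  · refine this.congr (fun _ => rfl) fun i => ?_
    congr 1
    induction l i with
    | nil => rfl
    | cons b t ih => by_cases h : p i b <;> simp [h, ih]
  · refine (top.cons (.const _ .nil)).congr (fun _ => rfl) fun ⟨x, hx⟩ => ?_
    have : p x.1 x.2 = true := by
      by_contra h
      simp [Data.ofBool, h] at hx
    simp [this, encodeList]
  · refine (const _ .nil).congr (fun _ => rfl) fun ⟨x, hx⟩ => ?_
    have : p x.1 x.2 = false := by
      by_contra h
      simp [Data.ofBool, h, cons_ne_nil] at hx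
    simp [this, encodeList]

/-- The number of the entries with a given property. -/
theorem countP {l : (i : ι) → List (β i)} {enc : (i : ι) → β i → Data}
    {p : (i : ι) → β i → Bool}
    (hl : PolyTime e fun i => encodeList ((l i).map (enc i)))
    (hp : PolyTime (fun x : Σ i, {b // b ∈ l i} => Data.cons (enc x.1 x.2) (e x.1))
      fun x => Data.ofBool (p x.1 x.2)) :
    PolyTime e fun i => encodeNat ((l i).countP (p i)) := by
  have := map (f := fun _ _ => .nil) (filter hl hp) (.const _ .nil)
  simpa [encodeNat, List.countP_eq_length_filter] using this

/-- The suffixes of a list. -/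
theorem tails {l : (i : ι) → List (β i)} {enc : (i : ι) → β i → Data}
    (hl : PolyTime e fun i => encodeList ((l i).map (enc i))) :
    PolyTime e fun i => encodeList ((l i).tails.map fun t => encodeList (t.map (enc i))) := by
  have hfold (i : ι) (t : List (β i)) : t.tails.map (fun t => encodeList (t.map (enc i))) =
      t.foldr (fun b s => Data.cons (enc i b) (encodeList s).left :: s) [.nil] := by
    induction t with
    | nil => rfl
    | cons b t ih =>
      rw [List.tails_cons, List.map_cons, ih, List.foldr_cons]
      congr 1
      rw [← ih]
      cases t <;> rfl
  have h := foldr (f := fun i b s => Data.cons (enc i b) (encodeList s).left :: s)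
    (s := fun _ => [.nil]) hl (.const e _) ((top.cons (left (weaken top))).cons (weaken top)) ?_
  · simpa only [hfold] using h
  · simp only [← hfold]
    obtain ⟨P, hP⟩ := hl.size
    refine ⟨(P + 1) * (P + 1), fun ⟨i, t, ht⟩ => ?_⟩
    refine (numNodes_encodeList_le (B := P.eval (e i).numNodes) ?_).trans ?_
    · intro x hx
      obtain ⟨u, hu, rfl⟩ := List.mem_map.1 hx
      refine le_trans ?_ (hP i)
      obtain ⟨w, hw⟩ := ((List.mem_tails _ _).1 hu).trans ht
      have := numNodes_encodeList_append (w.map (enc i)) (u.map (enc i))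
      rw [← List.map_append, hw] at this
      show _ ≤ (encodeList ((l i).map (enc i))).numNodes
      dsimp only
      omega
    · simp only [List.length_map, List.length_tails, Polynomial.eval_mul, Polynomial.eval_add,
        Polynomial.eval_one]
      gcongr
      refine ht.length_le.trans (le_trans ?_ (hP i))
      simpa using length_le_numNodes ((l i).map (enc i))

/-- The suffix of a list that starts at a given position. -/
theorem drop {l : ι → List Data} {k : ι → ℕ} (hl : PolyTime e fun i => encodeList (l i))
    (hk : PolyTime e fun i => encodeNat (k i)) :
    PolyTime e fun i => encodeList ((l i).drop (k i)) := by
  have hcomb (s : List Data) : encodeList s.tail = (encodeList s).right := by cases s <;> rfl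
  have hfold (s : List Data) (n : ℕ) :
      (List.replicate n (BinaryTree.nil : Data)).foldr (fun _ s => s.tail) s = s.drop n := by
    induction n with
    | zero => rfl
    | succ n ih => rw [List.replicate_succ, List.foldr_cons, ih, List.tail_drop]
  have h := foldr (β := fun _ => Data) (l := fun i => List.replicate (k i) .nil)
    (enc := fun _ x => x) (f := fun _ _ s => s.tail) (s := l) (by simpa [encodeNat] using hk) hl ?_ ?_
  · simpa only [hfold] using h
  · simp only [hcomb]
    exact right (weaken top)
  · refine (hl.size.reindex fun x :
      (Σ i, {m : List Data // m <:+ List.replicate (k i) (.nil : Data)}) => x.1).mono fun x => ?_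
    obtain ⟨i, t, ht⟩ := x
    obtain ⟨n, rfl⟩ : ∃ n, t = List.replicate n (.nil : Data) :=
      ⟨_, List.eq_replicate_of_mem fun x hx => List.eq_of_mem_replicate (ht.subset hx)⟩
    simp only [hfold]
    exact numNodes_drop_le _ _

/-- The list of the numbers below a number; in unary these are the proper suffixes. -/
theorem finRange {k : ι → ℕ} (hk : PolyTime e fun i => encodeNat (k i)) :
    PolyTime e fun i => encodeList ((List.finRange (k i)).map fun v : Fin (k i) => encodeNat v) := by
  have h := (right (tails (β := fun _ => Data) (l := fun i => List.replicate (k i) .nil)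
    (enc := fun _ x => x) (by simpa [encodeNat] using hk)))
  have hr : ∀ n : ℕ, (List.replicate n (.nil : Data)).tails =
      ((List.range (n + 1)).map fun v => List.replicate v (.nil : Data)).reverse := by
    intro n
    induction n with
    | zero => rfl
    | succ n ih =>
      rw [List.replicate_succ, List.tails_cons, ih, List.range_succ (n := n + 1)]
      simp [List.replicate_succ]
  have h2 : ∀ i, BinaryTree.right (encodeList
      ((List.replicate (k i) (.nil : Data)).tails.map fun t => encodeList (t.map fun x => x))) =
      encodeList (((List.finRange (k i)).map fun v : Fin (k i) => encodeNat v).reverse) := by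
    intro i
    rw [hr, List.range_succ, List.map_append, List.reverse_append, List.map_append]
    simp only [List.map_cons, List.map_nil, List.reverse_cons, List.reverse_nil, List.nil_append,
      List.singleton_append, encodeList, right_cons]
    congr 1
    rw [← List.map_coe_finRange_eq_range, List.map_reverse, List.map_map, List.map_map]
    simp [encodeNat, Function.comp_def]
  simp only [h2] at h
  simpa using reverse h

end PolyTime

end

/-! ### Rotation maps and walks -/

open scoped BigOperators

/-- A `d`-regular constraint graph given by a rotation map.  The darts (edges with a direction) out
of `v` are the pairs `(v, i)`, and `rot` sends a dart to the same edge with the opposite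
direction; a self-loop consists of two darts. -/
structure RotGraph (V A : Type) (d : ℕ) where
  rot : V × Fin d → V × Fin d
  rot_rot : ∀ p, rot (rot p) = p
  rel : V × Fin d → A → A → Bool
  rel_rot : ∀ p a b, rel (rot p) b a = rel p a b

/-- The words of length `k` over the labels of the darts. -/
def words (d k : ℕ) : Finset (List (Fin d)) :=
  Finset.univ.map ⟨fun c : List.Vector (Fin d) k => c.1, Subtype.val_injective⟩

section words

variable {d : ℕ}

@[simp] theorem mem_words {k : ℕ} {c : List (Fin d)} : c ∈ words d k ↔ c.length = k := by
  simp only [words, Finset.mem_map, Finset.mem_univ, true_and]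
  exact ⟨fun ⟨c, hc⟩ => hc ▸ c.2, fun h => ⟨⟨c, h⟩, rfl⟩⟩

theorem card_words (k : ℕ) : (words d k).card = d ^ k := by
  simp [words]

theorem words_nonempty [NeZero d] (k : ℕ) : (words d k).Nonempty :=
  ⟨List.replicate k 0, by simp⟩

theorem words_zero : words d 0 = {[]} := by
  ext c; simp

theorem sum_words_add (a b : ℕ) (F : List (Fin d) → ℝ) :
    ∑ c ∈ words d (a + b), F c = ∑ x ∈ words d a, ∑ y ∈ words d b, F (x ++ y) := by
  rw [← Finset.sum_product']
  refine (Finset.sum_nbij' (fun p => p.1 ++ p.2) (fun c => (c.take a, c.drop a)) ?_ ?_ ?_ ?_ ?_).symm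
  all_goals simp +contextual

theorem sum_words_succ {M : Type} [AddCommMonoid M] (k : ℕ) (F : List (Fin d) → M) :
    ∑ c ∈ words d (k + 1), F c = ∑ i : Fin d, ∑ c ∈ words d k, F (i :: c) := by
  rw [← Finset.sum_product' (f := fun i c => F (i :: c))]
  refine (Finset.sum_bij (fun p _ => p.1 :: p.2) ?_ ?_ ?_ ?_).symm
  · simp
  · rintro ⟨i, c⟩ _ ⟨j, c'⟩ _ h
    simpa using h
  · intro c hc
    cases c with
    | nil => simp at hc
    | cons i c => exact ⟨(i, c), by simpa using hc, rfl⟩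
  · simp

theorem expect_words_succ (k : ℕ) (F : List (Fin d) → ℝ) :
    𝔼 c ∈ words d (k + 1), F c = 𝔼 i : Fin d, 𝔼 c ∈ words d k, F (i :: c) := by
  simp only [Finset.expect_eq_sum_div_card, sum_words_succ, card_words, Finset.card_univ,
    Fintype.card_fin, ← Finset.sum_div, div_div]
  push_cast
  rw [pow_succ]

theorem expect_words_add (a b : ℕ) (F : List (Fin d) → ℝ) :
    𝔼 c ∈ words d (a + b), F c = 𝔼 x ∈ words d a, 𝔼 y ∈ words d b, F (x ++ y) := by
  simp only [Finset.expect_eq_sum_div_card, sum_words_add, card_words, ← Finset.sum_div, div_div]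
  push_cast
  rw [pow_add, mul_comm]

end words

namespace RotGraph

variable {V A : Type} {d : ℕ} (G : RotGraph V A d)

/-- The end of the walk from `v` along the word `c`. -/
def follow : V → List (Fin d) → V
  | v, [] => v
  | v, i :: c => follow (G.rot (v, i)).1 c

/-- The word of the reversed walk. -/
def rev : V → List (Fin d) → List (Fin d)
  | _, [] => []
  | v, i :: c => rev (G.rot (v, i)).1 c ++ [(G.rot (v, i)).2]

@[simp] theorem follow_nil (v : V) : G.follow v [] = v := rfl

@[simp] theorem follow_cons (v : V) (i : Fin d) (c : List (Fin d)) :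
    G.follow v (i :: c) = G.follow (G.rot (v, i)).1 c := rfl

@[simp] theorem rev_nil (v : V) : G.rev v [] = [] := rfl

@[simp] theorem rev_cons (v : V) (i : Fin d) (c : List (Fin d)) :
    G.rev v (i :: c) = G.rev (G.rot (v, i)).1 c ++ [(G.rot (v, i)).2] := rfl

theorem follow_append (v : V) (c c' : List (Fin d)) :
    G.follow v (c ++ c') = G.follow (G.follow v c) c' := by
  induction c generalizing v with
  | nil => rfl
  | cons i c ih => simp [ih]

theorem rev_append (v : V) (c c' : List (Fin d)) :
    G.rev v (c ++ c') = G.rev (G.follow v c) c' ++ G.rev v c := by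
  induction c generalizing v with
  | nil => simp
  | cons i c ih => simp [ih]

@[simp] theorem length_rev (v : V) (c : List (Fin d)) : (G.rev v c).length = c.length := by
  induction c generalizing v with
  | nil => rfl
  | cons i c ih => simp [ih]

@[simp] theorem follow_rev (v : V) (c : List (Fin d)) : G.follow (G.follow v c) (G.rev v c) = v := by
  induction c generalizing v with
  | nil => rfl
  | cons i c ih => simp [follow_append, ih, G.rot_rot]

@[simp] theorem rev_rev (v : V) (c : List (Fin d)) : G.rev (G.follow v c) (G.rev v c) = c := by
  induction c generalizing v with
  | nil => rfl
  | cons i c ih => simp [rev_append, ih, G.rot_rot]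

/-- The averaging operator of the random walk. -/
noncomputable def avg (f : V → ℝ) (v : V) : ℝ := 𝔼 i, f (G.rot (v, i)).1

theorem expect_follow (k : ℕ) (f : V → ℝ) (v : V) :
    𝔼 c ∈ words d k, f (G.follow v c) = G.avg^[k] f v := by
  induction k generalizing v with
  | zero => simp [words_zero]
  | succ k ih =>
    rw [expect_words_succ, Function.iterate_succ_apply']
    simp only [follow_cons, ih]
    rfl

theorem avg_add (f g : V → ℝ) : G.avg (f + g) = G.avg f + G.avg g := by
  funext v; simp [avg, Finset.expect_add_distrib]

theorem avg_const [NeZero d] (a : ℝ) : G.avg (fun _ => a) = fun _ => a := by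
  funext v; simp [avg]

variable [Fintype V]

/-- Reversing walks is an involution on the pairs of a vertex and a word. -/
theorem expect_reverse (k : ℕ) (F : V → List (Fin d) → ℝ) :
    𝔼 v, 𝔼 c ∈ words d k, F v c = 𝔼 v, 𝔼 c ∈ words d k, F (G.follow v c) (G.rev v c) := by
  rw [← Finset.expect_product' _ _ F,
    ← Finset.expect_product' _ _ fun v c => F (G.follow v c) (G.rev v c)]
  exact Finset.expect_nbij' (fun p => (G.follow p.1 p.2, G.rev p.1 p.2))
    (fun p => (G.follow p.1 p.2, G.rev p.1 p.2)) (by simp) (by simp) (by simp) (by simp) (by simp)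

theorem sum_reverse {M : Type} [AddCommMonoid M] (k : ℕ) (F : V → List (Fin d) → M) :
    ∑ v, ∑ c ∈ words d k, F v c = ∑ v, ∑ c ∈ words d k, F (G.follow v c) (G.rev v c) := by
  rw [← Finset.sum_product' _ _ F,
    ← Finset.sum_product' _ _ fun v c => F (G.follow v c) (G.rev v c)]
  exact Finset.sum_nbij' (fun p => (G.follow p.1 p.2, G.rev p.1 p.2))
    (fun p => (G.follow p.1 p.2, G.rev p.1 p.2)) (by simp) (by simp) (by simp) (by simp) (by simp)

theorem expect_rot (F : V × Fin d → ℝ) :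
    𝔼 v, 𝔼 i, F (v, i) = 𝔼 v, 𝔼 i, F (G.rot (v, i)) := by
  rw [← Finset.expect_product' _ _ fun v i => F (v, i),
    ← Finset.expect_product' _ _ fun v i => F (G.rot (v, i))]
  exact Finset.expect_nbij' (fun p => G.rot p) (fun p => G.rot p) (by simp) (by simp)
    (by simp [G.rot_rot]) (by simp [G.rot_rot]) (by simp [G.rot_rot])

/-! ### The spectral gap -/

theorem expect_avg [NeZero d] (f : V → ℝ) : 𝔼 v, G.avg f v = 𝔼 v, f v := by
  have := G.expect_rot fun p => f p.1
  simp only [Fintype.expect_const] at this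
  exact this.symm

/-- The uniform distribution is stationary. -/
theorem expect_expect_follow [NeZero d] (k : ℕ) (f : V → ℝ) :
    𝔼 v, 𝔼 c ∈ words d k, f (G.follow v c) = 𝔼 v, f v := by
  rw [G.expect_reverse]
  simp [Finset.expect_const (words_nonempty _)]

/-- The random walk contracts the functions with mean `0` by a factor `2`. -/
def HasGap : Prop := ∀ f : V → ℝ, 𝔼 v, f v = 0 → 𝔼 v, G.avg f v ^ 2 ≤ (1 / 4) * 𝔼 v, f v ^ 2

variable {G} [NeZero d]

theorem HasGap.iterate (hG : G.HasGap) (k : ℕ) {f : V → ℝ} (hf : 𝔼 v, f v = 0) :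
    𝔼 v, (G.avg^[k] f v) ^ 2 ≤ (1 / 4) ^ k * 𝔼 v, f v ^ 2 := by
  have h0 : ∀ k, 𝔼 v, G.avg^[k] f v = 0 := by
    intro k
    induction k with
    | zero => simpa using hf
    | succ k ih => rw [← ih]; simp only [Function.iterate_succ_apply']; exact G.expect_avg _
  induction k with
  | zero => simp
  | succ k ih =>
    simp only [Function.iterate_succ_apply']
    refine (hG _ (h0 k)).trans ?_
    rw [pow_succ', mul_assoc]
    gcongr

/-- The events of a marked dart at two places of a random walk are almost independent. -/
theorem HasGap.two_marks [Nonempty V] (hG : G.HasGap) {φ : V × Fin d → ℝ} (h0 : ∀ p, 0 ≤ φ p)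
    (h1 : ∀ p, φ p ≤ 1) (k : ℕ) :
    𝔼 v, 𝔼 i, φ (v, i) * 𝔼 c ∈ words d k, 𝔼 j, φ (G.follow (G.rot (v, i)).1 c, j) ≤
      (𝔼 v, 𝔼 i, φ (v, i)) ^ 2 + (1 / 2) ^ k * 𝔼 v, 𝔼 i, φ (v, i) := by
  set β := 𝔼 v, 𝔼 i, φ (v, i) with hβ
  set f : V → ℝ := fun v => 𝔼 i, φ (v, i) with hf
  set f' : V → ℝ := fun v => 𝔼 i, φ (G.rot (v, i)) with hf'
  have hf'β : 𝔼 v, f' v = β := (G.expect_rot φ).symm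
  have hβ0 : 0 ≤ β := Finset.expect_nonneg fun v _ => Finset.expect_nonneg fun i _ => h0 _
  have hsq {g : V → ℝ} (hg : ∀ v, g v = f v ∨ g v = f' v) : 𝔼 v, g v ^ 2 ≤ 𝔼 v, g v := by
    refine Finset.expect_le_expect fun v _ => ?_
    have : 0 ≤ g v ∧ g v ≤ 1 := by
      rcases hg v with h | h <;> rw [h]
      · exact ⟨Finset.expect_nonneg fun _ _ => h0 _, Finset.expect_le Finset.univ_nonempty
          fun _ _ => h1 _⟩
      · exact ⟨Finset.expect_nonneg fun _ _ => h0 _, Finset.expect_le Finset.univ_nonempty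
          fun _ _ => h1 _⟩
    nlinarith
  have hstart : 𝔼 v, 𝔼 i, φ (v, i) * 𝔼 c ∈ words d k, 𝔼 j, φ (G.follow (G.rot (v, i)).1 c, j) =
      𝔼 v, f' v * G.avg^[k] f v := by
    have : ∀ v, 𝔼 c ∈ words d k, 𝔼 j, φ (G.follow v c, j) = G.avg^[k] f v := fun v =>
      G.expect_follow k f v
    simp only [this]
    rw [G.expect_rot fun p => φ p * G.avg^[k] f (G.rot p).1]
    simp only [G.rot_rot, ← Finset.expect_mul, hf']
  set g : V → ℝ := fun v => f v - β with hg
  have hg0 : 𝔼 v, g v = 0 := by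
    simp only [hg, Finset.expect_sub_distrib, Fintype.expect_const]
    exact sub_self β
  have hsplit : ∀ k, G.avg^[k] f = (fun _ => β) + G.avg^[k] g := by
    intro k
    induction k with
    | zero => funext v; simp [hg]
    | succ k ih => rw [Function.iterate_succ_apply', ih, avg_add, avg_const,
        Function.iterate_succ_apply']
  have hgf : 𝔼 v, g v ^ 2 ≤ β := by
    have : ∀ v, g v ^ 2 = f v ^ 2 - 2 * β * f v + β ^ 2 := fun v => by simp only [hg]; ring
    simp only [this, Finset.expect_sub_distrib, Finset.expect_add_distrib, Fintype.expect_const,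
      ← Finset.mul_expect]
    have h := hsq (g := f) fun v => .inl rfl
    have hff : 𝔼 v, f v = β := rfl
    rw [hff] at h ⊢
    nlinarith
  have hcs : (𝔼 v, f' v * G.avg^[k] g v) ^ 2 ≤ ((1 / 2) ^ k * β) ^ 2 := by
    refine (Finset.expect_mul_sq_le_sq_mul_sq _ _ _).trans ?_
    have h2 := hG.iterate k hg0
    have h3 : 𝔼 v, f' v ^ 2 ≤ β := hf'β ▸ hsq (g := f') fun v => .inr rfl
    have h4 : 0 ≤ 𝔼 v, f' v ^ 2 := Finset.expect_nonneg fun _ _ => sq_nonneg _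
    have h5 : 0 ≤ 𝔼 v, (G.avg^[k] g v) ^ 2 := Finset.expect_nonneg fun _ _ => sq_nonneg _
    calc _ ≤ β * ((1 / 4) ^ k * β) := by
          refine mul_le_mul h3 (h2.trans ?_) h5 hβ0
          gcongr
      _ = ((1 / 2) ^ k * β) ^ 2 := by
          rw [mul_pow, ← pow_mul, mul_comm k, pow_mul]; norm_num; ring
  have hcs' := abs_le_of_sq_le_sq hcs (by positivity)
  rw [hstart, hsplit]
  simp only [Pi.add_apply, mul_add, Finset.expect_add_distrib, ← Finset.expect_mul, hf'β]
  nlinarith [(le_abs_self _).trans hcs']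

end RotGraph

/-! ### Walks through marked darts -/

theorem sum_half_pow_le (s : Finset ℕ) (f : ℕ → ℕ) (hf : Set.InjOn f s) :
    ∑ i ∈ s, (1 / 2 : ℝ) ^ f i ≤ 2 := by
  rw [← Finset.sum_image (g := f) (f := fun k => (1 / 2 : ℝ) ^ k) hf]
  refine (Summable.sum_le_tsum _ (fun _ _ => by positivity) summable_geometric_two).trans ?_
  rw [tsum_geometric_two]

theorem sum_half_pow_dist_le (t i : ℕ) :
    ∑ j ∈ Finset.range t, (1 / 2 : ℝ) ^ (i - j + (j - i)) ≤ 4 := by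
  rw [← Finset.sum_filter_add_sum_filter_not _ fun j => j ≤ i]
  have h1 := sum_half_pow_le ((Finset.range t).filter (· ≤ i)) (fun j => i - j + (j - i)) (by
    intro a ha b hb h
    simp at ha hb h
    omega)
  have h2 := sum_half_pow_le ((Finset.range t).filter (¬ · ≤ i)) (fun j => i - j + (j - i)) (by
    intro a ha b hb h
    simp at ha hb h
    omega)
  linarith

/-- The second moment method, averaged over the lengths `l`: `E l` stands for the expected number of
bad positions and `R l` for the probability that there is one. -/
theorem moment_average {t : ℕ} (ht : 0 < t) {κ β : ℝ} (hκ0 : 0 ≤ κ) (hβ : 0 ≤ β) {E R : ℕ → ℝ}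
    (hcs : ∀ l, E l ^ 2 ≤ (t ^ 2 * β ^ 2 + 8 * t * β) * R l) (hR0 : ∀ l, 0 ≤ R l)
    (hE : κ * t ^ 2 * β ≤ ∑ l ∈ Finset.range (2 * t - 1), E l) :
    κ ^ 2 * (t * β) ≤ 4 * (t * β + 8) * 𝔼 l ∈ Finset.range (2 * t - 1), R l := by
  have hL : (0 : ℝ) < (2 * t - 1 : ℕ) := by exact_mod_cast (by omega : 0 < 2 * t - 1)
  have ht' : (0 : ℝ) < t := by exact_mod_cast ht
  have hL2 : ((2 * t - 1 : ℕ) : ℝ) ≤ 2 * t := by exact_mod_cast (by omega : 2 * t - 1 ≤ 2 * t)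
  set ρ := 𝔼 l ∈ Finset.range (2 * t - 1), R l with hρ
  have hρ0 : 0 ≤ ρ := Finset.expect_nonneg fun l _ => hR0 l
  have hsum : ∑ l ∈ Finset.range (2 * t - 1), R l = (2 * t - 1 : ℕ) * ρ := by
    rw [hρ, Finset.expect_eq_sum_div_card, Finset.card_range]
    field_simp
  have hall : (κ * t ^ 2 * β) ^ 2 ≤ (2 * t) ^ 2 * ((t ^ 2 * β ^ 2 + 8 * t * β) * ρ) := by
    calc (κ * t ^ 2 * β) ^ 2 ≤ (∑ l ∈ Finset.range (2 * t - 1), E l) ^ 2 := by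
          gcongr
      _ ≤ (Finset.range (2 * t - 1)).card * ∑ l ∈ Finset.range (2 * t - 1), E l ^ 2 :=
          sq_sum_le_card_mul_sum_sq
      _ ≤ (2 * t - 1 : ℕ) * ∑ l ∈ Finset.range (2 * t - 1),
            (t ^ 2 * β ^ 2 + 8 * t * β) * R l := by
          rw [Finset.card_range]
          exact mul_le_mul_of_nonneg_left (Finset.sum_le_sum fun l _ => hcs l) hL.le
      _ = (2 * t - 1 : ℕ) ^ 2 * ((t ^ 2 * β ^ 2 + 8 * t * β) * ρ) := by
          rw [← Finset.mul_sum, hsum]; ring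
      _ ≤ (2 * t) ^ 2 * ((t ^ 2 * β ^ 2 + 8 * t * β) * ρ) := by gcongr
  rcases hβ.eq_or_lt with h0 | hpos
  · rw [← h0]
    simp only [mul_zero, zero_add]
    positivity
  · have h1 : t ^ 3 * β * (κ ^ 2 * (t * β)) * β ≤ t ^ 3 * β * (4 * (t * β + 8) * ρ) * β := by
      calc _ = (κ * t ^ 2 * β) ^ 2 * β := by ring
        _ ≤ _ := mul_le_mul_of_nonneg_right hall hβ
        _ = _ := by ring
    exact le_of_mul_le_mul_left (le_of_mul_le_mul_right h1 hpos) (by positivity)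

namespace RotGraph

variable {V A : Type} {d : ℕ} [Fintype V] [Nonempty V] [NeZero d] {G : RotGraph V A d}

theorem expect_indicator_nonneg {ι : Type} (s : Finset ι) (p : ι → Prop) [DecidablePred p] :
    0 ≤ 𝔼 i ∈ s, if p i then (1 : ℝ) else 0 :=
  Finset.expect_nonneg fun _ _ => by split <;> norm_num

variable (G) in
/-- The `i`-th dart of the walk from `v` along `c` is in `F`. -/
def Mark (F : Finset (V × Fin d)) (v : V) (c : List (Fin d)) (i : ℕ) : Prop :=
  ∃ c₁ j c₂, c = c₁ ++ j :: c₂ ∧ c₁.length = i ∧ (G.follow v c₁, j) ∈ F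

omit [Fintype V] [Nonempty V] [NeZero d] in
theorem mark_iff {F : Finset (V × Fin d)} {v : V} {c₁ c₂ : List (Fin d)} {j : Fin d} {i : ℕ}
    (hi : c₁.length = i) : G.Mark F v (c₁ ++ j :: c₂) i ↔ (G.follow v c₁, j) ∈ F := by
  constructor
  · rintro ⟨c₁', j', c₂', h, hi', hF⟩
    obtain ⟨rfl, e⟩ := List.append_inj h (by omega)
    obtain ⟨rfl, -⟩ := List.cons.inj e
    exact hF
  · exact fun h => ⟨c₁, j, c₂, rfl, hi, h⟩

open Classical in
/-- The density of a set of darts. -/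
noncomputable def density (F : Finset (V × Fin d)) : ℝ :=
  𝔼 v, 𝔼 i, if (v, i) ∈ F then (1 : ℝ) else 0

omit [Nonempty V] [NeZero d] in
theorem density_nonneg (F : Finset (V × Fin d)) : 0 ≤ density F := by
  classical
  exact Finset.expect_nonneg fun v _ => expect_indicator_nonneg _ _

open Classical in
omit [Nonempty V] in
theorem expect_mark (F : Finset (V × Fin d)) (i k : ℕ) :
    𝔼 v, 𝔼 c ∈ words d (i + 1 + k), (if G.Mark F v c i then (1 : ℝ) else 0) = density F := by
  have h : ∀ v, 𝔼 c ∈ words d (i + 1 + k), (if G.Mark F v c i then (1 : ℝ) else 0) =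
      𝔼 c ∈ words d i, 𝔼 j, if (G.follow v c, j) ∈ F then (1 : ℝ) else 0 := by
    intro v
    rw [add_assoc, expect_words_add]
    refine Finset.expect_congr rfl fun c hc => ?_
    rw [add_comm 1 k, expect_words_succ]
    refine Finset.expect_congr rfl fun j _ => ?_
    simp only [mark_iff (mem_words.1 hc), Finset.expect_const (words_nonempty k)]
  simp only [h]
  exact G.expect_expect_follow i fun v => 𝔼 j, if (v, j) ∈ F then (1 : ℝ) else 0

open Classical in
/-- Two positions at distance `k + 1` of a random walk are both marked with probability about the
square of the density. -/
theorem HasGap.expect_mark_mark (hG : G.HasGap) (F : Finset (V × Fin d)) (i k m : ℕ) :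
    𝔼 v, 𝔼 c ∈ words d (i + 1 + (k + 1 + m)),
      ((if G.Mark F v c i then (1 : ℝ) else 0) *
        (if G.Mark F v c (i + 1 + k) then (1 : ℝ) else 0)) ≤
      density F ^ 2 + (1 / 2) ^ k * density F := by
  have h : ∀ v, 𝔼 c ∈ words d (i + 1 + (k + 1 + m)),
      ((if G.Mark F v c i then (1 : ℝ) else 0) *
        (if G.Mark F v c (i + 1 + k) then (1 : ℝ) else 0)) =
      𝔼 c ∈ words d i, 𝔼 j, (if (G.follow v c, j) ∈ F then (1 : ℝ) else 0) *
        𝔼 c' ∈ words d k, 𝔼 j',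
          if (G.follow (G.rot (G.follow v c, j)).1 c', j') ∈ F then (1 : ℝ) else 0 := by
    intro v
    rw [add_assoc i, expect_words_add]
    refine Finset.expect_congr rfl fun c hc => ?_
    rw [add_comm 1, expect_words_succ]
    refine Finset.expect_congr rfl fun j _ => ?_
    rw [add_assoc, expect_words_add, Finset.mul_expect]
    refine Finset.expect_congr rfl fun c' hc' => ?_
    rw [add_comm 1, expect_words_succ, Finset.mul_expect]
    refine Finset.expect_congr rfl fun j' _ => ?_
    have h1 := mem_words.1 hc
    have h2 := mem_words.1 hc'
    have h3 : ∀ c'' : List (Fin d), c ++ j :: (c' ++ j' :: c'') = (c ++ j :: c') ++ j' :: c'' := by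
      simp
    have h4 : (c ++ j :: c').length = i + 1 + k := by simp; omega
    have h5 : ∀ c'' : List (Fin d), (G.Mark F v (c ++ j :: (c' ++ j' :: c'')) (i + 1 + k) ↔
        (G.follow (G.rot (G.follow v c, j)).1 c', j') ∈ F) := by
      intro c''
      rw [h3, mark_iff h4, follow_append, follow_cons]
    simp only [mark_iff h1, h5]
    simp only [Finset.expect_const (words_nonempty m)]
  simp only [h]
  rw [G.expect_expect_follow i fun v => 𝔼 j, (if (v, j) ∈ F then (1 : ℝ) else 0) *
        𝔼 c' ∈ words d k, 𝔼 j', if (G.follow (G.rot (v, j)).1 c', j') ∈ F then (1 : ℝ) else 0]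
  exact hG.two_marks (φ := fun p => if p ∈ F then (1 : ℝ) else 0)
    (fun p => by split <;> norm_num) (fun p => by split <;> norm_num) k

open Classical in
/-- The second moment, for two positions `i`, `i'` of the marks in walks of length `l`. -/
theorem HasGap.expect_mark_mark' (hG : G.HasGap) (F : Finset (V × Fin d)) {l i i' : ℕ}
    (hi : i < l) (hi' : i' < l) :
    𝔼 v, 𝔼 c ∈ words d l, ((if G.Mark F v c i then (1 : ℝ) else 0) *
        (if G.Mark F v c i' then (1 : ℝ) else 0)) ≤
      density F ^ 2 + 2 * density F * (1 / 2) ^ (i - i' + (i' - i)) := by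
  have hF := density_nonneg F
  have main : ∀ {i i' : ℕ}, i < i' → i' < l →
      𝔼 v, 𝔼 c ∈ words d l, ((if G.Mark F v c i then (1 : ℝ) else 0) *
        (if G.Mark F v c i' then (1 : ℝ) else 0)) ≤
      density F ^ 2 + 2 * density F * (1 / 2) ^ (i' - i) := by
    intro i i' h h'
    obtain ⟨k, rfl⟩ := Nat.exists_eq_add_of_le (Nat.succ_le_of_lt h)
    obtain ⟨m, rfl⟩ := Nat.exists_eq_add_of_le (Nat.succ_le_of_lt h')
    have := hG.expect_mark_mark F i k m
    have e1 : i + 1 + (k + 1 + m) = (i.succ + k).succ + m := by omega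
    have e2 : i.succ + k - i = k + 1 := by omega
    rw [e1] at this
    rw [e2, pow_succ]
    refine this.trans (le_of_eq ?_)
    ring
  rcases lt_trichotomy i i' with h | rfl | h
  · simpa [h.le] using main h hi'
  · obtain ⟨k, rfl⟩ := Nat.exists_eq_add_of_le (Nat.succ_le_of_lt hi)
    have := expect_mark (G := G) F i k
    have h2 : ∀ v c, ((if G.Mark F v c i then (1 : ℝ) else 0) *
        (if G.Mark F v c i then (1 : ℝ) else 0)) = if G.Mark F v c i then (1 : ℝ) else 0 := by
      intro v c; split <;> norm_num
    simp only [h2, Nat.sub_self, add_zero, pow_zero, mul_one]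
    rw [this]
    nlinarith
  · simpa [h.le, mul_comm] using main h hi

open Classical in
/-- If for every dart `p` in `F` a random walk through `p` is bad at `p` with conditional
probability at least `κ`, then walks of random length are bad with constant probability.  This is
the second moment method for the number of bad positions of a walk. -/
theorem HasGap.reject_bound (hG : G.HasGap) (F : Finset (V × Fin d)) {t : ℕ} (ht : 0 < t)
    (Bad : V × Fin d → List (Fin d) → List (Fin d) → Prop) (Rej : V → List (Fin d) → Prop)
    {κ : ℝ} (hκ0 : 0 ≤ κ)
    (hκ : ∀ p ∈ F, κ * t ^ 2 ≤ ∑ i ∈ Finset.range t, ∑ k ∈ Finset.range t,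
      𝔼 c ∈ words d i, 𝔼 c' ∈ words d k, if Bad p c c' then (1 : ℝ) else 0)
    (hRej : ∀ v c j c', c.length < t → c'.length < t → (G.follow v c, j) ∈ F →
      Bad (G.follow v c, j) (G.rev v c) c' → Rej v (c ++ j :: c')) :
    κ ^ 2 * (t * density F) ≤ 4 * (t * density F + 8) * 𝔼 l ∈ Finset.range (2 * t - 1),
      𝔼 v, 𝔼 c ∈ words d (l + 1), if Rej v c then (1 : ℝ) else 0 := by
  set β := density F with hβdef
  have hβ : 0 ≤ β := density_nonneg F
  -- the positions `(i, k)`: `i` steps before and `k` steps after the marked dart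
  let P : ℕ → Finset (ℕ × ℕ) := fun l =>
    ((Finset.range t) ×ˢ (Finset.range t)).filter fun x => x.1 + x.2 = l
  let Z : ℕ × ℕ → V → List (Fin d) → ℝ := fun x v c =>
    if ∃ c₁ j c₂, c = c₁ ++ j :: c₂ ∧ c₁.length = x.1 ∧ c₂.length = x.2 ∧ (G.follow v c₁, j) ∈ F ∧
      Bad (G.follow v c₁, j) (G.rev v c₁) c₂ then 1 else 0
  let N : ℕ → V → List (Fin d) → ℝ := fun l v c => ∑ x ∈ P l, Z x v c
  let E : ℕ → (V → List (Fin d) → ℝ) → ℝ := fun l f => 𝔼 v, 𝔼 c ∈ words d (l + 1), f v c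
  let R : ℕ → ℝ := fun l => E l fun v c => if Rej v c then 1 else 0
  have hZ0 : ∀ x v c, 0 ≤ Z x v c := fun x v c => by dsimp only [Z]; split <;> norm_num
  have hP : ∀ {l x}, x ∈ P l ↔ (x.1 < t ∧ x.2 < t) ∧ x.1 + x.2 = l := by
    intro l x; simp [P]
  -- first moment
  have hfirst : κ * t ^ 2 * β ≤ ∑ l ∈ Finset.range (2 * t - 1), E l (N l) := by
    have h1 : ∀ i k, E (i + k) (Z (i, k)) = 𝔼 v, 𝔼 j, if (v, j) ∈ F then
        𝔼 c ∈ words d i, 𝔼 c' ∈ words d k, (if Bad (v, j) c c' then (1 : ℝ) else 0) else 0 := by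
      intro i k
      have h2 : ∀ v, 𝔼 c ∈ words d (i + k + 1), Z (i, k) v c = 𝔼 c ∈ words d i, 𝔼 j : Fin d,
          𝔼 c' ∈ words d k, if (G.follow v c, j) ∈ F ∧ Bad (G.follow v c, j) (G.rev v c) c' then
            (1 : ℝ) else 0 := by
        intro v
        rw [add_assoc, expect_words_add]
        refine Finset.expect_congr rfl fun c hc => ?_
        rw [expect_words_succ]
        refine Finset.expect_congr rfl fun j _ => Finset.expect_congr rfl fun c' hc' => ?_
        dsimp only [Z]
        congr 1
        refine propext ⟨?_, fun h => ⟨c, j, c', rfl, mem_words.1 hc, mem_words.1 hc', h⟩⟩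
        rintro ⟨c₁, j', c₂, h, hl, -, hF⟩
        obtain ⟨rfl, e⟩ := List.append_inj h (by rw [mem_words.1 hc, hl])
        obtain ⟨rfl, rfl⟩ := List.cons.inj e
        exact hF
      dsimp only [E]
      simp only [h2]
      rw [G.expect_reverse i]
      simp only [follow_rev, rev_rev]
      refine Finset.expect_congr rfl fun v _ => ?_
      rw [Finset.expect_comm]
      refine Finset.expect_congr rfl fun j _ => ?_
      by_cases hF : (v, j) ∈ F <;> simp [hF]
    have h2 : ∑ l ∈ Finset.range (2 * t - 1), E l (N l) =
        ∑ x ∈ Finset.range t ×ˢ Finset.range t, E (x.1 + x.2) (Z x) := by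
      rw [← Finset.sum_fiberwise_of_maps_to (t := Finset.range (2 * t - 1))
        (g := fun x : ℕ × ℕ => x.1 + x.2)]
      · refine Finset.sum_congr rfl fun l _ => ?_
        dsimp only [E, N]
        simp only [Finset.expect_sum_comm]
        refine Finset.sum_congr rfl fun x hx => ?_
        rw [(hP.1 hx).2]
      · intro x hx
        simp at hx ⊢
        omega
    rw [h2, Finset.sum_product]
    simp only [h1]
    simp only [← Finset.expect_sum_comm]
    rw [hβdef, density, Finset.mul_expect]
    refine Finset.expect_le_expect fun v _ => ?_
    rw [Finset.mul_expect]
    refine Finset.expect_le_expect fun j _ => ?_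
    by_cases hF : (v, j) ∈ F
    · simpa [hF] using hκ _ hF
    · simp [hF]
  -- second moment
  set B : ℝ := t ^ 2 * β ^ 2 + 8 * t * β with hB
  have hsecond : ∀ l, E l (fun v c => N l v c ^ 2) ≤ B := by
    intro l
    have h1 : E l (fun v c => N l v c ^ 2) ≤ ∑ x ∈ P l, ∑ y ∈ P l,
        (β ^ 2 + 2 * β * (1 / 2) ^ (x.1 - y.1 + (y.1 - x.1))) := by
      dsimp only [E, N]
      simp only [sq (Finset.sum _ _), Finset.sum_mul_sum, Finset.expect_sum_comm]
      refine Finset.sum_le_sum fun x hx => Finset.sum_le_sum fun y hy => ?_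
      have hx' := hP.1 hx
      have hy' := hP.1 hy
      refine le_trans ?_ (hG.expect_mark_mark' F (l := l + 1) (i := x.1) (i' := y.1)
        (by omega) (by omega))
      have hZ : ∀ x v c, Z x v c ≤ if G.Mark F v c x.1 then 1 else 0 := by
        intro x v c
        dsimp only [Z]
        split_ifs with h h' h'
        · exact le_rfl
        · obtain ⟨c₁, j, c₂, h1, h2, h3, h4, h5⟩ := h
          exact absurd ⟨c₁, j, c₂, h1, h2, h4⟩ h'
        · norm_num
        · norm_num
      refine Finset.expect_le_expect fun v _ => Finset.expect_le_expect fun c _ => ?_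
      exact mul_le_mul (hZ _ _ _) (hZ _ _ _) (hZ0 _ _ _) (by split <;> norm_num)
    have hproj : ∀ g : ℕ → ℝ, (∀ i, 0 ≤ g i) → ∑ x ∈ P l, g x.1 ≤ ∑ i ∈ Finset.range t, g i := by
      intro g hg
      rw [← Finset.sum_image (g := Prod.fst) (f := g)]
      · refine Finset.sum_le_sum_of_subset_of_nonneg ?_ fun i _ _ => hg i
        intro i hi
        obtain ⟨x, hx, rfl⟩ := Finset.mem_image.1 hi
        simpa using (hP.1 hx).1.1
      · intro x hx y hy h
        have := (hP.1 hx).2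
        have := (hP.1 hy).2
        ext
        · exact h
        · omega
    refine h1.trans ?_
    calc _ ≤ ∑ x ∈ P l, ∑ j ∈ Finset.range t,
          (β ^ 2 + 2 * β * (1 / 2) ^ (x.1 - j + (j - x.1))) :=
          Finset.sum_le_sum fun x _ => hproj (fun j =>
            β ^ 2 + 2 * β * (1 / 2) ^ (x.1 - j + (j - x.1))) fun j => by positivity
      _ ≤ ∑ i ∈ Finset.range t, ∑ j ∈ Finset.range t,
          (β ^ 2 + 2 * β * (1 / 2) ^ (i - j + (j - i))) :=
          hproj (fun i => ∑ j ∈ Finset.range t,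
            (β ^ 2 + 2 * β * (1 / 2) ^ (i - j + (j - i)))) fun i =>
              Finset.sum_nonneg fun j _ => by positivity
      _ ≤ ∑ i ∈ Finset.range t, (t * β ^ 2 + 2 * β * 4) := by
          refine Finset.sum_le_sum fun i _ => ?_
          rw [Finset.sum_add_distrib, ← Finset.mul_sum]
          gcongr
          · simp
          · exact sum_half_pow_dist_le t i
      _ = B := by
          rw [Finset.sum_const, Finset.card_range, nsmul_eq_mul, hB]
          ring
  -- the second moment method, for each length
  have hR0 : ∀ l, 0 ≤ R l := fun l =>
    Finset.expect_nonneg fun v _ => expect_indicator_nonneg _ _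
  have hcs : ∀ l, E l (N l) ^ 2 ≤ B * R l := by
    intro l
    have h1 : ∀ v c, N l v c = N l v c * if Rej v c then 1 else 0 := by
      intro v c
      by_cases h : Rej v c
      · simp [h]
      · simp only [h, if_false, mul_zero]
        refine Finset.sum_eq_zero fun x hx => if_neg ?_
        rintro ⟨c₁, j, c₂, rfl, h1, h2, h3, h4⟩
        have := (hP.1 hx).1
        exact h (hRej v c₁ j c₂ (by omega) (by omega) h3 h4)
    have h2 : ∀ v c, (if Rej v c then (1 : ℝ) else 0) ^ 2 = if Rej v c then 1 else 0 := by
      intro v c; split <;> norm_num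
    have h3 := Finset.expect_mul_sq_le_sq_mul_sq (Finset.univ ×ˢ words d (l + 1))
      (fun p : V × List (Fin d) => N l p.1 p.2) (fun p => if Rej p.1 p.2 then (1 : ℝ) else 0)
    simp only [h2, ← h1, Finset.expect_product] at h3
    exact h3.trans (mul_le_mul_of_nonneg_right (hsecond l) (hR0 l))
  exact moment_average ht hκ0 hβ (by simpa only [hB] using hcs) hR0 hfirst

end RotGraph

/-! ### Opinions and the test of a walk -/

/-- A pair stands for a set of one or two values. -/
def InPair {A : Type} (a : A) (x : A × A) : Prop := a = x.1 ∨ a = x.2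

/-- The data about one step of a walk that the test of the walk sees: the labels of the dart and of
the reversed dart, and the constraint. -/
abbrev Step (A : Type) (d : ℕ) : Type := Fin d × Fin d × (A → A → Bool)

/-- The test of a walk with symbols `s` and `s'` at its ends.  A symbol holds an opinion, a set of
one or two values, about the end of every walk of length at most `t`.  The test looks at the darts
of the walk with fewer than `t` steps on either side: the opinions of the two ends of the walk about
either vertex of the dart have a common value, and all values that the start of the walk admits for
the source of the dart are compatible with all values that the end of the walk admits for its
target. -/
def Accepts {A S : Type} {d : ℕ} (t : ℕ) (op : S → List (Fin d) → A × A) (w : List (Step A d))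
    (s s' : S) : Prop :=
  ∀ w₁ k w₂, w = w₁ ++ k :: w₂ → w₁.length < t → w₂.length < t →
    (∃ a, InPair a (op s (w₁.map fun k => k.1)) ∧
      InPair a (op s' ((w₂.map fun k => k.2.1).reverse ++ [k.2.1]))) ∧
    (∃ a, InPair a (op s (w₁.map (fun k => k.1) ++ [k.1])) ∧
      InPair a (op s' (w₂.map fun k => k.2.1).reverse)) ∧
    ∀ a b, InPair a (op s (w₁.map fun k => k.1)) →
      InPair b (op s' (w₂.map fun k => k.2.1).reverse) → k.2.2 a b = true

namespace RotGraph

variable {V A S : Type} {d : ℕ} (G : RotGraph V A d)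

/-- The steps of the walk from `v` along `c`. -/
def steps : V → List (Fin d) → List (Step A d)
  | _, [] => []
  | v, i :: c => (i, (G.rot (v, i)).2, G.rel (v, i)) :: steps (G.rot (v, i)).1 c

@[simp] theorem steps_nil (v : V) : G.steps v [] = [] := rfl

@[simp] theorem steps_cons (v : V) (i : Fin d) (c : List (Fin d)) :
    G.steps v (i :: c) = (i, (G.rot (v, i)).2, G.rel (v, i)) :: G.steps (G.rot (v, i)).1 c := rfl

theorem steps_append (v : V) (c c' : List (Fin d)) :
    G.steps v (c ++ c') = G.steps v c ++ G.steps (G.follow v c) c' := by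
  induction c generalizing v with
  | nil => rfl
  | cons i c ih => simp [ih]

theorem map_fst_steps (v : V) (c : List (Fin d)) : (G.steps v c).map (fun k => k.1) = c := by
  induction c generalizing v with
  | nil => rfl
  | cons i c ih => simp [ih]

theorem reverse_map_steps (v : V) (c : List (Fin d)) :
    ((G.steps v c).map fun k => k.2.1).reverse = G.rev v c := by
  induction c generalizing v with
  | nil => rfl
  | cons i c ih => simp [ih]

@[simp] theorem length_steps (v : V) (c : List (Fin d)) : (G.steps v c).length = c.length := by
  rw [← List.length_map (f := fun k : Step A d => k.1), map_fst_steps]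

variable (t : ℕ) (op : S → List (Fin d) → A × A)

/-- The opinion about `x` at the end of the walk from `x` along `c`, in the assignment `ψ`. -/
def opinion (ψ : V → S) (x : V) (c : List (Fin d)) : A × A :=
  op (ψ (G.follow x c)) (G.rev x c)

/-- A position of a walk where the test rejects; `p` is the dart, `c` the walk from its source to
the start, and `c'` the walk from its target to the end. -/
def Bad (ψ : V → S) (p : V × Fin d) (c c' : List (Fin d)) : Prop :=
  (¬ ∃ a, InPair a (G.opinion op ψ p.1 c) ∧ InPair a (G.opinion op ψ p.1 (p.2 :: c'))) ∨
  (¬ ∃ a, InPair a (G.opinion op ψ (G.rot p).1 c') ∧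
    InPair a (G.opinion op ψ (G.rot p).1 ((G.rot p).2 :: c))) ∨
  ∃ a b, InPair a (G.opinion op ψ p.1 c) ∧ InPair b (G.opinion op ψ (G.rot p).1 c') ∧
    ¬ G.rel p a b

variable {t op}

theorem not_accepts_of_bad {ψ : V → S} {v : V} {c c' : List (Fin d)} {j : Fin d}
    (hc : c.length < t) (hc' : c'.length < t) (h : G.Bad op ψ (G.follow v c, j) (G.rev v c) c') :
    ¬ Accepts t op (G.steps v (c ++ j :: c')) (ψ v) (ψ (G.follow v (c ++ j :: c'))) := by
  intro hacc
  obtain ⟨h1, h2, h3⟩ := hacc (G.steps v c) _ (G.steps _ c') (by rw [steps_append, steps_cons])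
    (by simpa) (by simpa)
  simp only [map_fst_steps, reverse_map_steps, follow_append, follow_cons] at h1 h2 h3
  simp only [Bad, opinion, follow_cons, rev_cons, follow_rev, rev_rev, G.rot_rot] at h
  rcases h with h | h | ⟨a, b, ha, hb, hab⟩
  · exact h h1
  · exact h (h2.imp fun a h => h.symm)
  · exact hab (h3 a b ha hb)

/-- The test accepts if every vertex `u` holds opinions `o u` about the ends of its walks that do not
depend on the walk, the opinions of any two vertices meet, and all opinions are compatible. -/
theorem accepts_of_opinions {χ : V → S} {o : V → V → A × A} {v : V} {c : List (Fin d)}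
    (ho : ∀ u c, c.length ≤ t → op (χ u) c = o u (G.follow u c))
    (h1 : ∀ u u' x, ∃ a, InPair a (o u x) ∧ InPair a (o u' x))
    (h2 : ∀ u u' p a b, InPair a (o u p.1) → InPair b (o u' (G.rot p).1) → G.rel p a b) :
    Accepts t op (G.steps v c) (χ v) (χ (G.follow v c)) := by
  rintro w₁ k w₂ hw hl₁ hl₂
  -- split the word as the steps are split
  obtain ⟨c₁, j, c₂, rfl, hc₁, hc₂⟩ : ∃ c₁ j c₂, c = c₁ ++ j :: c₂ ∧ c₁.length = w₁.length ∧
      c₂.length = w₂.length := by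
    have := congrArg (List.map fun k => k.1) hw
    rw [map_fst_steps, List.map_append, List.map_cons] at this
    exact ⟨_, _, _, this, by simp, by simp⟩
  rw [steps_append, steps_cons] at hw
  obtain ⟨rfl, e⟩ := List.append_inj hw (by simp [hc₁])
  obtain ⟨rfl, rfl⟩ := List.cons.inj e
  simp only [map_fst_steps, reverse_map_steps, follow_append, follow_cons]
  set x := G.follow v c₁
  set y := (G.rot (x, j)).1
  have e1 : op (χ v) c₁ = o v x := ho _ _ (by omega)
  have e2 : op (χ v) (c₁ ++ [j]) = o v y := by
    rw [ho _ _ (by simp; omega), follow_append, follow_cons, follow_nil]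
  have e3 : op (χ (G.follow y c₂)) (G.rev y c₂) = o (G.follow y c₂) y := by
    rw [ho _ _ (by simp; omega), follow_rev]
  have e4 : op (χ (G.follow y c₂)) (G.rev y c₂ ++ [(G.rot (x, j)).2]) = o (G.follow y c₂) x := by
    rw [ho _ _ (by simp; omega), follow_append, follow_rev, follow_cons, follow_nil]
    simp [y, G.rot_rot]
  rw [e1, e2, e3, e4]
  exact ⟨h1 _ _ _, h1 _ _ _, fun a b ha hb => h2 _ _ _ a b ha hb⟩

/-! ### Plurality decoding -/

section decoding

/-- The sum over `i < t` of the averages over the words of length `i`. -/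
noncomputable def wordSum {d : ℕ} (t : ℕ) (f : List (Fin d) → ℝ) : ℝ :=
  ∑ i ∈ Finset.range t, 𝔼 c ∈ words d i, f c

theorem wordSum_mono {f g : List (Fin d) → ℝ} (h : ∀ c, f c ≤ g c) : wordSum t f ≤ wordSum t g :=
  Finset.sum_le_sum fun _ _ => Finset.expect_le_expect fun c _ => h c

theorem wordSum_congr {f g : List (Fin d) → ℝ} (h : ∀ c, c.length < t → f c = g c) :
    wordSum t f = wordSum t g :=
  Finset.sum_congr rfl fun i hi => Finset.expect_congr rfl fun c hc =>
    h c (by rw [mem_words.1 hc]; exact Finset.mem_range.1 hi)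

theorem wordSum_sub (f g : List (Fin d) → ℝ) :
    wordSum t (fun c => f c - g c) = wordSum t f - wordSum t g := by
  simp [wordSum, Finset.expect_sub_distrib]

theorem wordSum_sum {κ : Type} (s : Finset κ) (f : κ → List (Fin d) → ℝ) :
    wordSum t (fun c => ∑ k ∈ s, f k c) = ∑ k ∈ s, wordSum t (f k) := by
  simp only [wordSum, Finset.expect_sum_comm]
  rw [Finset.sum_comm]

theorem wordSum_const [NeZero d] (a : ℝ) : wordSum (d := d) t (fun _ => a) = t * a := by
  simp [wordSum, Finset.expect_const (words_nonempty _)]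

theorem wordSum_mul (f : List (Fin d) → ℝ) (a : ℝ) :
    wordSum t (fun c => f c * a) = wordSum t f * a := by
  simp [wordSum, Finset.expect_mul, Finset.sum_mul]

theorem mul_wordSum (f : List (Fin d) → ℝ) (a : ℝ) :
    wordSum t (fun c => a * f c) = a * wordSum t f := by
  simp [wordSum, Finset.mul_expect, Finset.mul_sum]

theorem wordSum_comm {d' : ℕ} (f : List (Fin d) → List (Fin d') → ℝ) :
    wordSum t (fun c => wordSum t (f c)) = wordSum t fun c' => wordSum t fun c => f c c' := by
  simp only [wordSum, Finset.expect_sum_comm]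
  rw [Finset.sum_comm]
  refine Finset.sum_congr rfl fun _ _ => Finset.sum_congr rfl fun _ _ => ?_
  rw [Finset.expect_comm]

open Classical in
/-- Independent opinions rarely meet if no value is popular with one of them. -/
theorem wordSum_disjoint [NeZero d] [Fintype A] {θ : ℝ} {o o' : List (Fin d) → A × A}
    (h : ∀ a, wordSum t (fun c => if InPair a (o c) then (1 : ℝ) else 0) ≤ θ * t) :
    (1 - 2 * θ) * t ^ 2 ≤ wordSum t fun c => wordSum t fun c' =>
      if ¬ ∃ a, InPair a (o c) ∧ InPair a (o' c') then (1 : ℝ) else 0 := by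
  have h1 : ∀ c c', 1 - ∑ a : A, (if InPair a (o c) then (1 : ℝ) else 0) *
      (if InPair a (o' c') then 1 else 0) ≤
      if ¬ ∃ a, InPair a (o c) ∧ InPair a (o' c') then (1 : ℝ) else 0 := by
    intro c c'
    have h0 : ∀ a ∈ Finset.univ, (0 : ℝ) ≤ (if InPair a (o c) then (1 : ℝ) else 0) *
        (if InPair a (o' c') then 1 else 0) := fun a _ => by positivity
    by_cases hm : ∃ a, InPair a (o c) ∧ InPair a (o' c')
    · obtain ⟨a, ha, ha'⟩ := id hm
      have := Finset.single_le_sum h0 (Finset.mem_univ a)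
      simp only [ha, ha', if_true, mul_one] at this
      simp only [hm, not_true_eq_false, if_false]
      linarith
    · simp only [hm, not_false_eq_true, if_true]
      linarith [Finset.sum_nonneg h0]
  have h2 : ∀ c', ∑ a : A, (if InPair a (o' c') then (1 : ℝ) else 0) ≤ 2 := by
    intro c'
    rw [Finset.sum_boole]
    have : (Finset.univ.filter fun a => InPair a (o' c')) ⊆ {(o' c').1, (o' c').2} := by
      intro a ha
      have := (Finset.mem_filter.1 ha).2
      unfold InPair at this
      simpa using this
    exact_mod_cast (Finset.card_le_card this).trans Finset.card_le_two
  refine le_trans ?_ (wordSum_mono fun c => wordSum_mono fun c' => h1 c c')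
  simp only [wordSum_sub, wordSum_const, wordSum_sum, wordSum_mul, mul_wordSum, mul_one]
  have h3 : ∑ a : A, wordSum t (fun c => if InPair a (o c) then (1 : ℝ) else 0) *
      wordSum t (fun c => if InPair a (o' c) then (1 : ℝ) else 0) ≤ θ * t * (t * 2) := by
    rcases isEmpty_or_nonempty A with hA | ⟨⟨a⟩⟩
    · exact hA.elim (o []).1
    have hθ : 0 ≤ θ * t := le_trans (Finset.sum_nonneg fun _ _ => expect_indicator_nonneg _ _) (h a)
    calc _ ≤ ∑ a : A, θ * t * wordSum t (fun c => if InPair a (o' c) then (1 : ℝ) else 0) := by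
          refine Finset.sum_le_sum fun a _ => mul_le_mul_of_nonneg_right (h a) ?_
          exact Finset.sum_nonneg fun _ _ => expect_indicator_nonneg _ _
      _ = θ * t * wordSum t fun c => ∑ a : A, if InPair a (o' c) then (1 : ℝ) else 0 := by
          rw [wordSum_sum, Finset.mul_sum]
      _ ≤ θ * t * wordSum (d := d) t fun _ => 2 :=
          mul_le_mul_of_nonneg_left (wordSum_mono h2) hθ
      _ = _ := by rw [wordSum_const]
  nlinarith

variable [Finite A] [Nonempty A]

variable (t op) in
open Classical in
/-- The popularity of the value `a` for `x`: (`t` times) the probability that the end of a random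
walk from `x` of random length less than `t` admits `a` for `x`. -/
noncomputable def popularity (ψ : V → S) (x : V) (a : A) : ℝ :=
  wordSum t fun c => if InPair a (G.opinion op ψ x c) then (1 : ℝ) else 0

variable (t op) in
/-- The plurality decoding of an assignment of the powered graph. -/
noncomputable def decode (ψ : V → S) (x : V) : A :=
  Classical.choose (Finite.exists_max (G.popularity t op ψ x))

theorem popularity_le_decode (ψ : V → S) (x : V) (a : A) :
    G.popularity t op ψ x a ≤ G.popularity t op ψ x (G.decode t op ψ x) :=
  Classical.choose_spec (Finite.exists_max (G.popularity t op ψ x)) a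

/-- The decoding at `x` depends only on the values at distance less than `t` from `x`. -/
theorem decode_congr {ψ φ : V → S} {x : V}
    (h : ∀ c : List (Fin d), c.length < t → ψ (G.follow x c) = φ (G.follow x c)) :
    G.decode t op ψ x = G.decode t op φ x := by
  have : G.popularity t op ψ x = G.popularity t op φ x := by
    funext a
    exact wordSum_congr fun c hc => by rw [opinion, opinion, h c hc]
  rw [decode, decode]
  congr 1
  rw [this]

open Classical in
/-- A walk through a dart that the decoded assignment violates is likely to be bad at this dart:
either the decoded values of both its ends are popular, or the opinions about an end are likely to
be disjoint. -/
theorem bad_of_decode_violates [NeZero d] {ψ : V → S} {p : V × Fin d}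
    (hp : ¬ G.rel p (G.decode t op ψ p.1) (G.decode t op ψ (G.rot p).1)) :
    0.171 * (t : ℝ) ^ 2 ≤ ∑ i ∈ Finset.range t, ∑ k ∈ Finset.range t,
      𝔼 c ∈ words d i, 𝔼 c' ∈ words d k, if G.Bad op ψ p c c' then (1 : ℝ) else 0 := by
  have := Fintype.ofFinite A
  have hsum : ∑ i ∈ Finset.range t, ∑ k ∈ Finset.range t,
      𝔼 c ∈ words d i, 𝔼 c' ∈ words d k, (if G.Bad op ψ p c c' then (1 : ℝ) else 0) =
      wordSum t fun c => wordSum t fun c' => if G.Bad op ψ p c c' then (1 : ℝ) else 0 := by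
    simp only [wordSum, Finset.expect_sum_comm]
  rw [hsum]
  have ht : (0 : ℝ) ≤ t := t.cast_nonneg
  have hmono : ∀ {P Q : List (Fin d) → List (Fin d) → Prop} [∀ c c', Decidable (P c c')]
      [∀ c c', Decidable (Q c c')], (∀ c c', P c c' → Q c c') →
      wordSum t (fun c => wordSum t fun c' => if P c c' then (1 : ℝ) else 0) ≤
      wordSum t (fun c => wordSum t fun c' => if Q c c' then (1 : ℝ) else 0) := by
    intro P Q _ _ h
    refine wordSum_mono fun c => wordSum_mono fun c' => ?_
    by_cases hP : P c c'
    · simp [hP, h c c' hP]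
    · rw [if_neg hP]; split <;> norm_num
  -- the threshold `0.414` balances its square against `1 - 2 * 0.414`
  by_cases hx : G.popularity t op ψ p.1 (G.decode t op ψ p.1) ≤ 0.414 * t
  · have h1 := wordSum_disjoint (t := t) (θ := 0.414) (o := G.opinion op ψ p.1)
      (o' := fun c' => G.opinion op ψ p.1 (p.2 :: c'))
      fun a => (G.popularity_le_decode ψ p.1 a).trans hx
    refine le_trans ?_ (h1.trans (hmono fun c c' h => .inl h))
    nlinarith [sq_nonneg (t : ℝ)]
  by_cases hy : G.popularity t op ψ (G.rot p).1 (G.decode t op ψ (G.rot p).1) ≤ 0.414 * t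
  · have h1 := wordSum_disjoint (t := t) (θ := 0.414) (o := G.opinion op ψ (G.rot p).1)
      (o' := fun c' => G.opinion op ψ (G.rot p).1 ((G.rot p).2 :: c'))
      fun a => (G.popularity_le_decode ψ _ a).trans hy
    rw [wordSum_comm] at h1
    refine le_trans ?_ (h1.trans (hmono fun c c' h => .inr (.inl h)))
    nlinarith [sq_nonneg (t : ℝ)]
  · push Not at hx hy
    refine le_trans ?_ (hmono (P := fun c c' => InPair (G.decode t op ψ p.1)
      (G.opinion op ψ p.1 c) ∧ InPair (G.decode t op ψ (G.rot p).1)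
      (G.opinion op ψ (G.rot p).1 c')) fun c c' h => .inr (.inr ⟨_, _, h.1, h.2, hp⟩))
    have h1 : ∀ P Q : Prop, (if P ∧ Q then (1 : ℝ) else 0) =
        (if P then (1 : ℝ) else 0) * if Q then 1 else 0 := by
      intro P Q; by_cases P <;> by_cases Q <;> simp [*]
    simp only [h1, mul_wordSum, wordSum_mul]
    have h2 : 0.414 * (t : ℝ) * (0.414 * t) ≤ G.popularity t op ψ p.1 (G.decode t op ψ p.1) *
        G.popularity t op ψ (G.rot p).1 (G.decode t op ψ (G.rot p).1) :=
      mul_le_mul hx.le hy.le (by positivity) (le_trans (by positivity) hx.le)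
    simp only [popularity] at h2
    refine le_trans ?_ h2
    nlinarith [sq_nonneg (t : ℝ)]

end decoding

/-! ### Soundness and completeness of the powered graph -/

variable [Fintype V]

open Classical in
/-- The fraction of the darts that the assignment violates. -/
noncomputable def violated (ψ : V → A) : ℝ :=
  𝔼 v, 𝔼 i, if G.rel (v, i) (ψ v) (ψ (G.rot (v, i)).1) then (0 : ℝ) else 1

variable (t op) in
open Classical in
/-- The probability that the test of a random walk, of random length between `1` and `2 t - 1`,
rejects. -/
noncomputable def rejected (ψ : V → S) : ℝ :=
  𝔼 l ∈ Finset.range (2 * t - 1), 𝔼 v, 𝔼 c ∈ words d (l + 1),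
    if Accepts t op (G.steps v c) (ψ v) (ψ (G.follow v c)) then (0 : ℝ) else 1

/-- Soundness for a single assignment: if the test rejects rarely, then the decoding violates few
darts.  With `μ = t * density ≥ 50` the rejection probability is at least
`0.171 ^ 2 * μ / (4 * (μ + 8)) > 0.00588`. -/
theorem HasGap.violated_decode_lt [Finite A] [Nonempty A] [Nonempty V] [NeZero d] {G : RotGraph V A d}
    (hG : G.HasGap) {ψ : V → S} (h : G.rejected t op ψ ≤ 0.00588) {ε : ℝ} (hε : 0 < ε)
    (ht : 100 / ε ≤ t) : G.violated (G.decode t op ψ) < ε / 2 := by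
  classical
  by_contra! hv
  let F : Finset (V × Fin d) := Finset.univ.filter fun p =>
    ¬ G.rel p (G.decode t op ψ p.1) (G.decode t op ψ (G.rot p).1)
  have hF : density F = G.violated (G.decode t op ψ) := by
    refine Finset.expect_congr rfl fun v _ => Finset.expect_congr rfl fun i _ => ?_
    simp only [F, Finset.mem_filter, Finset.mem_univ, true_and, ite_not]
  have ht0 : (0 : ℝ) < t := lt_of_lt_of_le (by positivity) ht
  have key := hG.reject_bound F (t := t) (by exact_mod_cast ht0) (G.Bad op ψ)
    (fun v c => ¬ Accepts t op (G.steps v c) (ψ v) (ψ (G.follow v c))) (κ := 0.171) (by norm_num)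
    (fun p hp => by
      simp only [F, Finset.mem_filter, Finset.mem_univ, true_and] at hp
      convert G.bad_of_decode_violates hp)
    fun v c j c' hc hc' _ hb => G.not_accepts_of_bad hc hc' hb
  have hμ : 50 ≤ t * density F := by
    rw [hF]
    rw [div_le_iff₀ hε] at ht
    nlinarith
  set μ := t * density F
  have h' : 4 * (μ + 8) * G.rejected t op ψ ≤ 4 * (μ + 8) * 0.00588 := by gcongr
  have h'' : 0.171 ^ 2 * μ ≤ 4 * (μ + 8) * G.rejected t op ψ := by
    have e : ∀ P : Prop, (if P then (0 : ℝ) else 1) = if ¬ P then 1 else 0 := by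
      intro P; by_cases P <;> simp [*]
    simp only [rejected, e]
    convert key
  norm_num at h' h''
  linarith

/-- A change of an assignment at few vertices violates few more darts. -/
theorem violated_le [NeZero d] [DecidableEq V] (ψ φ : V → A) (s : Finset V)
    (h : ∀ x ∉ s, φ x = ψ x) :
    G.violated φ ≤ G.violated ψ + 2 * (s.card / Fintype.card V) := by
  classical
  have h1 : ∀ v i, (if G.rel (v, i) (φ v) (φ (G.rot (v, i)).1) then (0 : ℝ) else 1) ≤
      (if G.rel (v, i) (ψ v) (ψ (G.rot (v, i)).1) then (0 : ℝ) else 1) +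
      ((if v ∈ s then 1 else 0) + if (G.rot (v, i)).1 ∈ s then 1 else 0) := by
    intro v i
    by_cases h1 : v ∈ s
    · simp only [h1, if_true]
      split_ifs <;> norm_num
    by_cases h2 : (G.rot (v, i)).1 ∈ s
    · simp only [h2, if_true]
      split_ifs <;> norm_num
    · rw [h _ h1, h _ h2]
      simp [h1, h2]
  have h2 : 𝔼 v : V, (if v ∈ s then (1 : ℝ) else 0) = s.card / Fintype.card V := by
    rw [Fintype.expect_eq_sum_div_card]
    simp
  have h3 := G.expect_avg fun v => if v ∈ s then (1 : ℝ) else 0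
  calc _ ≤ 𝔼 v, 𝔼 i, ((if G.rel (v, i) (ψ v) (ψ (G.rot (v, i)).1) then (0 : ℝ) else 1) +
      ((if v ∈ s then (1 : ℝ) else 0) + if (G.rot (v, i)).1 ∈ s then (1 : ℝ) else 0)) :=
        Finset.expect_le_expect fun v _ => Finset.expect_le_expect fun i _ => h1 v i
    _ = _ := by
        simp only [Finset.expect_add_distrib]
        simp only [Fintype.expect_const]
        rw [h2]
        simp only [avg] at h3
        rw [h3, h2]
        simp only [violated]
        ring

end RotGraph

/-! ### Reconfiguration paths -/

section

variable {V A : Type}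

/-- There is a path of good assignments from `ψ` to `φ` that changes one value at a time. -/
def Reconfigurable [DecidableEq V] (Good : (V → A) → Prop) (ψ φ : V → A) : Prop :=
  Good ψ ∧ Relation.ReflTransGen
    (fun χ χ' => Good χ' ∧ ∃ v a, χ' = Function.update χ v a) ψ φ

namespace Reconfigurable

variable [DecidableEq V] {Good : (V → A) → Prop} {ψ φ χ : V → A}

theorem refl (h : Good ψ) : Reconfigurable Good ψ ψ := ⟨h, .refl⟩

theorem trans (h₁ : Reconfigurable Good ψ φ) (h₂ : Reconfigurable Good φ χ) :
    Reconfigurable Good ψ χ := ⟨h₁.1, h₁.2.trans h₂.2⟩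

/-- Two assignments are connected if all their mixtures are good. -/
theorem of_mixtures [Finite V] (h : ∀ χ : V → A, (∀ v, χ v = ψ v ∨ χ v = φ v) → Good χ) :
    Reconfigurable Good ψ φ := by
  have := Fintype.ofFinite V
  suffices H : ∀ s : Finset V, Reconfigurable Good ψ fun v => if v ∈ s then φ v else ψ v by
    simpa using H Finset.univ
  intro s
  induction s using Finset.induction_on with
  | empty => simpa using refl (h ψ fun v => .inl rfl)
  | insert a s ha ih =>
    refine ⟨ih.1, ih.2.tail ⟨h _ fun v => ?_, a, φ a, ?_⟩⟩
    · split
      · exact .inr rfl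
      · exact .inl rfl
    · funext v
      by_cases hv : v = a
      · subst hv; simp
      · simp [hv]

end Reconfigurable

namespace ConstraintGraph

variable (G : ConstraintGraph V A)

theorem encard_ne_le_one_iff [DecidableEq V] [Nonempty V] {χ χ' : V → A} :
    {v | χ v ≠ χ' v}.encard ≤ 1 ↔ ∃ v a, χ' = Function.update χ v a := by
  constructor
  · intro h
    rw [Set.encard_le_one_iff_subsingleton] at h
    by_cases hv : ∃ v, χ v ≠ χ' v
    · obtain ⟨v, hv⟩ := hv
      refine ⟨v, χ' v, funext fun u => ?_⟩
      by_cases hu : u = v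
      · subst hu; simp
      · rw [Function.update_of_ne hu]
        by_contra hne
        exact hu (h (Ne.symm hne) hv)
    · push Not at hv
      exact ⟨Classical.arbitrary V, χ (Classical.arbitrary V), by
        rw [Function.update_eq_self]; exact (funext hv).symm⟩
  · rintro ⟨v, a, rfl⟩
    rw [Set.encard_le_one_iff_subsingleton]
    have : ∀ u, χ u ≠ Function.update χ v a u → u = v := fun u hu => by
      by_contra h
      rw [Function.update_of_ne h] at hu
      exact hu rfl
    intro x hx y hy
    rw [this x hx, this y hy]

/-- The supremum in `reconfVal` is attained.  For `r ≤ 0` the equivalence could fail, since the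
supremum of the empty set is `0`. -/
theorem le_reconfVal_iff [Finite V] [Nonempty V] [Finite A] [DecidableEq V] {r : ℝ} (hr : 0 < r)
    (ini tar : V → A) :
    r ≤ G.reconfVal ini tar ↔ Reconfigurable (fun ψ => r ≤ G.val ψ) ini tar := by
  have hpath : ∀ χ, Reconfigurable (fun ψ => r ≤ G.val ψ) ini χ ↔
      ∃ (T : ℕ) (seq : Fin (T + 1) → V → A), IsReconfSeq ini χ T seq ∧ ∀ i, r ≤ G.val (seq i) := by
    intro χ
    constructor
    · rintro ⟨h0, h⟩
      induction h with
      | refl => exact ⟨0, fun _ => ini, ⟨rfl, rfl, fun i => i.elim0⟩, fun _ => h0⟩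
      | tail _ hstep ih =>
        obtain ⟨T, seq, ⟨h1, h2, h3⟩, h4⟩ := ih
        obtain ⟨hgood, hup⟩ := hstep
        refine ⟨T + 1, Fin.snoc (α := fun _ => V → A) seq _, ⟨?_, Fin.snoc_last _ _, fun i => ?_⟩,
          fun i => ?_⟩
        · have : (0 : Fin (T + 1 + 1)) = Fin.castSucc 0 := rfl
          rw [this, Fin.snoc_castSucc, h1]
        · induction i using Fin.lastCases with
          | last =>
            rw [Fin.succ_last, Fin.snoc_last, Fin.snoc_castSucc, h2]
            exact encard_ne_le_one_iff.2 hup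
          | cast i =>
            rw [Fin.succ_castSucc, Fin.snoc_castSucc, Fin.snoc_castSucc]
            exact h3 i
        · induction i using Fin.lastCases with
          | last => rw [Fin.snoc_last]; exact hgood
          | cast i => rw [Fin.snoc_castSucc]; exact h4 i
    · rintro ⟨T, seq, ⟨h1, h2, h3⟩, h4⟩
      have : ∀ i : Fin (T + 1), Reconfigurable (fun ψ => r ≤ G.val ψ) ini (seq i) := by
        intro i
        induction i using Fin.induction with
        | zero => rw [h1]; exact .refl (h1 ▸ h4 0)
        | succ i ih => exact ⟨ih.1, ih.2.tail ⟨h4 _, encard_ne_le_one_iff.1 (h3 i)⟩⟩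
      exact h2 ▸ this (Fin.last T)
  rw [hpath]
  set Q := {r | ∃ (T : ℕ) (seq : Fin (T + 1) → V → A), IsReconfSeq ini tar T seq ∧ r = G.seqVal seq}
    with hQ
  have hle : ∀ {T : ℕ} (seq : Fin (T + 1) → V → A), r ≤ G.seqVal seq ↔ ∀ i, r ≤ G.val (seq i) := by
    intro T seq; simp [seqVal]
  -- the value of a sequence is the value of one of its members
  have hfin : Q.Finite := by
    refine (Set.finite_range G.val).subset ?_
    rintro _ ⟨T, seq, -, rfl⟩
    obtain ⟨i, -, hi⟩ := Finset.exists_mem_eq_inf' Finset.univ_nonempty fun i => G.val (seq i)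
    exact ⟨seq i, hi.symm⟩
  constructor
  · intro h
    have hne : Q.Nonempty := by
      by_contra hne
      rw [Set.not_nonempty_iff_eq_empty] at hne
      rw [reconfVal, ← hQ, hne, Real.sSup_empty] at h
      linarith
    obtain ⟨T, seq, hseq, hv⟩ := hne.csSup_mem hfin
    refine ⟨T, seq, hseq, (hle seq).1 ?_⟩
    rw [← hv]
    exact h
  · rintro ⟨T, seq, hseq, hv⟩
    exact ((hle seq).2 hv).trans (le_csSup hfin.bddAbove ⟨T, seq, hseq, rfl⟩)

end ConstraintGraph

end

namespace RotGraph

variable {V A S : Type} {d : ℕ} [Fintype V] [Nonempty V] [NeZero d] [DecidableEq V]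
  {G : RotGraph V A d} {t : ℕ} {op : S → List (Fin d) → A × A}

/-- Decoding takes paths of the powered graph to paths of the graph, if there are many vertices. -/
theorem HasGap.reconfigurable_decode [Finite A] [Nonempty A] (hG : G.HasGap) {ε : ℝ} (hε : 0 < ε)
    (ht : 100 / ε ≤ t)
    (hn : 4 * (∑ i ∈ Finset.range t, d ^ i : ℕ) / ε ≤ Fintype.card V) {ψ φ : V → S}
    (h : Reconfigurable (fun χ => G.rejected t op χ ≤ 0.00588) ψ φ) :
    Reconfigurable (fun χ => G.violated χ ≤ ε) (G.decode t op ψ) (G.decode t op φ) := by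
  have hgood {χ : V → S} (hχ : G.rejected t op χ ≤ 0.00588) := hG.violated_decode_lt hχ hε ht
  obtain ⟨h0, h⟩ := h
  induction h with
  | refl => exact .refl ((hgood h0).le.trans (by linarith))
  | @tail χ _ hχ hstep ih =>
    refine ih.trans ?_
    obtain ⟨hχ', v, s, rfl⟩ := hstep
    have hχ0 : G.rejected t op χ ≤ 0.00588 := by
      cases hχ with
      | refl => exact h0
      | tail _ h => exact h.1
    -- the decoding changes only near `v`
    let B : Finset V := (Finset.range t).biUnion fun i => (words d i).image (G.follow v)
    have hB : B.card ≤ ∑ i ∈ Finset.range t, d ^ i := by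
      refine Finset.card_biUnion_le.trans (Finset.sum_le_sum fun i _ => ?_)
      exact Finset.card_image_le.trans (card_words i).le
    have hdec : ∀ x ∉ B, G.decode t op (Function.update χ v s) x = G.decode t op χ x := by
      intro x hx
      refine G.decode_congr fun c hc => Function.update_of_ne ?_ _ _
      rintro rfl
      refine hx (Finset.mem_biUnion.2 ⟨c.length, Finset.mem_range.2 hc,
        Finset.mem_image.2 ⟨G.rev x c, by simp, by simp⟩⟩)
    refine .of_mixtures fun χ' h' => ?_
    have h1 := G.violated_le (G.decode t op χ) χ' B fun x hx => by
      rcases h' x with h | h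
      · exact h
      · rw [h, hdec x hx]
    have hcard : (0 : ℝ) < Fintype.card V := by exact_mod_cast Fintype.card_pos
    have h2 : (B.card : ℝ) / Fintype.card V ≤ ε / 4 := by
      rw [div_le_iff₀ hε] at hn
      rw [div_le_iff₀ hcard]
      have : (B.card : ℝ) ≤ (∑ i ∈ Finset.range t, d ^ i : ℕ) := by exact_mod_cast hB
      linarith
    have := hgood hχ0
    linarith

omit [Fintype V] [Nonempty V] [DecidableEq V] in
/-- The plurality of an honest assignment. -/
theorem decode_honest [Finite A] [Nonempty A] (ht : 0 < t) {ψ : V → A} {χ : V → S}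
    (h : ∀ v c, c.length ≤ t → op (χ v) c = (ψ (G.follow v c), ψ (G.follow v c))) :
    G.decode t op χ = ψ := by
  classical
  funext x
  have hpop : ∀ a, G.popularity t op χ x a = if a = ψ x then (t : ℝ) else 0 := by
    intro a
    have : G.popularity t op χ x a = wordSum (d := d) t fun _ => if a = ψ x then (1 : ℝ) else 0 := by
      refine wordSum_congr fun c hc => ?_
      rw [opinion, h _ _ (by simpa using hc.le), follow_rev]
      simp [InPair]
    rw [this, wordSum_const]
    split <;> simp
  by_contra hne
  have := G.popularity_le_decode (t := t) (op := op) χ x (ψ x)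
  rw [hpop, hpop, if_pos rfl, if_neg hne] at this
  have ht' : (0 : ℝ) < t := by exact_mod_cast ht
  linarith

omit [Nonempty V] [NeZero d] [DecidableEq V] in
theorem violated_eq_zero_iff {ψ : V → A} :
    G.violated ψ ≤ 0 ↔ ∀ p, G.rel p (ψ p.1) (ψ (G.rot p).1) := by
  classical
  have hin : ∀ v i, (0 : ℝ) ≤ if G.rel (v, i) (ψ v) (ψ (G.rot (v, i)).1) then (0 : ℝ) else 1 :=
    fun v i => by split <;> norm_num
  have hout : ∀ v, (0 : ℝ) ≤ 𝔼 i, if G.rel (v, i) (ψ v) (ψ (G.rot (v, i)).1) then (0 : ℝ) else 1 :=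
    fun v => Finset.expect_nonneg fun i _ => hin v i
  constructor
  · intro h p
    have h1 := (Finset.expect_eq_zero_iff_of_nonneg fun v _ => hout v).1
      (le_antisymm h (Finset.expect_nonneg fun v _ => hout v)) p.1 (Finset.mem_univ _)
    have h2 := (Finset.expect_eq_zero_iff_of_nonneg fun i _ => hin p.1 i).1
      h1 p.2 (Finset.mem_univ _)
    by_contra hne
    rw [if_neg hne] at h2
    norm_num at h2
  · intro h
    refine le_of_eq (Finset.expect_eq_zero fun v _ => Finset.expect_eq_zero fun i _ => ?_)
    rw [if_pos (h (v, i))]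

/-- The symbol that holds the opinions of `v` about the global assignment `χ` of pairs. -/
def honest (G : RotGraph V A d) (enc : (List (Fin d) → A × A) → S) (χ : V → A × A) (v : V) : S :=
  enc fun c => χ (G.follow v c)

omit [Nonempty V] [NeZero d] [DecidableEq V] in
/-- No test rejects a mixture of two honest assignments whose opinions meet everywhere and are
compatible along every dart. -/
theorem rejected_mixture {enc : (List (Fin d) → A × A) → S}
    (henc : ∀ g c, c.length ≤ t → op (enc g) c = g c) {χ₀ χ₁ : V → A × A}
    (h1 : ∀ x, ∃ a, InPair a (χ₀ x) ∧ InPair a (χ₁ x))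
    (h2 : ∀ p a b, (InPair a (χ₀ p.1) ∨ InPair a (χ₁ p.1)) →
      (InPair b (χ₀ (G.rot p).1) ∨ InPair b (χ₁ (G.rot p).1)) → G.rel p a b)
    {χ : V → S} (hχ : ∀ v, χ v = G.honest enc χ₀ v ∨ χ v = G.honest enc χ₁ v) :
    G.rejected t op χ ≤ 0 := by
  classical
  let o : V → V → A × A := fun u x => if χ u = G.honest enc χ₀ u then χ₀ x else χ₁ x
  have ho : ∀ u x, o u x = χ₀ x ∨ o u x = χ₁ x := by
    intro u x; dsimp only [o]; split <;> simp
  refine le_of_eq (Finset.expect_eq_zero fun l _ => Finset.expect_eq_zero fun v _ =>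
    Finset.expect_eq_zero fun c _ => if_pos ?_)
  refine G.accepts_of_opinions (o := o) (fun u c hc => ?_) (fun u u' x => ?_)
    fun u u' p a b ha hb => h2 p a b ?_ ?_
  · dsimp only [o]
    split
    · next h => rw [h, honest, henc _ _ hc]
    · next h => rw [(hχ u).resolve_left h, honest, henc _ _ hc]
  · obtain ⟨a, ha, ha'⟩ := h1 x
    rcases ho u x with h | h <;> rcases ho u' x with h' | h' <;> rw [h, h']
    · exact ⟨a, ha, ha⟩
    · exact ⟨a, ha, ha'⟩
    · exact ⟨a, ha', ha⟩
    · exact ⟨a, ha', ha'⟩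
  · rcases ho u p.1 with h | h <;> rw [h] at ha
    · exact .inl ha
    · exact .inr ha
  · rcases ho u' (G.rot p).1 with h | h <;> rw [h] at hb
    · exact .inl hb
    · exact .inr hb

omit [Nonempty V] [NeZero d] in
/-- Honest assignments follow a path of satisfying assignments: to change the value of `x` from `a`
to `b`, the opinions about `x` are changed one by one from `{a}` to `{a, b}`, and then from `{a, b}`
to `{b}`.  At a self-loop both `a` and `b` may be held, so its constraint has to accept all pairs of
distinct values. -/
theorem reconfigurable_honest {enc : (List (Fin d) → A × A) → S}
    (henc : ∀ g c, c.length ≤ t → op (enc g) c = g c)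
    (hloop : ∀ p a b, (G.rot p).1 = p.1 → a ≠ b → G.rel p a b) {ψ φ : V → A}
    (h : Reconfigurable (fun χ => G.violated χ ≤ 0) ψ φ) :
    Reconfigurable (fun χ => G.rejected t op χ ≤ 0) (G.honest enc fun v => (ψ v, ψ v))
      (G.honest enc fun v => (φ v, φ v)) := by
  obtain ⟨h0, h⟩ := h
  have hone {ψ : V → A} {a : A} {x : V} : InPair a (ψ x, ψ x) ↔ a = ψ x := by simp [InPair]
  induction h with
  | refl =>
    rw [violated_eq_zero_iff] at h0
    refine .refl (rejected_mixture henc (χ₀ := fun v => (ψ v, ψ v)) (χ₁ := fun v => (ψ v, ψ v))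
      (fun x => ⟨ψ x, hone.2 rfl, hone.2 rfl⟩) (fun p a b ha hb => ?_) fun v => .inl rfl)
    simp only [hone, or_self] at ha hb
    rw [ha, hb]
    exact h0 p
  | @tail χ χ' hχ hstep ih =>
    refine ih.trans ?_
    have hgood : G.violated χ ≤ 0 := by
      cases hχ with
      | refl => exact h0
      | tail _ h => exact h.1
    obtain ⟨hgood', z, s, hup⟩ := hstep
    rw [violated_eq_zero_iff] at hgood hgood'
    have hrel : ∀ p a b, (a = χ p.1 ∨ a = χ' p.1) → (b = χ (G.rot p).1 ∨ b = χ' (G.rot p).1) →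
        G.rel p a b := by
      intro p a b ha hb
      by_cases hl : (G.rot p).1 = p.1
      · by_cases hab : a = b
        · subst hab
          rcases ha with rfl | rfl
          · have := hgood p; rwa [hl] at this
          · have := hgood' p; rwa [hl] at this
        · exact hloop p a b hl hab
      · by_cases hz : p.1 = z
        · have hy : χ' (G.rot p).1 = χ (G.rot p).1 := by
            rw [hup, Function.update_of_ne (fun h => hl (h.trans hz.symm))]
          rw [hy, or_self] at hb
          subst hb
          rcases ha with rfl | rfl
          · exact hgood p
          · rw [← hy]; exact hgood' p
        · have hx : χ' p.1 = χ p.1 := by rw [hup, Function.update_of_ne hz]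
          rw [hx, or_self] at ha
          subst ha
          rcases hb with rfl | rfl
          · exact hgood p
          · rw [← hx]; exact hgood' p
    have htwo {a : A} {x : V} : InPair a (χ x, χ' x) ↔ a = χ x ∨ a = χ' x := Iff.rfl
    refine .trans (φ := G.honest enc fun v => (χ v, χ' v)) (.of_mixtures fun ω hω => ?_)
      (.of_mixtures fun ω hω => ?_)
    · refine rejected_mixture henc (fun x => ⟨χ x, hone.2 rfl, .inl rfl⟩)
        (fun p a b ha hb => hrel p a b ?_ ?_) hω
      · rw [hone, htwo] at ha; tauto
      · rw [hone, htwo] at hb; tauto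
    · refine rejected_mixture henc (fun x => ⟨χ' x, .inr rfl, hone.2 rfl⟩)
        (fun p a b ha hb => hrel p a b ?_ ?_) hω
      · rw [hone, htwo] at ha; tauto
      · rw [hone, htwo] at hb; tauto

end RotGraph

/-! ### The darts of a constraint graph -/

section darts

variable {V A : Type} [DecidableEq V] {d : ℕ}

/-- The number of ends of edges at `v`. -/
def endCount (es : List (ConstraintEdge V A)) (v : V) : ℕ :=
  es.countP (fun e => e.fst = v) + es.countP fun e => e.snd = v

theorem endCount_cons (e : ConstraintEdge V A) (es : List (ConstraintEdge V A)) (v : V) :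
    endCount (e :: es) v = endCount es v + ((if e.fst = v then 1 else 0) +
      if e.snd = v then 1 else 0) := by
  simp only [endCount, List.countP_cons, decide_eq_true_eq]
  omega

theorem degree_eq_endCount (es : List (ConstraintEdge V A)) (v : V) :
    (ConstraintGraph.mk es).degree v = endCount es v := by
  induction es with
  | nil => rfl
  | cons e es ih =>
    rw [endCount_cons, ← ih]
    simp [ConstraintGraph.degree, add_comm]

theorem sum_endCount [Fintype V] (es : List (ConstraintEdge V A)) :
    ∑ v, endCount es v = 2 * es.length := by
  induction es with
  | nil => simp [endCount]
  | cons e es ih =>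
    simp only [endCount_cons, Finset.sum_add_distrib, ih, List.length_cons]
    simp
    omega

variable [DecidableEq A]

/-- The constraint of an edge in its own direction.  The constraint of a self-loop is weakened to
accept all pairs of distinct values, which does not change the value of any assignment. -/
def forwardRel (e : ConstraintEdge V A) (a b : A) : Bool :=
  e.rel a b || (decide (e.fst = e.snd) && !decide (a = b))

/-- The constraint of an edge in the opposite direction. -/
def backwardRel (e : ConstraintEdge V A) (a b : A) : Bool := forwardRel e b a

/-- The darts of a list of edges: a source, a target, and a step.  The label of a dart is the number
of the darts after it that have the same source. -/
def darts (d : ℕ) [NeZero d] : List (ConstraintEdge V A) → List (V × V × Step A d)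
  | [] => []
  | e :: es =>
    let i := Fin.ofNat d (endCount es e.fst + if e.fst = e.snd then 1 else 0)
    let j := Fin.ofNat d (endCount es e.snd)
    (e.fst, e.snd, i, j, forwardRel e) :: (e.snd, e.fst, j, i, backwardRel e) :: darts d es

variable [NeZero d]

theorem length_darts (es : List (ConstraintEdge V A)) :
    (darts d es).length = 2 * es.length := by
  induction es with
  | nil => rfl
  | cons e es ih => simp only [darts, List.length_cons, ih]; omega

/-- The source and the label of a dart. -/
abbrev Dart.key (D : V × V × Step A d) : V × Fin d := (D.1, D.2.2.1)

/-- The opposite dart. -/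
def Dart.reverse (D : V × V × Step A d) : V × V × Step A d :=
  (D.2.1, D.1, D.2.2.2.1, D.2.2.1, fun a b => D.2.2.2.2 b a)

theorem reverse_mem_darts {es : List (ConstraintEdge V A)} {D : V × V × Step A d}
    (h : D ∈ darts d es) : Dart.reverse D ∈ darts d es := by
  induction es with
  | nil => simp [darts] at h
  | cons e es ih =>
    simp only [darts, List.mem_cons] at h ⊢
    rcases h with rfl | rfl | h
    · exact .inr (.inl rfl)
    · exact .inl rfl
    · exact .inr (.inr (ih h))

theorem label_lt_endCount {es : List (ConstraintEdge V A)} (hes : ∀ v, endCount es v ≤ d)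
    {D : V × V × Step A d} (h : D ∈ darts d es) : D.2.2.1.val < endCount es D.1 := by
  induction es with
  | nil => simp [darts] at h
  | cons e es ih =>
    have hes' : ∀ v, endCount es v ≤ d := fun v => by
      have := hes v
      rw [endCount_cons] at this
      omega
    have h1 := hes e.fst
    have h2 := hes e.snd
    rw [endCount_cons] at h1 h2 ⊢
    simp only [darts, List.mem_cons] at h
    rcases h with rfl | rfl | h
    · simp only [Fin.val_ofNat, if_true] at h1 ⊢
      by_cases hl : e.fst = e.snd
      · simp only [hl, if_true] at h1 ⊢
        rw [Nat.mod_eq_of_lt (by omega)]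
        omega
      · simp only [hl, Ne.symm hl, if_false] at h1 ⊢
        rw [Nat.mod_eq_of_lt (by omega)]
        omega
    · simp only [Fin.val_ofNat, if_true] at h2 ⊢
      rw [Nat.mod_eq_of_lt (by omega)]
      omega
    · have := ih hes' h
      omega

/-- At every vertex the darts have different labels. -/
theorem nodup_darts {es : List (ConstraintEdge V A)} (hes : ∀ v, endCount es v ≤ d) :
    ((darts d es).map Dart.key).Nodup := by
  induction es with
  | nil => simp [darts]
  | cons e es ih =>
    have hes' : ∀ v, endCount es v ≤ d := fun v => by
      have := hes v
      rw [endCount_cons] at this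
      omega
    have h1 := hes e.fst
    have h2 := hes e.snd
    rw [endCount_cons] at h1 h2
    have hnot : ∀ (v : V) (i : Fin d), endCount es v ≤ i → (v, i) ∉ (darts d es).map Dart.key := by
      intro v i hi hmem
      obtain ⟨D, hD, heq⟩ := List.mem_map.1 hmem
      have := label_lt_endCount hes' hD
      obtain ⟨rfl, rfl⟩ := Prod.mk.inj heq
      omega
    simp only [darts, List.map_cons, List.nodup_cons, List.mem_cons, not_or]
    simp only [if_true] at h1 h2
    refine ⟨⟨?_, hnot _ _ ?_⟩, hnot _ _ ?_, ih hes'⟩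
    · intro heq
      obtain ⟨hv, hi⟩ := Prod.mk.inj heq
      have hv : e.fst = e.snd := hv
      have : (Fin.ofNat d (endCount es e.fst + if e.fst = e.snd then 1 else 0)).val =
        (Fin.ofNat d (endCount es e.snd)).val := congrArg Fin.val hi
      simp only [hv, if_true, Fin.val_ofNat] at this h1
      rw [Nat.mod_eq_of_lt (by omega), Nat.mod_eq_of_lt (by omega)] at this
      omega
    · simp only [Fin.val_ofNat]
      by_cases hl : e.fst = e.snd
      · simp only [hl, if_true] at h1 ⊢
        rw [Nat.mod_eq_of_lt (by omega)]
        omega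
      · simp only [hl, if_false]
        rw [Nat.mod_eq_of_lt (by omega)]
        omega
    · simp only [Fin.val_ofNat]
      rw [Nat.mod_eq_of_lt (by omega)]

variable [Fintype V]

theorem exists_dart {es : List (ConstraintEdge V A)} (hes : ∀ v, endCount es v = d)
    (p : V × Fin d) : ∃ D ∈ darts d es, Dart.key D = p := by
  have hnd := nodup_darts (d := d) fun v => (hes v).le
  have hcard : ((darts d es).map Dart.key).toFinset.card = Fintype.card (V × Fin d) := by
    rw [List.toFinset_card_of_nodup hnd, List.length_map, length_darts, ← sum_endCount]
    simp [hes]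
  have := Finset.mem_univ p
  rw [← (Finset.card_eq_iff_eq_univ _).1 hcard, List.mem_toFinset] at this
  exact List.mem_map.1 this

variable {es : List (ConstraintEdge V A)}

/-- The dart with a given source and label, in a regular graph. -/
noncomputable def dartAt (hes : ∀ v, endCount es v = d) (p : V × Fin d) : V × V × Step A d :=
  (exists_dart hes p).choose

theorem dartAt_mem (hes : ∀ v, endCount es v = d) (p : V × Fin d) :
    dartAt hes p ∈ darts d es := (exists_dart hes p).choose_spec.1

theorem key_dartAt (hes : ∀ v, endCount es v = d) (p : V × Fin d) :
    Dart.key (dartAt hes p) = p := (exists_dart hes p).choose_spec.2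

theorem dartAt_key (hes : ∀ v, endCount es v = d) {D : V × V × Step A d} (hD : D ∈ darts d es) :
    dartAt hes (Dart.key D) = D :=
  List.inj_on_of_nodup_map (nodup_darts fun v => (hes v).le) (dartAt_mem hes _) hD
    (key_dartAt hes _)

theorem dartAt_rot (hes : ∀ v, endCount es v = d) (p : V × Fin d) :
    dartAt hes ((dartAt hes p).2.1, (dartAt hes p).2.2.2.1) = Dart.reverse (dartAt hes p) :=
  dartAt_key hes (reverse_mem_darts (dartAt_mem hes p))

/-- The rotation map of a regular constraint graph. -/
noncomputable def rotGraph (hes : ∀ v, endCount es v = d) : RotGraph V A d where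
  rot p := ((dartAt hes p).2.1, (dartAt hes p).2.2.2.1)
  rot_rot p := by
    have := key_dartAt hes p
    rw [dartAt_rot]
    exact this
  rel p := (dartAt hes p).2.2.2.2
  rel_rot p a b := by rw [dartAt_rot]; rfl

theorem dartAt_eq (hes : ∀ v, endCount es v = d) (p : V × Fin d) :
    dartAt hes p = (p.1, ((rotGraph hes).rot p).1, p.2, ((rotGraph hes).rot p).2,
      (rotGraph hes).rel p) := by
  have h1 : (dartAt hes p).1 = p.1 := congrArg Prod.fst (key_dartAt hes p)
  have h2 : (dartAt hes p).2.2.1 = p.2 := congrArg Prod.snd (key_dartAt hes p)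
  exact Prod.ext h1 (Prod.ext rfl (Prod.ext h2 rfl))

/-- The weakened constraints of self-loops are the ones that `reconfigurable_honest` needs. -/
theorem rotGraph_loop (hes : ∀ v, endCount es v = d) (p : V × Fin d) (a b : A)
    (hp : ((rotGraph hes).rot p).1 = p.1) (hab : a ≠ b) : (rotGraph hes).rel p a b := by
  have h : ∀ {es : List (ConstraintEdge V A)} {D : V × V × Step A d}, D ∈ darts d es →
      D.2.1 = D.1 → D.2.2.2.2 a b = true := by
    intro es D hD heq
    induction es with
    | nil => simp [darts] at hD
    | cons e es ih =>
      simp only [darts, List.mem_cons] at hD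
      rcases hD with rfl | rfl | hD
      · simp only at heq; simp [forwardRel, heq, hab]
      · simp only at heq; simp [backwardRel, forwardRel, heq, hab.symm]
      · exact ih hD
  refine h (dartAt_mem hes p) ?_
  have := congrArg Prod.fst (key_dartAt hes p)
  exact hp.trans this.symm

theorem darts_perm (hes : ∀ v, endCount es v = d) :
    (darts d es).Perm ((Finset.univ : Finset (V × Fin d)).toList.map (dartAt hes)) := by
  refine (List.perm_ext_iff_of_nodup (List.Nodup.of_map _ (nodup_darts fun v => (hes v).le)) ?_).2 ?_
  · refine (Finset.nodup_toList _).map fun p q h => ?_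
    rw [← key_dartAt hes p, h, key_dartAt]
  · intro D
    simp only [List.mem_map, Finset.mem_toList, Finset.mem_univ, true_and]
    exact ⟨fun h => ⟨_, dartAt_key hes h⟩, fun ⟨p, hp⟩ => hp ▸ dartAt_mem hes p⟩

theorem sum_darts {M : Type} [AddCommMonoid M] (hes : ∀ v, endCount es v = d)
    (g : V × V × Step A d → M) :
    ((darts d es).map g).sum = ∑ v, ∑ i, g (dartAt hes (v, i)) := by
  rw [((darts_perm hes).map g).sum_eq, List.map_map, ← Fintype.sum_prod_type']
  exact Finset.sum_map_toList _ _

/-- The darts out of `v`. -/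
def dartsFrom (d : ℕ) [NeZero d] (es : List (ConstraintEdge V A)) (v : V) :
    List (V × V × Step A d) :=
  (darts d es).filter fun D => D.1 = v

theorem sum_dartsFrom {M : Type} [AddCommMonoid M] (hes : ∀ v, endCount es v = d) (v : V)
    (g : V × V × Step A d → M) :
    ((dartsFrom d es v).map g).sum = ∑ i, g (dartAt hes (v, i)) := by
  have : ∀ l : List (V × V × Step A d), ((l.filter fun D => D.1 = v).map g).sum =
      (l.map fun D => if D.1 = v then g D else 0).sum := by
    intro l
    induction l with
    | nil => rfl
    | cons D l ih => by_cases h : D.1 = v <;> simp [h, ih]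
  have hsrc : ∀ p, (dartAt hes p).1 = p.1 := fun p => congrArg Prod.fst (key_dartAt hes p)
  rw [dartsFrom, this, sum_darts hes]
  simp only [hsrc]
  rw [Finset.sum_eq_single v] <;> simp +contextual

/-- The walks of length `k` from `v`: the end and the list of the steps. -/
def walks (d : ℕ) [NeZero d] (es : List (ConstraintEdge V A)) : ℕ → V → List (V × List (Step A d))
  | 0, v => [(v, [])]
  | k + 1, v => (dartsFrom d es v).flatMap fun D =>
      (walks d es k D.2.1).map fun x => (x.1, D.2.2 :: x.2)

theorem List.sum_map_flatMap {α β M : Type} [AddCommMonoid M] (l : List α) (f : α → List β)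
    (g : β → M) : ((l.flatMap f).map g).sum = (l.map fun a => ((f a).map g).sum).sum := by
  induction l with
  | nil => rfl
  | cons a l ih => simp [ih]

theorem sum_walks {M : Type} [AddCommMonoid M] (hes : ∀ v, endCount es v = d) (k : ℕ) (v : V)
    (g : V × List (Step A d) → M) :
    ((walks d es k v).map g).sum =
      ∑ c ∈ words d k, g ((rotGraph hes).follow v c, (rotGraph hes).steps v c) := by
  induction k generalizing v g with
  | zero => simp [walks, words_zero]
  | succ k ih =>
    rw [walks, List.sum_map_flatMap, sum_dartsFrom hes, sum_words_succ]
    refine Finset.sum_congr rfl fun i _ => ?_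
    rw [List.map_map, ih]
    simp only [dartAt_eq]
    rfl

theorem mem_walks (hes : ∀ v, endCount es v = d) {k : ℕ} {v : V} {x : V × List (Step A d)} :
    x ∈ walks d es k v ↔ ∃ c : List (Fin d), c.length = k ∧
      x = ((rotGraph hes).follow v c, (rotGraph hes).steps v c) := by
  -- membership is the positivity of a sum
  classical
  have h := sum_walks (M := ℕ) hes k v fun y => if y = x then 1 else 0
  have h1 : x ∈ walks d es k v ↔
      ((walks d es k v).map fun y => if y = x then 1 else 0).sum ≠ 0 := by
    rw [Ne, List.sum_eq_zero_iff]
    simp only [List.mem_map]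
    exact ⟨fun h h' => by simpa using h' _ ⟨x, h, rfl⟩, fun h => by
      by_contra hx
      refine h fun y ⟨z, hz, hy⟩ => ?_
      rw [← hy, if_neg (by rintro rfl; exact hx hz)]⟩
  rw [h1, h, Ne, Finset.sum_eq_zero_iff]
  simp [eq_comm]

end darts

/-! ### Value and spectrum in terms of the rotation map -/

theorem List.cast_countP {α : Type} (l : List α) (p : α → Bool) :
    (l.countP p : ℝ) = (l.map fun x => if p x then (1 : ℝ) else 0).sum := by
  induction l with
  | nil => simp
  | cons x l ih => by_cases h : p x <;> simp [h, ih, add_comm]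

section

variable {V A : Type} [DecidableEq V] [DecidableEq A] [Fintype V] {d : ℕ} [NeZero d]
  {es : List (ConstraintEdge V A)} (hes : ∀ v, endCount es v = d)

omit [DecidableEq A] [NeZero d] in
include hes in
theorem two_mul_length : 2 * es.length = Fintype.card V * d := by
  rw [← sum_endCount]; simp [hes]

theorem val_eq_one_sub_violated [Nonempty V] (ψ : V → A) :
    (ConstraintGraph.mk es).val ψ = 1 - (rotGraph hes).violated ψ := by
  have h1 : ∀ es : List (ConstraintEdge V A),
      ((darts d es).map fun D => if D.2.2.2.2 (ψ D.1) (ψ D.2.1) then (1 : ℝ) else 0).sum =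
      2 * es.countP fun e => e.rel (ψ e.fst) (ψ e.snd) := by
    intro es
    induction es with
    | nil => simp [darts]
    | cons e es ih =>
      have hf : forwardRel e (ψ e.fst) (ψ e.snd) = e.rel (ψ e.fst) (ψ e.snd) := by
        by_cases h : e.fst = e.snd <;> simp [forwardRel, h]
      simp only [darts, List.map_cons, List.sum_cons, ih, backwardRel, hf]
      by_cases h : e.rel (ψ e.fst) (ψ e.snd)
      · simp [h]; ring
      · simp [h]
  have h2 := sum_darts hes fun D => if D.2.2.2.2 (ψ D.1) (ψ D.2.1) then (1 : ℝ) else 0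
  rw [h1] at h2
  simp only [dartAt_eq] at h2
  have h3 : (2 : ℝ) * es.length = Fintype.card V * d := by exact_mod_cast two_mul_length hes
  have h4 : 1 - (rotGraph hes).violated ψ = 𝔼 v, 𝔼 i : Fin d,
      if (rotGraph hes).rel (v, i) (ψ v) (ψ ((rotGraph hes).rot (v, i)).1) then (1 : ℝ) else 0 := by
    have h5 : ∀ v i, (if (rotGraph hes).rel (v, i) (ψ v) (ψ ((rotGraph hes).rot (v, i)).1)
        then (1 : ℝ) else 0) = 1 - if (rotGraph hes).rel (v, i) (ψ v)
          (ψ ((rotGraph hes).rot (v, i)).1) then (0 : ℝ) else 1 := by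
      intro v i; split <;> norm_num
    simp only [h5, Finset.expect_sub_distrib, Fintype.expect_const]
    rfl
  rw [h4, ConstraintGraph.val]
  simp only [Fintype.expect_eq_sum_div_card, ← Finset.sum_div, ← h2, Fintype.card_fin]
  have hd : (d : ℝ) ≠ 0 := Nat.cast_ne_zero.2 (NeZero.ne d)
  have hV : (Fintype.card V : ℝ) ≠ 0 := Nat.cast_ne_zero.2 Fintype.card_ne_zero
  have hl : (es.length : ℝ) ≠ 0 := by
    intro h; rw [h, mul_zero] at h3; exact mul_ne_zero hV hd h3.symm
  field_simp
  linear_combination (-(es.countP fun e => e.rel (ψ e.fst) (ψ e.snd) : ℝ)) * h3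

theorem adjMatrix_mulVec (x : V → ℝ) (v : V) :
    (ConstraintGraph.mk es).adjMatrix.mulVec x v = d * (rotGraph hes).avg x v := by
  have h1 : ∀ (es : List (ConstraintEdge V A)) (u w : V),
      (ConstraintGraph.mk es).adjMatrix u w =
      ((darts d es).map fun D => if D.1 = u ∧ D.2.1 = w then (1 : ℝ) else 0).sum := by
    intro es u w
    induction es with
    | nil => rfl
    | cons e es ih =>
      simp only [darts, List.map_cons, List.sum_cons, ← ih]
      simp only [ConstraintGraph.adjMatrix, List.map_cons, List.sum_cons, and_comm]
      ring
  have h2 : ∀ w, (ConstraintGraph.mk es).adjMatrix v w =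
      ∑ i : Fin d, if ((rotGraph hes).rot (v, i)).1 = w then (1 : ℝ) else 0 := by
    intro w
    rw [h1, sum_darts hes, Finset.sum_eq_single v]
    · simp [dartAt_eq]
    · intro u _ hu; simp [dartAt_eq, hu]
    · simp
  have hd : (d : ℝ) ≠ 0 := Nat.cast_ne_zero.2 (NeZero.ne d)
  rw [Matrix.mulVec, dotProduct]
  simp only [h2, Finset.sum_mul, RotGraph.avg, Fintype.expect_eq_sum_div_card, Fintype.card_fin]
  rw [Finset.sum_comm]
  field_simp
  simp

omit [DecidableEq A] in
theorem sqrt_div_le_secondEigenvalue (G : ConstraintGraph V A) {x : V → ℝ} (hx : x ≠ 0)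
    (h0 : ∑ v, x v = 0) :
    √(∑ v, (G.adjMatrix.mulVec x v) ^ 2) / √(∑ v, x v ^ 2) ≤ G.secondEigenvalue := by
  refine le_csSup ⟨√(∑ v, ∑ w, G.adjMatrix v w ^ 2), ?_⟩ ⟨x, hx, h0, rfl⟩
  rintro _ ⟨y, -, -, rfl⟩
  refine div_le_of_le_mul₀ (Real.sqrt_nonneg _) (Real.sqrt_nonneg _) ?_
  have hA : 0 ≤ ∑ v, ∑ w, G.adjMatrix v w ^ 2 :=
    Finset.sum_nonneg fun _ _ => Finset.sum_nonneg fun _ _ => sq_nonneg _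
  refine (Real.sqrt_le_sqrt ?_).trans (Real.sqrt_mul hA _).le
  rw [Finset.sum_mul]
  exact Finset.sum_le_sum fun v _ => Finset.sum_mul_sq_le_sq_mul_sq _ _ _

theorem avg_contracts {lam : ℝ} (hlam : (ConstraintGraph.mk es).secondEigenvalue ≤ lam)
    {x : V → ℝ} (h0 : 𝔼 v, x v = 0) :
    𝔼 v, (rotGraph hes).avg x v ^ 2 ≤ (lam / d) ^ 2 * 𝔼 v, x v ^ 2 := by
  rcases isEmpty_or_nonempty V with hV | hV
  · simp
  have hd : (0 : ℝ) < d := Nat.cast_pos.2 (NeZero.pos d)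
  have hcard : (0 : ℝ) < Fintype.card V := by exact_mod_cast Fintype.card_pos
  by_cases hx : x = 0
  · subst hx; simp [RotGraph.avg]
  have h0' : ∑ v, x v = 0 := by
    rw [Fintype.expect_eq_sum_div_card] at h0
    field_simp at h0
    simpa using h0
  have h := (sqrt_div_le_secondEigenvalue _ hx h0').trans hlam
  have hpos : 0 < ∑ v, x v ^ 2 := by
    obtain ⟨v, hv⟩ := Function.ne_iff.1 hx
    exact Finset.sum_pos' (fun _ _ => sq_nonneg _) ⟨v, Finset.mem_univ _, by
      have : x v ≠ 0 := hv
      positivity⟩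
  rw [div_le_iff₀ (Real.sqrt_pos.2 hpos)] at h
  simp only [adjMatrix_mulVec hes] at h
  have h2 := pow_le_pow_left₀ (Real.sqrt_nonneg _) h 2
  rw [mul_pow, Real.sq_sqrt hpos.le, Real.sq_sqrt (Finset.sum_nonneg fun _ _ => sq_nonneg _)] at h2
  simp only [mul_pow, ← Finset.mul_sum] at h2
  rw [Fintype.expect_eq_sum_div_card, Fintype.expect_eq_sum_div_card, div_pow]
  rw [← mul_div_assoc]
  gcongr
  rw [div_mul_eq_mul_div, le_div_iff₀ (by positivity)]
  linarith

theorem hasGap_of_secondEigenvalue {lam : ℝ}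
    (hlam : (ConstraintGraph.mk es).secondEigenvalue ≤ lam) (h0 : 0 ≤ lam) (h : lam ≤ d / 2) :
    (rotGraph hes).HasGap := by
  intro x hx
  refine (avg_contracts hes hlam hx).trans ?_
  have hd : (0 : ℝ) < d := Nat.cast_pos.2 (NeZero.pos d)
  have h1 : lam / d ≤ 1 / 2 := by rw [div_le_iff₀ hd]; linarith
  have h2 : (lam / d) ^ 2 ≤ 1 / 4 := by
    have := pow_le_pow_left₀ (by positivity) h1 2
    norm_num at this ⊢
    exact this
  exact mul_le_mul_of_nonneg_right h2 (Finset.expect_nonneg fun _ _ => sq_nonneg _)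

end

/-! ### The powered graph -/

section power

variable {n : ℕ} {A S : Type} [DecidableEq A] {d : ℕ} [NeZero d]

open Classical in
/-- The edges of the powered graph: all walks of lengths `1, …, 2 t - 1`.  The walks of each length
are repeated so that all lengths have the same total number of edges. -/
noncomputable def powerEdges (t : ℕ) (op : S → List (Fin d) → A × A)
    (es : List (ConstraintEdge (Fin n) A)) : List (ConstraintEdge (Fin n) S) :=
  (List.finRange n).flatMap fun v => (List.range (2 * t - 1)).flatMap fun l =>
    (List.replicate (d ^ (2 * t - 2 - l)) ()).flatMap fun _ => (walks d es (l + 1) v).map fun x =>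
      ⟨v, x.1, fun s s' => decide (Accepts t op x.2 s s')⟩

variable {t : ℕ} {op : S → List (Fin d) → A × A} {es : List (ConstraintEdge (Fin n) A)}
  (hes : ∀ v, endCount es v = d)

open Classical in
theorem sum_powerEdges {M : Type} [AddCommMonoid M] (g : ConstraintEdge (Fin n) S → M) :
    ((powerEdges t op es).map g).sum = ∑ v, ∑ l ∈ Finset.range (2 * t - 1),
      d ^ (2 * t - 2 - l) • ∑ c ∈ words d (l + 1), g ⟨v, (rotGraph hes).follow v c, fun s s' =>
        decide (Accepts t op ((rotGraph hes).steps v c) s s')⟩ := by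
  rw [powerEdges, List.sum_map_flatMap, ← List.ofFn_eq_map, List.sum_ofFn]
  refine Finset.sum_congr rfl fun v _ => ?_
  rw [List.sum_map_flatMap, ← List.sum_toFinset _ List.nodup_range, List.toFinset_range]
  refine Finset.sum_congr rfl fun l _ => ?_
  rw [List.sum_map_flatMap, List.map_replicate, List.sum_replicate, List.map_map, sum_walks hes]
  rfl

omit [NeZero d] in
/-- The repetitions make every length equally likely. -/
theorem pow_mul_pow_length {l : ℕ} (hl : l ∈ Finset.range (2 * t - 1)) :
    d ^ (2 * t - 2 - l) * d ^ (l + 1) = d ^ (2 * t - 1) := by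
  rw [← pow_add]
  congr 1
  have := Finset.mem_range.1 hl
  omega

include hes in
theorem length_powerEdges : (powerEdges t op es).length = n * ((2 * t - 1) * d ^ (2 * t - 1)) := by
  have h := sum_powerEdges (t := t) (op := op) hes fun _ => 1
  simp only [List.map_const', List.sum_replicate, smul_eq_mul, mul_one, Finset.sum_const,
    card_words] at h
  rw [h, Finset.sum_congr rfl fun l hl => pow_mul_pow_length hl]
  simp

theorem val_powerEdges [NeZero n] (ht : 0 < t) (ψ : Fin n → S) :
    (ConstraintGraph.mk (powerEdges t op es)).val ψ = 1 - (rotGraph hes).rejected t op ψ := by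
  classical
  have hd : (d : ℝ) ≠ 0 := Nat.cast_ne_zero.2 (NeZero.ne d)
  have hn : (n : ℝ) ≠ 0 := Nat.cast_ne_zero.2 (NeZero.ne n)
  have hL : ((2 * t - 1 : ℕ) : ℝ) ≠ 0 := Nat.cast_ne_zero.2 (by omega)
  let a : Fin n → List (Fin d) → ℝ := fun v c => if Accepts t op ((rotGraph hes).steps v c) (ψ v)
    (ψ ((rotGraph hes).follow v c)) then 1 else 0
  have h1 : 1 - (rotGraph hes).rejected t op ψ =
      𝔼 l ∈ Finset.range (2 * t - 1), 𝔼 v, 𝔼 c ∈ words d (l + 1), a v c := by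
    have h2 : ∀ v c, a v c = 1 - if Accepts t op ((rotGraph hes).steps v c) (ψ v)
        (ψ ((rotGraph hes).follow v c)) then (0 : ℝ) else 1 := by
      intro v c; dsimp only [a]; split <;> norm_num
    simp only [h2, Finset.expect_sub_distrib, Finset.expect_const (words_nonempty _),
      Fintype.expect_const]
    rw [Finset.expect_const (Finset.nonempty_range_iff.2 (by omega))]
    simp only [RotGraph.rejected]
  rw [h1, ConstraintGraph.val, length_powerEdges hes, List.cast_countP, sum_powerEdges hes]
  simp only [decide_eq_true_eq]
  have h3 : ∀ l ∈ Finset.range (2 * t - 1), 𝔼 v, 𝔼 c ∈ words d (l + 1), a v c =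
      (∑ v, d ^ (2 * t - 2 - l) • ∑ c ∈ words d (l + 1), a v c) / (n * d ^ (2 * t - 1)) := by
    intro l hl
    simp only [Finset.expect_eq_sum_div_card, card_words, Finset.card_univ, Fintype.card_fin,
      ← Finset.sum_div, ← Finset.smul_sum]
    have h5 : (d : ℝ) ^ (2 * t - 1) = d ^ (2 * t - 2 - l) * d ^ (l + 1) := by
      exact_mod_cast (pow_mul_pow_length hl).symm
    rw [h5, nsmul_eq_mul]
    push_cast
    field_simp
  rw [Finset.expect_congr rfl h3, Finset.expect_eq_sum_div_card, ← Finset.sum_div,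
    Finset.sum_comm, Finset.card_range]
  push_cast
  rw [div_div]
  congr 1
  ring

include hes in
theorem degree_powerEdges (v : Fin n) :
    (ConstraintGraph.mk (powerEdges t op es)).degree v = 2 * ((2 * t - 1) * d ^ (2 * t - 1)) := by
  have h1 : ∀ k, ∑ u, ∑ c ∈ words d k, (if (rotGraph hes).follow u c = v then 1 else 0) =
      ∑ u : Fin n, ∑ c ∈ words d k, if u = v then 1 else 0 := by
    intro k
    rw [(rotGraph hes).sum_reverse]
    simp
  rw [ConstraintGraph.degree, sum_powerEdges hes, Finset.sum_comm]
  simp only [smul_eq_mul, ← Finset.mul_sum, Finset.sum_add_distrib, h1]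
  have h2 : ∀ k, ∑ u : Fin n, ∑ c ∈ words d k, (if u = v then 1 else 0) = d ^ k := by
    intro k
    rw [Finset.sum_eq_single v] <;> simp +contextual [card_words]
  simp only [h2, mul_add]
  rw [Finset.sum_congr rfl fun l hl => by rw [pow_mul_pow_length hl]]
  simp
  ring

theorem adjMatrix_powerEdges_mulVec (x : Fin n → ℝ) (v : Fin n) :
    (ConstraintGraph.mk (powerEdges t op es)).adjMatrix.mulVec x v =
      2 * d ^ (2 * t - 1) * ∑ l ∈ Finset.range (2 * t - 1), (rotGraph hes).avg^[l + 1] x v := by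
  have hd : (d : ℝ) ≠ 0 := Nat.cast_ne_zero.2 (NeZero.ne d)
  have h1 : ∀ k w, ∑ u, ∑ c ∈ words d k,
      (if (rotGraph hes).follow u c = v ∧ u = w then (1 : ℝ) else 0) =
      ∑ c ∈ words d k, if (rotGraph hes).follow v c = w then 1 else 0 := by
    intro k w
    rw [(rotGraph hes).sum_reverse]
    simp only [RotGraph.follow_rev]
    rw [Finset.sum_eq_single v] <;> simp +contextual
  have h2 : ∀ k w, ∑ u, ∑ c ∈ words d k,
      (if u = v ∧ (rotGraph hes).follow u c = w then (1 : ℝ) else 0) =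
      ∑ c ∈ words d k, if (rotGraph hes).follow v c = w then 1 else 0 := by
    intro k w
    rw [Finset.sum_eq_single v] <;> simp +contextual
  have h3 : ∀ w, (ConstraintGraph.mk (powerEdges t op es)).adjMatrix v w =
      ∑ l ∈ Finset.range (2 * t - 1), 2 * d ^ (2 * t - 2 - l) * ∑ c ∈ words d (l + 1),
        if (rotGraph hes).follow v c = w then (1 : ℝ) else 0 := by
    intro w
    rw [ConstraintGraph.adjMatrix, sum_powerEdges hes, Finset.sum_comm]
    refine Finset.sum_congr rfl fun l _ => ?_
    simp only [← Finset.smul_sum, Finset.sum_add_distrib, h1, h2]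
    rw [nsmul_eq_mul]
    push_cast
    ring
  rw [Matrix.mulVec, dotProduct]
  simp only [h3, Finset.sum_mul]
  rw [Finset.sum_comm, Finset.mul_sum]
  refine Finset.sum_congr rfl fun l hl => ?_
  rw [← RotGraph.expect_follow, Finset.expect_eq_sum_div_card, card_words]
  have h4 : ∑ w, 2 * (d : ℝ) ^ (2 * t - 2 - l) * (∑ c ∈ words d (l + 1),
      if (rotGraph hes).follow v c = w then (1 : ℝ) else 0) * x w =
      2 * d ^ (2 * t - 2 - l) * ∑ c ∈ words d (l + 1), x ((rotGraph hes).follow v c) := by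
    simp only [mul_assoc, ← Finset.mul_sum, Finset.sum_mul]
    rw [Finset.sum_comm]
    simp
  have h5 : (d : ℝ) ^ (2 * t - 1) = d ^ (2 * t - 2 - l) * d ^ (l + 1) := by
    exact_mod_cast (pow_mul_pow_length hl).symm
  rw [h4, h5]
  push_cast
  field_simp

include hes in
/-- The powered graph is an expander with the same ratio of the second eigenvalue to the degree. -/
theorem isExpander_powerEdges [NeZero n] (ht : 0 < t) {lam : ℝ}
    (hlam : (ConstraintGraph.mk es).secondEigenvalue ≤ lam) (h0 : 0 ≤ lam) (h : lam ≤ d / 2) :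
    (ConstraintGraph.mk (powerEdges t op es)).IsExpander (2 * ((2 * t - 1) * d ^ (2 * t - 1)))
      ((2 * ((2 * t - 1) * d ^ (2 * t - 1)) : ℕ) * (lam / d)) := by
  have hd : (0 : ℝ) < d := Nat.cast_pos.2 (NeZero.pos d)
  have hL : 0 < 2 * t - 1 := by omega
  have hd' : (0 : ℝ) < (2 * ((2 * t - 1) * d ^ (2 * t - 1)) : ℕ) := by
    have := NeZero.pos d
    exact_mod_cast (by positivity)
  refine ⟨?_, degree_powerEdges hes, ?_⟩
  · have : lam / d ≤ 1 / 2 := by rw [div_le_iff₀ hd]; linarith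
    nlinarith
  · refine Real.sSup_le ?_ (by positivity)
    rintro _ ⟨x, hx, hx0, rfl⟩
    refine div_le_of_le_mul₀ (Real.sqrt_nonneg _) (by positivity) ?_
    refine Real.sqrt_le_iff.2 ⟨by positivity, ?_⟩
    rw [mul_pow, Real.sq_sqrt (Finset.sum_nonneg fun _ _ => sq_nonneg _)]
    simp only [adjMatrix_powerEdges_mulVec hes, mul_pow, ← Finset.mul_sum]
    have hx0' : 𝔼 v, x v = 0 := by rw [Fintype.expect_eq_sum_div_card, hx0, zero_div]
    have hgap := hasGap_of_secondEigenvalue hes hlam h0 h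
    have h1 : ∀ l, ∑ v, ((rotGraph hes).avg^[l + 1] x v) ^ 2 ≤ (lam / d) ^ 2 * ∑ v, x v ^ 2 := by
      intro l
      have h2 := hgap.iterate l (f := (rotGraph hes).avg x) (by
        rw [RotGraph.expect_avg, hx0'])
      have h3 := avg_contracts hes hlam hx0'
      have h4 : 𝔼 v, ((rotGraph hes).avg^[l + 1] x v) ^ 2 ≤ (lam / d) ^ 2 * 𝔼 v, x v ^ 2 := by
        simp only [Function.iterate_succ_apply]
        refine h2.trans (le_trans ?_ h3)
        refine mul_le_of_le_one_left (Finset.expect_nonneg fun _ _ => sq_nonneg _) ?_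
        exact pow_le_one₀ (by norm_num) (by norm_num)
      rw [Fintype.expect_eq_sum_div_card, Fintype.expect_eq_sum_div_card, ← mul_div_assoc,
        div_le_div_iff_of_pos_right (by simp [NeZero.pos n])] at h4
      exact h4
    have h2 : ∑ v, (∑ l ∈ Finset.range (2 * t - 1), (rotGraph hes).avg^[l + 1] x v) ^ 2 ≤
        (2 * t - 1 : ℕ) ^ 2 * ((lam / d) ^ 2 * ∑ v, x v ^ 2) := by
      calc _ ≤ ∑ v, (2 * t - 1 : ℕ) * ∑ l ∈ Finset.range (2 * t - 1),
            ((rotGraph hes).avg^[l + 1] x v) ^ 2 := by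
            refine Finset.sum_le_sum fun v _ => ?_
            simpa using sq_sum_le_card_mul_sum_sq (s := Finset.range (2 * t - 1))
              (f := fun l => (rotGraph hes).avg^[l + 1] x v)
        _ ≤ (2 * t - 1 : ℕ) * ∑ l ∈ Finset.range (2 * t - 1), ((lam / d) ^ 2 * ∑ v, x v ^ 2) := by
            rw [← Finset.mul_sum, Finset.sum_comm]
            gcongr with l
            exact h1 l
        _ = _ := by rw [Finset.sum_const, Finset.card_range, nsmul_eq_mul]; ring
    push_cast
    refine (mul_le_mul_of_nonneg_left h2 (by positivity)).trans (le_of_eq ?_)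
    ring

end power

/-! ### The alphabet of the powered graph -/

section alphabet

/-- The words of length at most `t`. -/
def wordsLE (d t : ℕ) : Finset (List (Fin d)) := (Finset.range (t + 1)).biUnion (words d)

@[simp] theorem mem_wordsLE {d t : ℕ} {c : List (Fin d)} : c ∈ wordsLE d t ↔ c.length ≤ t := by
  simp [wordsLE]

theorem card_wordsLE (d t : ℕ) : (wordsLE d t).card = ∑ i ∈ Finset.range (t + 1), d ^ i := by
  rw [wordsLE, Finset.card_biUnion]
  · simp only [card_words]
  · intro i _ j _ hij
    refine Finset.disjoint_left.2 fun c hc hc' => ?_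
    rw [mem_words] at hc hc'
    exact hij (hc.symm.trans hc')

/-- The alphabet size of the powered graph: the number of ways to give a pair of values to each
word of length at most `t`. -/
def alphabetSize (W d t : ℕ) : ℕ := (W * W) ^ ∑ i ∈ Finset.range (t + 1), d ^ i

variable {W d t : ℕ}

theorem alphabetSize_pos (hW : 0 < W) : 0 < alphabetSize W d t := by
  unfold alphabetSize; positivity

/-- The symbols of the powered graph are numbered in an arbitrary way. -/
noncomputable def symbolEquiv (W d t : ℕ) :
    (wordsLE d t → Fin W × Fin W) ≃ Fin (alphabetSize W d t) :=
  Fintype.equivFinOfCardEq (by simp [alphabetSize, card_wordsLE])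

variable [NeZero W]

/-- The opinion that a symbol holds about the end of the walk along `c`. -/
noncomputable def symbolOpinion (s : Fin (alphabetSize W d t)) (c : List (Fin d)) : Fin W × Fin W :=
  if h : c ∈ wordsLE d t then (symbolEquiv W d t).symm s ⟨c, h⟩ else (0, 0)

omit [NeZero W] in
/-- The symbol with given opinions. -/
noncomputable def symbolOf (W d t : ℕ) (g : List (Fin d) → Fin W × Fin W) : Fin (alphabetSize W d t) :=
  symbolEquiv W d t fun c => g c

theorem symbolOpinion_symbolOf (g : List (Fin d) → Fin W × Fin W) (c : List (Fin d))
    (hc : c.length ≤ t) : symbolOpinion (symbolOf W d t g) c = g c := by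
  simp [symbolOpinion, symbolOf, hc]

omit [NeZero W] in
theorem symbolOf_congr {g g' : List (Fin d) → Fin W × Fin W} (h : ∀ c, c.length ≤ t → g c = g' c) :
    symbolOf W d t g = symbolOf W d t g' := by
  unfold symbolOf
  congr 1
  funext c
  exact h _ (mem_wordsLE.1 c.2)

end alphabet

/-! ### The powered instance -/

section instances

variable {W d t n : ℕ} [NeZero W] [NeZero d]

/-- The values of an assignment around `v`: the walks of length at most `t` from `v`, each with the
value at its end. -/
def localValues (t : ℕ) (es : List (ConstraintEdge (Fin n) (Fin W))) (ψ : Fin n → Fin W) (v : Fin n) :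
    List (List (Step (Fin W) d) × Fin W) :=
  (List.range (t + 1)).flatMap fun k => (walks d es k v).map fun x => (x.2, ψ x.1)

/-- The symbol with single-valued opinions that are given by a list of walks with values. -/
noncomputable def symbolOfValues (t : ℕ) (l : List (List (Step (Fin W) d) × Fin W)) :
    Fin (alphabetSize W d t) :=
  symbolOf W d t fun c => match l.find? fun y => y.1.map (fun k => k.1) = c with
    | some y => (y.2, y.2)
    | none => (0, 0)

/-- The honest assignment of the powered graph for `ψ`. -/
noncomputable def powerAssignment (d t : ℕ) [NeZero d] (es : List (ConstraintEdge (Fin n) (Fin W)))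
    (ψ : Fin n → Fin W) (v : Fin n) : Fin (alphabetSize W d t) :=
  symbolOfValues t (localValues (d := d) t es ψ v)

theorem powerAssignment_eq_honest {es : List (ConstraintEdge (Fin n) (Fin W))}
    (hes : ∀ v, endCount es v = d) (ψ : Fin n → Fin W) :
    powerAssignment d t es ψ = (rotGraph hes).honest (symbolOf W d t) fun v => (ψ v, ψ v) := by
  funext v
  unfold powerAssignment symbolOfValues RotGraph.honest
  refine symbolOf_congr fun c hc => ?_
  have hmem : ∀ y, y ∈ localValues (d := d) t es ψ v ↔ ∃ c : List (Fin d), c.length ≤ t ∧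
      y = ((rotGraph hes).steps v c, ψ ((rotGraph hes).follow v c)) := by
    intro y
    simp only [localValues, List.mem_flatMap, List.mem_range, List.mem_map, mem_walks hes,
      Nat.lt_succ_iff]
    constructor
    · rintro ⟨k, hk, x, ⟨c, rfl, rfl⟩, rfl⟩
      exact ⟨c, hk, rfl⟩
    · rintro ⟨c, hc, rfl⟩
      exact ⟨c.length, hc, _, ⟨c, rfl, rfl⟩, rfl⟩
  cases hf : (localValues (d := d) t es ψ v).find? fun y => y.1.map (fun k => k.1) = c with
  | none =>
    rw [List.find?_eq_none] at hf
    have := hf _ ((hmem _).2 ⟨c, hc, rfl⟩)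
    simp [RotGraph.map_fst_steps] at this
  | some y =>
    have h1 := List.find?_some hf
    obtain ⟨c', -, rfl⟩ := (hmem _).1 (List.mem_of_find?_eq_some hf)
    simp only [RotGraph.map_fst_steps, decide_eq_true_eq] at h1
    subst h1
    rfl

/-- The powered instance. -/
noncomputable def powerInstance (d t : ℕ) [NeZero d] (I : CSPInstance W) :
    CSPInstance (alphabetSize W d t) where
  n := I.n
  n_pos := I.n_pos
  graph := ⟨powerEdges (d := d) t symbolOpinion I.graph.edges⟩
  ini := powerAssignment d t I.graph.edges I.ini
  tar := powerAssignment d t I.graph.edges I.tar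

omit [NeZero d] in
theorem endCount_of_isExpander {V A : Type} [DecidableEq V] [Fintype V] {G : ConstraintGraph V A}
    {lam : ℝ} (h : G.IsExpander d lam) (v : V) : endCount G.edges v = d :=
  (degree_eq_endCount _ _).symm.trans (h.2.1 v)

variable {lam : ℝ} {I : CSPInstance W}

theorem isExpander_powerInstance (hI : I.graph.IsExpander d lam) (ht : 0 < t) (h0 : 0 ≤ lam)
    (h : lam ≤ d / 2) : (powerInstance d t I).graph.IsExpander
      (2 * ((2 * t - 1) * d ^ (2 * t - 1)))
      ((2 * ((2 * t - 1) * d ^ (2 * t - 1)) : ℕ) * (lam / d)) := by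
  have : NeZero I.n := ⟨I.n_pos.ne'⟩
  exact isExpander_powerEdges (endCount_of_isExpander hI) ht hI.2.2 h0 h

theorem value_powerInstance_of_yes (hI : I.graph.IsExpander d lam) (ht : 0 < t)
    (h : 1 ≤ I.value) : 1 ≤ (powerInstance d t I).value := by
  have : NeZero I.n := ⟨I.n_pos.ne'⟩
  have : NeZero (powerInstance d t I).n := ⟨I.n_pos.ne'⟩
  have hes := endCount_of_isExpander hI
  have h1 := (ConstraintGraph.le_reconfVal_iff _ one_pos _ _).1 h
  refine (ConstraintGraph.le_reconfVal_iff _ one_pos _ _).2 ?_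
  have e1 : ∀ ψ, 1 ≤ I.graph.val ψ ↔ (rotGraph hes).violated ψ ≤ 0 := fun ψ => by
    have : I.graph.val ψ = _ := val_eq_one_sub_violated hes ψ
    rw [this]
    constructor <;> intro h <;> linarith
  have e2 : ∀ ψ, 1 ≤ (powerInstance d t I).graph.val ψ ↔
      (rotGraph hes).rejected t symbolOpinion ψ ≤ 0 := fun ψ => by
    have : (powerInstance d t I).graph.val ψ = _ := val_powerEdges hes ht ψ
    rw [this]
    constructor <;> intro h <;> linarith
  simp only [e1] at h1
  simp only [e2]
  have h2 := RotGraph.reconfigurable_honest (t := t) (op := symbolOpinion)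
    (enc := symbolOf W d t) symbolOpinion_symbolOf (rotGraph_loop hes) h1
  rw [← powerAssignment_eq_honest, ← powerAssignment_eq_honest] at h2
  exact h2

theorem value_powerInstance_of_no (hI : I.graph.IsExpander d lam) (h0 : 0 ≤ lam)
    (hlam : lam ≤ d / 2) {ε : ℝ} (hε : 0 < ε) (hε1 : ε < 1) (ht : 100 / ε ≤ t)
    (hn : 4 * (∑ i ∈ Finset.range t, d ^ i : ℕ) / ε ≤ I.n)
    (h : I.value < 1 - ε) : (powerInstance d t I).value < 1 - 0.00588 := by
  have : NeZero I.n := ⟨I.n_pos.ne'⟩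
  have : NeZero (powerInstance d t I).n := ⟨I.n_pos.ne'⟩
  have hes := endCount_of_isExpander hI
  have ht0 : 0 < t := by
    have : (0 : ℝ) < t := lt_of_lt_of_le (by positivity) ht
    exact_mod_cast this
  by_contra! h'
  refine h.not_ge ?_
  have h1 := (ConstraintGraph.le_reconfVal_iff _ (by norm_num) _ _).1 h'
  refine (ConstraintGraph.le_reconfVal_iff _ (by linarith) _ _).2 ?_
  have e1 : ∀ ψ, 1 - ε ≤ I.graph.val ψ ↔ (rotGraph hes).violated ψ ≤ ε := fun ψ => by
    have : I.graph.val ψ = _ := val_eq_one_sub_violated hes ψ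
    rw [this]
    constructor <;> intro h <;> linarith
  have e2 : ∀ ψ, 1 - 0.00588 ≤ (powerInstance d t I).graph.val ψ ↔
      (rotGraph hes).rejected t symbolOpinion ψ ≤ 0.00588 := fun ψ => by
    have : (powerInstance d t I).graph.val ψ = _ := val_powerEdges hes ht0 ψ
    rw [this]
    constructor <;> intro h <;> linarith
  simp only [e2] at h1
  simp only [e1]
  have hG := hasGap_of_secondEigenvalue hes hI.2.2 h0 hlam
  have h2 := hG.reconfigurable_decode hε ht (by simpa using hn) h1
  have hdec : ∀ ψ : Fin I.n → Fin W, (rotGraph hes).decode t symbolOpinion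
      (powerAssignment d t I.graph.edges ψ) = ψ := by
    intro ψ
    refine RotGraph.decode_honest ht0 fun v c hc => ?_
    rw [powerAssignment_eq_honest hes, RotGraph.honest, symbolOpinion_symbolOf _ _ hc]
  have e3 : (powerInstance d t I).ini = powerAssignment d t I.graph.edges I.ini := rfl
  have e4 : (powerInstance d t I).tar = powerAssignment d t I.graph.edges I.tar := rfl
  rw [e3, e4, hdec, hdec] at h2
  exact h2

/-! ### Trivial instances -/

/-- The instance with one vertex, `m` self-loops, and the constant constraint `b`. -/
def trivialInstance (W m : ℕ) [NeZero W] (b : Bool) : CSPInstance W where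
  n := 1
  n_pos := one_pos
  graph := ⟨List.replicate m ⟨0, 0, fun _ _ => b⟩⟩
  ini _ := 0
  tar _ := 0

theorem isExpander_trivialInstance {m : ℕ} {b : Bool} (h0 : 0 ≤ lam) (h : lam < (2 * m : ℕ)) :
    (trivialInstance W m b).graph.IsExpander (2 * m) lam := by
  refine ⟨h, fun v => ?_, ?_⟩
  · obtain rfl : v = (0 : Fin 1) := Subsingleton.elim (α := Fin 1) _ _
    simp [trivialInstance, ConstraintGraph.degree, mul_comm]
  · refine Real.sSup_le ?_ h0
    rintro _ ⟨x, hx, hx0, -⟩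
    refine absurd (funext fun v => ?_) hx
    have h1 : ∀ y : Fin 1 → ℝ, ∑ v, y v = 0 → ∀ v, y v = 0 := by
      intro y hy v
      rw [Fin.sum_univ_one] at hy
      rw [Subsingleton.elim v 0, hy]
    exact h1 x hx0 v

theorem val_trivialInstance {m : ℕ} (hm : 0 < m) (b : Bool)
    (ψ : Fin (trivialInstance W m b).n → Fin W) :
    (trivialInstance W m b).graph.val ψ = if b then 1 else 0 := by
  have : (m : ℝ) ≠ 0 := Nat.cast_ne_zero.2 hm.ne'
  cases b <;> simp [trivialInstance, ConstraintGraph.val, List.countP_replicate, this]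

theorem value_trivialInstance_true {m : ℕ} (hm : 0 < m) : 1 ≤ (trivialInstance W m true).value := by
  have : NeZero (trivialInstance W m true).n := ⟨one_ne_zero⟩
  refine (ConstraintGraph.le_reconfVal_iff _ one_pos _ _).2 (.of_mixtures fun χ _ => ?_)
  rw [val_trivialInstance hm]
  simp

theorem value_trivialInstance_false {m : ℕ} (hm : 0 < m) {r : ℝ} (hr : 0 < r) :
    (trivialInstance W m false).value < r := by
  have : NeZero (trivialInstance W m false).n := ⟨one_ne_zero⟩
  by_contra! h
  have := ((ConstraintGraph.le_reconfVal_iff _ hr _ _).1 h).1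
  beta_reduce at this
  rw [val_trivialInstance hm] at this
  simp at this
  linarith

end instances

/-! ### The reduction runs in polynomial time -/

section

variable {W d : ℕ}

theorem encodeNat_injective : Function.Injective encodeNat := fun a b h => by
  simpa using congrArg List.length (encodeList_injective h)

theorem ofBool_injective : Function.Injective Data.ofBool := by
  intro a b h
  cases a <;> cases b <;> simp_all [Data.ofBool, Data.cons]

/-- The truth table of a constraint. -/
def encodeTable (r : Fin W → Fin W → Bool) : Data :=
  encodeList (List.ofFn fun a => encodeList (List.ofFn fun b => Data.ofBool (r a b)))

theorem encodeTable_injective : Function.Injective (encodeTable (W := W)) := by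
  intro r s h
  funext a b
  exact ofBool_injective
    (congrFun (List.ofFn_injective (encodeList_injective
      (congrFun (List.ofFn_injective (encodeList_injective h)) a))) b)

/-- The encoding of a step of a walk. -/
def encodeStep (k : Step (Fin W) d) : Data :=
  Data.cons (encodeNat k.1) (Data.cons (encodeNat k.2.1) (encodeTable k.2.2))

theorem encodeStep_injective : Function.Injective (encodeStep (W := W) (d := d)) := by
  rintro ⟨i, j, r⟩ ⟨i', j', r'⟩ h
  simp only [encodeStep, cons_inj] at h
  obtain ⟨h1, h2, h3⟩ := h
  rw [Fin.ext (encodeNat_injective h1), Fin.ext (encodeNat_injective h2), encodeTable_injective h3]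

/-- The encoding of the steps of a walk. -/
def encodeSteps (w : List (Step (Fin W) d)) : Data := encodeList (w.map encodeStep)

theorem encodeSteps_injective : Function.Injective (encodeSteps (W := W) (d := d)) :=
  encodeList_injective.comp (List.map_injective_iff.2 encodeStep_injective)

/-- The encoding of a dart. -/
def encodeDart {n : ℕ} (D : Fin n × Fin n × Step (Fin W) d) : Data :=
  Data.cons (encodeNat D.1) (Data.cons (encodeNat D.2.1) (encodeStep D.2.2))

/-- The encoding of a walk: its end and its steps. -/
def encodeWalk {n : ℕ} (x : Fin n × List (Step (Fin W) d)) : Data :=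
  Data.cons (encodeNat x.1) (encodeSteps x.2)

/-- The encoding of a walk with a value. -/
def encodeValue (y : List (Step (Fin W) d) × Fin W) : Data :=
  Data.cons (encodeSteps y.1) (encodeNat y.2)

theorem encodeValue_injective : Function.Injective (encodeValue (W := W) (d := d)) := by
  rintro ⟨w, a⟩ ⟨w', a'⟩ h
  simp only [encodeValue, cons_inj] at h
  rw [encodeSteps_injective h.1, Fin.ext (encodeNat_injective h.2)]

theorem Set.Finite.lists {α : Type} {s : Set α} (hs : s.Finite) (B : ℕ) :
    {l : List α | l.length ≤ B ∧ ∀ x ∈ l, x ∈ s}.Finite := by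
  have := hs.to_subtype
  refine ((List.finite_length_le s B).image (List.map (↑))).subset ?_
  rintro l ⟨hl, hls⟩
  lift l to List s using hls
  exact ⟨l, by simpa using hl, rfl⟩

end

namespace PolyTime

section

variable {ι κ : Type} {e : ι → Data}

/-- Table lookup, where only finitely many keys occur. -/
theorem lookup_of_finite {key : κ → Data} (hkey : Function.Injective key) (k : ι → κ)
    (out : κ → Data) {s : Set κ} (hs : s.Finite) (hk : ∀ i, k i ∈ s)
    (h : PolyTime e fun i => key (k i)) : PolyTime e fun i => out (k i) := by
  have := hs.to_subtype
  exact lookup (key := fun x : s => key x) (hkey.comp Subtype.val_injective)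
    (fun i => ⟨k i, hk i⟩) (fun x => out x) h

theorem flatMap_const (l : List κ) {f : ι → κ → List Data}
    (h : ∀ k ∈ l, PolyTime e fun i => encodeList (f i k)) :
    PolyTime e fun i => encodeList (l.flatMap (f i)) := by
  induction l with
  | nil => exact const _ _
  | cons k l ih =>
    simp only [List.flatMap_cons]
    exact append (h k (by simp)) (ih fun k hk => h k (by simp [hk]))

theorem encodeNat_add {a b : ι → ℕ} (ha : PolyTime e fun i => encodeNat (a i))
    (hb : PolyTime e fun i => encodeNat (b i)) : PolyTime e fun i => encodeNat (a i + b i) := by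
  simpa only [encodeNat, ← List.replicate_append_replicate] using append ha hb

theorem decide_eq {n : ι → ℕ} {a b : (i : ι) → Fin (n i)} (ha : PolyTime e fun i => encodeNat (a i))
    (hb : PolyTime e fun i => encodeNat (b i)) :
    PolyTime e fun i => Data.ofBool (decide (a i = b i)) := by
  refine (ha.beq hb).congr (fun _ => rfl) fun i => ?_
  congr 1
  rw [decide_eq_decide, encodeNat_injective.eq_iff, Fin.ext_iff]

end

section

variable {ι : Type} {e : ι → Data} {W d : ℕ} {n : ι → ℕ}
  {es : (i : ι) → List (ConstraintEdge (Fin (n i)) (Fin W))} {v : (i : ι) → Fin (n i)}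

theorem endCount (hes : PolyTime e fun i => encodeList ((es i).map CSPInstance.encodeEdge))
    (hv : PolyTime e fun i => encodeNat (v i)) :
    PolyTime e fun i => encodeNat (_root_.endCount (es i) (v i)) := by
  have hv' := weaken (a := fun x : Σ i, {b // b ∈ es i} => CSPInstance.encodeEdge x.2.1)
    (hv.reindex fun x : Σ i, {b // b ∈ es i} => x.1)
  exact encodeNat_add (countP hes (decide_eq top.left hv'))
    (countP hes (decide_eq top.right.left hv'))

theorem forwardRel {g : (i : ι) → ConstraintEdge (Fin (n i)) (Fin W)}
    (hg : PolyTime e fun i => CSPInstance.encodeEdge (g i)) :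
    PolyTime e fun i => encodeTable (_root_.forwardRel (g i)) := by
  refine lookup (κ := (Fin W → Fin W → Bool) × Bool)
    (key := fun k => Data.cons (encodeTable k.1) (Data.ofBool k.2)) ?_
    (fun i => ((g i).rel, decide ((g i).fst = (g i).snd)))
    (fun k => encodeTable fun a b => k.1 a b || (k.2 && !decide (a = b))) ?_
  · rintro ⟨r, b⟩ ⟨r', b'⟩ h
    obtain ⟨h1, h2⟩ := cons_inj.1 h
    exact Prod.ext (encodeTable_injective h1) (ofBool_injective h2)
  · exact hg.right.right.left.cons (decide_eq hg.left hg.right.left)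

theorem backwardRel {g : (i : ι) → ConstraintEdge (Fin (n i)) (Fin W)}
    (hg : PolyTime e fun i => CSPInstance.encodeEdge (g i)) :
    PolyTime e fun i => encodeTable (_root_.backwardRel (g i)) :=
  lookup encodeTable_injective (fun i => _root_.forwardRel (g i))
    (fun r => encodeTable fun a b => r b a) (forwardRel hg)

end

section

variable {ι : Type} {e : ι → Data} {W d : ℕ} [NeZero d] {n : ι → ℕ}
  {es : (i : ι) → List (ConstraintEdge (Fin (n i)) (Fin W))} {v : (i : ι) → Fin (n i)}

/-- The encodings of the two darts of the first edge of a list.  The darts of a list of edges are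
found by applying this function to all suffixes. -/
def encodeHeadDarts (d : ℕ) [NeZero d] {n : ℕ} :
    List (ConstraintEdge (Fin n) (Fin W)) → List Data
  | [] => []
  | e :: es => [
      Data.cons (encodeNat e.fst) (Data.cons (encodeNat e.snd) (Data.cons
        (encodeNat (Fin.ofNat d (_root_.endCount es e.fst + if e.fst = e.snd then 1 else 0)))
        (Data.cons (encodeNat (Fin.ofNat d (_root_.endCount es e.snd)))
          (encodeTable (_root_.forwardRel e))))),
      Data.cons (encodeNat e.snd) (Data.cons (encodeNat e.fst) (Data.cons
        (encodeNat (Fin.ofNat d (_root_.endCount es e.snd)))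
        (Data.cons
          (encodeNat (Fin.ofNat d (_root_.endCount es e.fst + if e.fst = e.snd then 1 else 0)))
          (encodeTable (_root_.backwardRel e)))))]

theorem map_encodeDart_darts {n : ℕ} (es : List (ConstraintEdge (Fin n) (Fin W))) :
    (_root_.darts d es).map encodeDart = es.tails.flatMap (encodeHeadDarts d) := by
  induction es with
  | nil => rfl
  | cons e es ih =>
    rw [List.tails_cons, List.flatMap_cons, ← ih]
    rfl

omit [NeZero d] in
theorem endCount_le_of_suffix {n : ℕ} {l m : List (ConstraintEdge (Fin n) (Fin W))} (h : l <:+ m)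
    (v : Fin n) : _root_.endCount l v ≤ _root_.endCount m v :=
  add_le_add (h.sublist.countP_le) (h.sublist.countP_le)

theorem headDarts {g : (i : ι) → ConstraintEdge (Fin (n i)) (Fin W)}
    {r : (i : ι) → List (ConstraintEdge (Fin (n i)) (Fin W))}
    (hd : ∀ i v, _root_.endCount (g i :: r i) v ≤ d)
    (hg : PolyTime e fun i => CSPInstance.encodeEdge (g i))
    (hr : PolyTime e fun i => encodeList ((r i).map CSPInstance.encodeEdge)) :
    PolyTime e fun i => encodeList (encodeHeadDarts d (g i :: r i)) := by
  have hlt : ∀ i, _root_.endCount (r i) (g i).fst + (if (g i).fst = (g i).snd then 1 else 0) < d ∧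
      _root_.endCount (r i) (g i).snd < d := by
    intro i
    have h1 := hd i (g i).fst
    have h2 := hd i (g i).snd
    rw [endCount_cons] at h1 h2
    simp only [if_true, @eq_comm _ (g i).snd (g i).fst] at h1 h2
    constructor <;> omega
  have hi := encodeNat_add (b := fun i => if (g i).fst = (g i).snd then 1 else 0)
    (endCount hr hg.left) ((decide_eq hg.left hg.right.left).congr (fun _ => rfl) fun i => by
      by_cases h : (g i).fst = (g i).snd <;> simp [h, Data.ofBool, encodeNat, encodeList])
  -- the labels are smaller than `d`, so that the reduction modulo `d` has no effect
  have hi' : PolyTime _ _ := hi.congr (fun _ => rfl) fun i => congrArg encodeNat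
    (Nat.mod_eq_of_lt (hlt i).1).symm
  have hj' : PolyTime _ _ := (endCount hr hg.right.left).congr (fun _ => rfl) fun i =>
    congrArg encodeNat (Nat.mod_eq_of_lt (hlt i).2).symm
  exact (hg.left.cons (hg.right.left.cons (hi'.cons (hj'.cons (forwardRel hg))))).cons
    ((hg.right.left.cons (hg.left.cons (hj'.cons (hi'.cons (backwardRel hg))))).cons
      (const _ .nil))

theorem darts (hd : ∀ i v, _root_.endCount (es i) v = d)
    (hes : PolyTime e fun i => encodeList ((es i).map CSPInstance.encodeEdge)) :
    PolyTime e fun i => encodeList ((_root_.darts d (es i)).map encodeDart) := by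
  simp only [map_encodeDart_darts]
  refine flatMap (tails hes) (ite top ?_ ?_)
  · have hne : ∀ x : {x : Σ i, {t // t ∈ (es i).tails} //
        encodeList (x.2.1.map CSPInstance.encodeEdge) ≠ .nil}, x.1.2.1 ≠ [] := by
      intro x h
      exact x.2 (by rw [h]; rfl)
    have htop := (top (a := fun x : Σ i, {t // t ∈ (es i).tails} =>
      encodeList (x.2.1.map CSPInstance.encodeEdge)) (e := fun x => e x.1)).reindex
        fun x : {x : Σ i, {t // t ∈ (es i).tails} //
        encodeList (x.2.1.map CSPInstance.encodeEdge) ≠ .nil} => x.1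
    have hcons : PolyTime _ _ := htop.congr (fun _ => rfl) fun x => congrArg
      (fun l => encodeList (l.map CSPInstance.encodeEdge)) (List.cons_head_tail (hne x)).symm
    refine (headDarts (d := d) ?_ hcons.left hcons.right).congr (fun _ => rfl) fun x => ?_
    · intro x v
      rw [List.cons_head_tail, ← hd x.1.1 v]
      exact endCount_le_of_suffix ((List.mem_tails _ _).1 x.1.2.2) v
    · rw [List.cons_head_tail]
  · refine (const _ .nil).congr (fun _ => rfl) fun x => ?_
    obtain ⟨⟨i, t, ht⟩, hx⟩ := x
    cases t with
    | nil => rfl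
    | cons g r => exact absurd hx (cons_ne_nil _ _)

theorem dartsFrom (hd : ∀ i v, _root_.endCount (es i) v = d)
    (hes : PolyTime e fun i => encodeList ((es i).map CSPInstance.encodeEdge))
    (hv : PolyTime e fun i => encodeNat (v i)) :
    PolyTime e fun i => encodeList ((_root_.dartsFrom d (es i) (v i)).map encodeDart) :=
  filter (darts hd hes) (decide_eq top.left (weaken (hv.reindex fun x :
    (Σ i, {D // D ∈ _root_.darts d (es i)}) => x.1)))

end

theorem walks (k : ℕ) {ι : Type} {e : ι → Data} {W d : ℕ} [NeZero d] {n : ι → ℕ}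
    {es : (i : ι) → List (ConstraintEdge (Fin (n i)) (Fin W))} {v : (i : ι) → Fin (n i)}
    (hd : ∀ i v, _root_.endCount (es i) v = d)
    (hes : PolyTime e fun i => encodeList ((es i).map CSPInstance.encodeEdge))
    (hv : PolyTime e fun i => encodeNat (v i)) :
    PolyTime e fun i => encodeList ((_root_.walks d (es i) k (v i)).map encodeWalk) := by
  induction k generalizing ι with
  | zero => exact (hv.cons (const _ .nil)).cons (const _ .nil)
  | succ k ih =>
    have h := flatMap (f := fun i D => (_root_.walks d (es i) k D.2.1).map fun x =>
      encodeWalk (x.1, D.2.2 :: x.2)) (dartsFrom hd hes hv) ?_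
    · refine h.congr (fun _ => rfl) fun i => ?_
      simp [_root_.walks, List.map_flatMap, Function.comp_def]
    · have hw := ih (es := fun x : Σ i, {D // D ∈ _root_.dartsFrom d (es i) (v i)} => es x.1)
        (v := fun x => x.2.1.2.1) (fun x => hd x.1) (weaken (a := fun x => encodeDart x.2.1)
          (hes.reindex fun x : (Σ i, {D // D ∈ _root_.dartsFrom d (es i) (v i)}) => x.1))
        top.right.left
      exact map (f := fun x y => encodeWalk (y.1, x.2.1.2.2 :: y.2)) hw
        (top.left.cons ((right (right (weaken top))).cons top.right))

end PolyTime

section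

variable {W d t n : ℕ} [NeZero d]

theorem length_of_mem_walks {V A : Type} [DecidableEq V] [DecidableEq A]
    {es : List (ConstraintEdge V A)} {k : ℕ}
    {v : V} {x : V × List (Step A d)} (h : x ∈ walks d es k v) : x.2.length = k := by
  induction k generalizing v x with
  | zero =>
    simp only [walks, List.mem_singleton] at h
    simp [h]
  | succ k ih =>
    simp only [walks, List.mem_flatMap, List.mem_map] at h
    obtain ⟨D, -, y, hy, rfl⟩ := h
    simp [ih hy]

theorem length_localValues {es : List (ConstraintEdge (Fin n) (Fin W))}
    (hes : ∀ v, endCount es v = d) (ψ : Fin n → Fin W) (v : Fin n) :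
    (localValues (d := d) t es ψ v).length = ((List.range (t + 1)).map fun k => d ^ k).sum := by
  have h : ∀ k, (walks d es k v).length = d ^ k := fun k => by
    have := sum_walks (M := ℕ) hes k v fun _ => 1
    simpa [card_words] using this
  simp [localValues, List.length_flatMap, h]

theorem length_of_mem_localValues {es : List (ConstraintEdge (Fin n) (Fin W))}
    {ψ : Fin n → Fin W} {v : Fin n} {y : List (Step (Fin W) d) × Fin W}
    (h : y ∈ localValues (d := d) t es ψ v) : y.1.length ≤ t := by
  simp only [localValues, List.mem_flatMap, List.mem_range, List.mem_map] at h
  obtain ⟨k, hk, x, hx, rfl⟩ := h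
  rw [length_of_mem_walks hx]
  omega

omit [NeZero d] in
theorem encode_eq {W : ℕ} (I : CSPInstance W) : I.encode =
    Data.cons (encodeNat I.n) (Data.cons (encodeList (I.graph.edges.map CSPInstance.encodeEdge))
      (Data.cons (CSPInstance.encodeAssignment I.ini)
        (Data.cons (CSPInstance.encodeAssignment I.tar) .nil))) := rfl

end

namespace PolyTime

section

variable {ι : Type} {e : ι → Data} {W W' d : ℕ} [NeZero d] {n : ι → ℕ}
  {es : (i : ι) → List (ConstraintEdge (Fin (n i)) (Fin W))} {v : (i : ι) → Fin (n i)}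
  {ψ : (i : ι) → Fin (n i) → Fin W}

/-- The truth tables of the tests are looked up: a walk of bounded length has finitely many possible
lists of steps. -/
theorem powerEdges (t : ℕ) (op : Fin W' → List (Fin d) → Fin W × Fin W)
    (hd : ∀ i v, _root_.endCount (es i) v = d) (hn : PolyTime e fun i => encodeNat (n i))
    (hes : PolyTime e fun i => encodeList ((es i).map CSPInstance.encodeEdge)) :
    PolyTime e fun i =>
      encodeList ((_root_.powerEdges t op (es i)).map CSPInstance.encodeEdge) := by
  classical
  simp only [_root_.powerEdges, List.map_flatMap]
  refine flatMap (enc := fun i (v : Fin (n i)) => encodeNat v) (finRange hn) ?_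
  refine flatMap_const _ fun l _ => ?_
  refine flatMap_const _ fun _ _ => ?_
  have hes' := weaken (a := fun x : Σ i, {v : Fin (n i) // v ∈ List.finRange (n i)} =>
    encodeNat x.2.1) (hes.reindex fun x => x.1)
  have hw := walks (l + 1) (es := fun x : Σ i, {v : Fin (n i) // v ∈ List.finRange (n i)} => es x.1)
    (v := fun x => x.2.1) (fun x => hd x.1) hes' top
  simp only [List.map_map, Function.comp_def, CSPInstance.encodeEdge]
  refine map hw ((left (weaken (.id _))).cons (top.left.cons (cons ?_ (const _ .nil))))
  exact lookup_of_finite encodeSteps_injective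
    (fun x : Σ x : (Σ i, {v : Fin (n i) // v ∈ List.finRange (n i)}),
      {y // y ∈ _root_.walks d (es x.1) (l + 1) x.2.1} => x.2.1.2)
    (fun w => encodeTable fun s s' => decide (Accepts t op w s s'))
    (List.finite_length_eq _ (l + 1)) (fun x => length_of_mem_walks x.2.2) top.right

/-- The value of an assignment at a vertex. -/
theorem apply_assignment (hψ : PolyTime e fun i => CSPInstance.encodeAssignment (ψ i))
    (hv : PolyTime e fun i => encodeNat (v i)) : PolyTime e fun i => encodeNat (ψ i (v i)) := by
  refine (left (drop hψ hv)).congr (fun _ => rfl) fun i => ?_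
  rw [List.drop_eq_getElem_cons (by simp)]
  simp only [List.getElem_ofFn, encodeList, left_cons]

theorem localValues (t : ℕ) (hd : ∀ i v, _root_.endCount (es i) v = d)
    (hes : PolyTime e fun i => encodeList ((es i).map CSPInstance.encodeEdge))
    (hψ : PolyTime e fun i => CSPInstance.encodeAssignment (ψ i))
    (hv : PolyTime e fun i => encodeNat (v i)) : PolyTime e fun i =>
      encodeList ((_root_.localValues (d := d) t (es i) (ψ i) (v i)).map encodeValue) := by
  simp only [_root_.localValues, List.map_flatMap, List.map_map]
  refine flatMap_const _ fun k _ => map (walks k hd hes hv) (top.right.cons ?_)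
  exact apply_assignment (weaken (hψ.reindex fun x :
    (Σ i, {y // y ∈ _root_.walks d (es i) k (v i)}) => x.1)) top.left

/-- The symbols are looked up: in a regular graph a vertex has boundedly many short walks. -/
theorem powerAssignment (t : ℕ) [NeZero W] (hd : ∀ i v, _root_.endCount (es i) v = d)
    (hn : PolyTime e fun i => encodeNat (n i))
    (hes : PolyTime e fun i => encodeList ((es i).map CSPInstance.encodeEdge))
    (hψ : PolyTime e fun i => CSPInstance.encodeAssignment (ψ i)) :
    PolyTime e fun i =>
      CSPInstance.encodeAssignment (_root_.powerAssignment d t (es i) (ψ i)) := by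
  simp only [CSPInstance.encodeAssignment, List.ofFn_eq_map]
  refine map (enc := fun i (v : Fin (n i)) => encodeNat v) (finRange hn) ?_
  have h := localValues t (es := fun x : Σ i, {v : Fin (n i) // v ∈ List.finRange (n i)} => es x.1)
    (ψ := fun x => ψ x.1) (v := fun x => x.2.1) (fun x => hd x.1)
    (weaken (a := fun x : Σ i, {v : Fin (n i) // v ∈ List.finRange (n i)} => encodeNat x.2.1)
      (hes.reindex Sigma.fst))
    (weaken (a := fun x : Σ i, {v : Fin (n i) // v ∈ List.finRange (n i)} => encodeNat x.2.1)
      (hψ.reindex Sigma.fst)) top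
  refine lookup_of_finite (encodeList_injective.comp (List.map_injective_iff.2 encodeValue_injective))
    (fun x : Σ i, {v : Fin (n i) // v ∈ List.finRange (n i)} =>
      _root_.localValues (d := d) t (es x.1) (ψ x.1) x.2.1) (fun l => encodeNat (symbolOfValues t l))
    (((List.finite_length_le (Step (Fin W) d) t).prod (Set.finite_univ (α := Fin W))).lists
      ((List.range (t + 1)).map fun k => d ^ k).sum) (fun x => ⟨?_, fun y hy => ⟨?_, trivial⟩⟩) h
  · exact (length_localValues (hd x.1) _ _).le
  · exact length_of_mem_localValues hy

theorem powerInstance (t : ℕ) [NeZero W] {I : ι → CSPInstance W}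
    (hd : ∀ i v, _root_.endCount (I i).graph.edges v = d)
    (hI : PolyTime e fun i => (I i).encode) :
    PolyTime e fun i => (_root_.powerInstance d t (I i)).encode :=
  hI.left.cons ((powerEdges t symbolOpinion hd hI.left hI.right.left).cons
    ((powerAssignment t hd hI.left hI.right.left hI.right.right.left).cons
      ((powerAssignment t hd hI.left hI.right.left hI.right.right.right.left).cons (const _ .nil))))

end

end PolyTime

section

variable {W d : ℕ}

/-! ### The reduction -/

theorem encode_injective : Function.Injective (CSPInstance.encode (W := W)) := by
  rintro ⟨n, hn, ⟨es⟩, ψ, φ⟩ ⟨n', hn', ⟨es'⟩, ψ', φ'⟩ h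
  simp only [encode_eq, cons_inj] at h
  obtain ⟨h1, h2, h3, h4, -⟩ := h
  obtain rfl := encodeNat_injective h1
  have hE : Function.Injective (CSPInstance.encodeEdge (W := W) (n := n)) := by
    rintro ⟨a, b, r⟩ ⟨a', b', r'⟩ h
    have h : Data.cons (encodeNat a) (Data.cons (encodeNat b) (Data.cons (encodeTable r) .nil)) =
      Data.cons (encodeNat a') (Data.cons (encodeNat b') (Data.cons (encodeTable r') .nil)) := h
    simp only [cons_inj] at h
    rw [Fin.ext (encodeNat_injective h.1), Fin.ext (encodeNat_injective h.2.1),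
      encodeTable_injective h.2.2.1]
  have hA : Function.Injective (CSPInstance.encodeAssignment (W := W) (n := n)) := by
    intro ψ φ h
    funext v
    exact Fin.ext (encodeNat_injective (congrFun (List.ofFn_injective (encodeList_injective h)) v))
  rw [List.map_injective_iff.2 hE (encodeList_injective h2), hA h3, hA h4]

instance {V A : Type} [Finite V] [Finite A] : Finite (ConstraintEdge V A) :=
  Finite.of_injective (fun e => (e.fst, e.snd, e.rel)) fun ⟨a, b, r⟩ ⟨a', b', r'⟩ h => by
    simp only [Prod.mk.injEq] at h
    obtain ⟨rfl, rfl, rfl⟩ := h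
    rfl

theorem finite_instances (N L : ℕ) :
    {I : CSPInstance W | I.n ≤ N ∧ I.graph.edges.length ≤ L}.Finite := by
  have hT : Finite (Σ n : Fin (N + 1), {l : List (ConstraintEdge (Fin n) (Fin W)) // l.length ≤ L} ×
      (Fin n → Fin W) × (Fin n → Fin W)) := by
    have : ∀ n : Fin (N + 1), Finite {l : List (ConstraintEdge (Fin n) (Fin W)) // l.length ≤ L} :=
      fun n => (List.finite_length_le _ L).to_subtype
    infer_instance
  refine Set.finite_coe_iff.1 (Finite.of_injective
    (fun I : {I : CSPInstance W | I.n ≤ N ∧ I.graph.edges.length ≤ L} =>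
      (⟨⟨I.1.n, Nat.lt_succ_of_le I.2.1⟩, ⟨I.1.graph.edges, I.2.2⟩, I.1.ini, I.1.tar⟩ :
        Σ n : Fin (N + 1), {l : List (ConstraintEdge (Fin n) (Fin W)) // l.length ≤ L} ×
          (Fin n → Fin W) × (Fin n → Fin W))) ?_)
  rintro ⟨⟨n, hn, ⟨es⟩, ψ, φ⟩, h⟩ ⟨⟨n', hn', ⟨es'⟩, ψ', φ'⟩, h'⟩ heq
  simp only [Sigma.mk.injEq, Fin.mk.injEq] at heq
  obtain ⟨rfl, heq⟩ := heq
  simp only [heq_eq_eq, Prod.mk.injEq, Subtype.mk.injEq] at heq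
  obtain ⟨rfl, rfl, rfl⟩ := heq
  rfl

theorem length_edges_le {I : CSPInstance W} {lam : ℝ} (hI : I.graph.IsExpander d lam) :
    I.graph.edges.length ≤ I.n * d := by
  have := two_mul_length (endCount_of_isExpander hI)
  rw [Fintype.card_fin] at this
  omega

end

section

variable {W d t : ℕ} [NeZero W] [NeZero d] {lam : ℝ}

instance : NeZero (alphabetSize W d t) := ⟨(alphabetSize_pos (NeZero.pos W)).ne'⟩

open Classical in
/-- The map on instances: powering, except that the finitely many instances with at most `N`
vertices are solved. -/
noncomputable def amplify (d t N : ℕ) [NeZero d] (I : CSPInstance W) :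
    CSPInstance (alphabetSize W d t) :=
  if I.n ≤ N then trivialInstance _ ((2 * t - 1) * d ^ (2 * t - 1)) (decide (1 ≤ I.value))
  else powerInstance d t I

theorem isExpander_amplify {N : ℕ} {I : CSPInstance W} (hI : I.graph.IsExpander d lam) (ht : 0 < t)
    (h0 : 0 ≤ lam) (h : lam ≤ d / 2) : (amplify d t N I).graph.IsExpander
      (2 * ((2 * t - 1) * d ^ (2 * t - 1)))
      ((2 * ((2 * t - 1) * d ^ (2 * t - 1)) : ℕ) * (lam / d)) := by
  by_cases hN : I.n ≤ N
  · rw [show amplify d t N I = _ from if_pos hN]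
    refine isExpander_trivialInstance (by positivity) ?_
    have hd : (0 : ℝ) < d := Nat.cast_pos.2 (NeZero.pos d)
    have hm : (0 : ℝ) < (2 * ((2 * t - 1) * d ^ (2 * t - 1)) : ℕ) := by
      have := NeZero.pos d
      have : 0 < 2 * t - 1 := by omega
      exact_mod_cast (by positivity)
    refine mul_lt_of_lt_one_right hm ?_
    rw [div_lt_one hd]
    linarith
  · rw [show amplify d t N I = _ from if_neg hN]
    exact isExpander_powerInstance hI ht h0 h

/-- The instances with at most `N` vertices are finitely many by regularity, so that they are
looked up; their values are not computed. -/
theorem polyTime_amplify (N : ℕ) : PolyTime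
    (fun I : ExpanderInstance W d lam => I.1.encode) fun I => (amplify d t N I.1).encode := by
  classical
  have hcond : PolyTime (fun I : ExpanderInstance W d lam => I.1.encode)
      fun I => encodeNat (I.1.n - N) := by
    induction N with
    | zero => exact (PolyTime.id _).left
    | succ N ih =>
      refine ih.right.congr (fun _ => rfl) fun I => ?_
      rw [← Nat.sub_sub]
      cases I.1.n - N <;> rfl
  have hnil : ∀ k, encodeNat k = .nil ↔ k = 0 := fun k => by
    cases k with
    | zero => simp [encodeNat, encodeList]
    | succ k => simpa using! cons_ne_nil .nil (encodeNat k)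
  refine PolyTime.ite hcond ?_ ?_
  · refine (PolyTime.powerInstance t (I := fun I : {I : ExpanderInstance W d lam //
      encodeNat (I.1.n - N) ≠ .nil} => I.1.1) (fun I => endCount_of_isExpander I.1.2)
      (.id _)).congr (fun _ => rfl) fun I => ?_
    have := (hnil _).not.1 I.2
    rw [amplify, if_neg (by omega)]
  · refine PolyTime.lookup_of_finite encode_injective (fun I : {I : ExpanderInstance W d lam //
      encodeNat (I.1.n - N) = .nil} => I.1.1) (fun I => (amplify d t N I).encode)
      (finite_instances N (N * d)) (fun I => ?_) (.id _)
    have := (hnil _).1 I.2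
    have hN : I.1.1.n ≤ N := by omega
    exact ⟨hN, (length_edges_le I.1.2).trans (Nat.mul_le_mul_right _ hN)⟩

/-- Powering is a gap-preserving reduction. -/
theorem gapReducible_amplify (h0 : 0 ≤ lam) (hlam : lam ≤ d / 2) {ε : ℝ} (hε : 0 < ε) (hε1 : ε < 1)
    (ht : 100 / ε ≤ t) : GapReducible 1 (1 - ε) W d lam 1 (1 - 0.00588) (alphabetSize W d t)
      (2 * ((2 * t - 1) * d ^ (2 * t - 1)))
      ((2 * ((2 * t - 1) * d ^ (2 * t - 1)) : ℕ) * (lam / d)) := by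
  have ht0 : 0 < t := by
    have : (0 : ℝ) < t := lt_of_lt_of_le (by positivity) ht
    exact_mod_cast this
  have hm : 0 < (2 * t - 1) * d ^ (2 * t - 1) := by
    have := NeZero.pos d
    have : 0 < 2 * t - 1 := by omega
    positivity
  let N := ⌈4 * (∑ i ∈ Finset.range t, d ^ i : ℕ) / ε⌉₊
  refine ⟨fun I => ⟨amplify d t N I.1, isExpander_amplify I.2 ht0 h0 hlam⟩,
    polyTimeComputable_of_polyTime (polyTime_amplify N), fun I => ?_⟩
  by_cases hN : I.1.n ≤ N
  · simp only [amplify, if_pos hN]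
    constructor
    · intro h
      simp only [h, decide_true]
      exact value_trivialInstance_true hm
    · intro h
      have : ¬ 1 ≤ I.1.value := by linarith
      simp only [this, decide_false]
      exact value_trivialInstance_false hm (by norm_num)
  · simp only [amplify, if_neg hN]
    refine ⟨value_powerInstance_of_yes I.2 ht0,
      value_powerInstance_of_no I.2 h0 hlam hε hε1 ht ((Nat.le_ceil _).trans ?_)⟩
    exact Nat.cast_le.2 (not_le.1 hN).le

end

section

variable {W : ℕ} {lam : ℝ}

/-- A `1`-regular graph is a perfect matching, whose eigenvalues are `1` and `-1`; so it is not an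
expander. -/
theorem isEmpty_expanderInstance_one (h0 : 0 ≤ lam) (h : lam ≤ 1 / 2) :
    IsEmpty (ExpanderInstance W 1 lam) := by
  refine ⟨fun ⟨I, hI⟩ => ?_⟩
  have hes := endCount_of_isExpander hI
  have hn : 1 < I.n := by
    have := two_mul_length hes
    rw [Fintype.card_fin] at this
    have := I.n_pos
    omega
  have : NeZero I.n := ⟨I.n_pos.ne'⟩
  let u : Fin I.n := ⟨0, I.n_pos⟩
  let w : Fin I.n := ⟨1, hn⟩
  have huw : u ≠ w := by simp [u, w]
  let x : Fin I.n → ℝ := fun v => (if v = u then 1 else 0) - if v = w then 1 else 0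
  have hx : 𝔼 v, x v = 0 := by simp [x, Fintype.expect_eq_sum_div_card]
  have h1 := avg_contracts hes hI.2.2 hx
  have h2 : 𝔼 v, (rotGraph hes).avg x v ^ 2 = 𝔼 v, x v ^ 2 := by
    rw [← (rotGraph hes).expect_avg fun v => x v ^ 2]
    simp [RotGraph.avg]
  have h3 : 0 < 𝔼 v, x v ^ 2 := by
    refine Finset.expect_pos' (fun v _ => sq_nonneg _) ⟨u, Finset.mem_univ _, ?_⟩
    simp [x, huw]
  rw [h2, Nat.cast_one, div_one] at h1
  have h4 : lam ^ 2 ≤ 1 / 4 := by nlinarith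
  nlinarith

end

/-! ### The choice of the parameters -/

theorem sum_pow_le {d : ℕ} (hd : 2 ≤ d) (t : ℕ) :
    2 * ∑ i ∈ Finset.range (t + 1), d ^ i ≤ d ^ (t + 2) := by
  induction t with
  | zero => simp; nlinarith
  | succ t ih =>
    rw [Finset.sum_range_succ, mul_add]
    have h1 : d ^ (t + 1 + 2) = d ^ (t + 2) * d := pow_succ _ _
    have h2 : d ^ (t + 2) = d ^ (t + 1) * d := pow_succ _ _
    have h3 : d ^ (t + 1) * 2 ≤ d ^ (t + 1) * d := by gcongr
    have h4 : d ^ (t + 2) * 2 ≤ d ^ (t + 2) * d := by gcongr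
    omega

theorem alphabetSize_le {W d : ℕ} (hW : 0 < W) (hd : 2 ≤ d) {ε : ℝ} (hε : 0 < ε) (hε1 : ε < 1) :
    (alphabetSize W d ⌈100 / ε⌉₊ : ℝ) ≤ (W : ℝ) ^ ((d : ℝ) ^ (103 / ε)) := by
  set t := ⌈100 / ε⌉₊
  have hW1 : (1 : ℝ) ≤ W := by exact_mod_cast hW
  have hd1 : (1 : ℝ) ≤ d := by exact_mod_cast (by omega : 1 ≤ d)
  have ht : (t : ℝ) + 2 ≤ 103 / ε := by
    have h1 : (t : ℝ) < 100 / ε + 1 := Nat.ceil_lt_add_one (by positivity)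
    have h2 : 1 ≤ 1 / ε := by rw [le_div_iff₀ hε]; linarith
    have h3 : 103 / ε = 100 / ε + 3 * (1 / ε) := by ring
    linarith
  have h1 : (alphabetSize W d t : ℝ) =
      (W : ℝ) ^ ((2 * ∑ i ∈ Finset.range (t + 1), d ^ i : ℕ) : ℝ) := by
    rw [Real.rpow_natCast, alphabetSize, Nat.cast_pow, Nat.cast_mul, ← sq, ← pow_mul]
  rw [h1]
  refine Real.rpow_le_rpow_of_exponent_le hW1 ?_
  calc ((2 * ∑ i ∈ Finset.range (t + 1), d ^ i : ℕ) : ℝ) ≤ ((d ^ (t + 2) : ℕ) : ℝ) :=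
        Nat.cast_le.2 (sum_pow_le hd t)
    _ = (d : ℝ) ^ ((t : ℝ) + 2) := by rw [Nat.cast_pow, ← Real.rpow_natCast]; push_cast; rfl
    _ ≤ _ := Real.rpow_le_rpow_of_exponent_le hd1 ht

theorem GapReducible.mono_right {c s s' t : ℝ} {W d : ℕ} {lam : ℝ} {c' : ℝ} {W' d' : ℕ} {lam' : ℝ}
    (h : GapReducible c s W d lam c' s' W' d' lam') (hs : s' ≤ t) :
    GapReducible c s W d lam c' t W' d' lam' := by
  obtain ⟨f, hf, h⟩ := h
  exact ⟨f, hf, fun I => ⟨(h I).1, fun hI => ((h I).2 hI).trans_le hs⟩⟩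

theorem GapReducible.of_isEmpty {c s s' : ℝ} {W d : ℕ} {lam : ℝ} {c' : ℝ} {W' d' : ℕ} {lam' : ℝ}
    (h : IsEmpty (ExpanderInstance W d lam)) : GapReducible c s W d lam c' s' W' d' lam' :=
  ⟨fun I => h.elim I, ⟨.id, 0, fun I => h.elim I⟩, fun I => h.elim I⟩

/-- Gap amplification for 2-CSP Reconfiguration on expanders. -/
theorem lemma3p3 :
    ∃ (C : ℝ) (W' : ℝ → ℕ → ℕ → ℕ), 0 < C ∧
      (∀ (ε : ℝ) (W d : ℕ), 0 < ε → ε < 1 → 0 < W → 0 < d →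
        0 < W' ε W d ∧ (W' ε W d : ℝ) ≤ (W : ℝ) ^ ((d : ℝ) ^ (C / ε))) ∧
      ∀ (ε : ℝ) (d : ℕ) (lam : ℝ), 0 < ε → ε < 1 → 0 < d → 0 < lam → lam ≤ d / 2 →
        ∃ (d' : ℕ) (lam' : ℝ), 0 < d' ∧ 0 ≤ lam' ∧ lam' < d' ∧
          lam' / d' ≤ (4 : ℝ) ^ 100 / 100 * (lam / d) ∧
          ∀ W : ℕ, 0 < W →
            GapReducible 1 (1 - ε) W d lam
              1 (1 - 0.0294 / (3 + 2 * (d / (d - lam)))) (W' ε W d) d' lam' := by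
  -- for `d = 1` the bound on the alphabet size is just `W`, but there are no instances
  refine ⟨103, fun ε W d => if d = 1 then W else alphabetSize W d ⌈100 / ε⌉₊, by norm_num, ?_, ?_⟩
  · intro ε W d hε hε1 hW hd
    by_cases hd1 : d = 1
    · simp [hd1, hW]
    · simp only [if_neg hd1]
      exact ⟨alphabetSize_pos hW, alphabetSize_le hW (by omega) hε hε1⟩
  · intro ε d lam hε hε1 hd h0 hlam
    have hd' : (0 : ℝ) < d := Nat.cast_pos.2 hd
    have ht : 0 < ⌈100 / ε⌉₊ := Nat.ceil_pos.2 (by positivity)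
    have hm : 0 < 2 * ((2 * ⌈100 / ε⌉₊ - 1) * d ^ (2 * ⌈100 / ε⌉₊ - 1)) := by
      have : 0 < 2 * ⌈100 / ε⌉₊ - 1 := by omega
      positivity
    have hm' : (0 : ℝ) < (2 * ((2 * ⌈100 / ε⌉₊ - 1) * d ^ (2 * ⌈100 / ε⌉₊ - 1)) : ℕ) :=
      Nat.cast_pos.2 hm
    have hr : lam / d ≤ 1 / 2 := by rw [div_le_iff₀ hd']; linarith
    have hr0 : 0 < lam / d := by positivity
    refine ⟨2 * ((2 * ⌈100 / ε⌉₊ - 1) * d ^ (2 * ⌈100 / ε⌉₊ - 1)), _ * (lam / d), hm,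
      mul_nonneg hm'.le hr0.le, mul_lt_of_lt_one_right hm' (by linarith), ?_, fun W hW => ?_⟩
    · rw [mul_div_cancel_left₀ _ hm'.ne']
      exact le_mul_of_one_le_left hr0.le (by norm_num)
    · by_cases hd1 : d = 1
      · subst hd1
        exact .of_isEmpty (isEmpty_expanderInstance_one h0.le (by simpa using hlam))
      · have : NeZero W := ⟨hW.ne'⟩
        have : NeZero d := ⟨hd.ne'⟩
        simp only [if_neg hd1]
        refine (gapReducible_amplify h0.le hlam hε hε1 (Nat.le_ceil _)).mono_right ?_
        -- `d / (d - lam)` is at least one, and `0.0294 / 5 = 0.00588`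
        have h1 : 1 ≤ d / (d - lam) := by rw [le_div_iff₀ (by linarith)]; linarith
        have h2 : 0.0294 / (3 + 2 * (d / (d - lam))) ≤ 0.00588 := by
          rw [div_le_iff₀ (by linarith)]; linarith
        linarith
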